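/- For a finite graph $H$ write $v_H$ for its number of vertices and let $P_H(x)=\sum_k i_k(H)x^k$ be its independence polynomial, where $i_k(H)$ is the number of independent sets of $H$ with exactly $k$ vertices. Let $G_{n,p}$ be the binomial random graph on $n$ vertices with edge probability $p$, and let $X=X_{n,p}^H$ be the number of copies of $H$ in $G_{n,p}$, i.e. the number of (not necessarily induced) subgraphs of $G_{n,p}$ isomorphic to $H$. For sequences, $a_n\ll b_n$ means $a_n/b_n\to 0$. **Theorem.** Let $\Delta\ge 2$ be an integer, let $H$ be a finite, connected, nonbipartite, $\Delta$-regular graph, and let $\delta>0$ be fixed. Then the equation $P_H(\theta)=1+\delta$ has a unique positive solution $\theta=\theta(H,\delta)$, and for every $p=p(n)\in[0,1]$ satisfying $$n^{-1}(\log n)^{\Delta v_H^2}\ll p^{\Delta/2}\ll 1$$ we have $$\lim_{n\to\infty}\frac{-\log\mathbb P\big(X\ge(1+\delta)\,\mathbb E[X]\big)}{n^2p^\Delta\log(1/p)}=\begin{cases}\delta^{2/v_H}/2 & \text{if } np^\Delta\to 0,\\ \min\{\delta^{2/v_H}/2,\ \theta\} & \text{if } np^\Delta\to\infty.\end{cases}$$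 Additionally, the assumption that $H$ is nonbipartite can be dropped if $p^{\Delta/2}\ge n^{-1/2-o(1)}$, that is, if there is a sequence $\varepsilon_n\to 0$ with $p(n)^{\Delta/2}\ge n^{-1/2-\varepsilon_n}$ for all sufficiently large $n$. -/

import Mathlib

open MeasureTheory Filter Asymptotics Topology
open scoped SimpleGraph unitInterval

/-- The independence polynomial `P_H(x) = ∑ₖ iₖ(H) xᵏ`, where `iₖ(H)` is the number of independent
sets of `H` with exactly `k` vertices (so the constant term is `i₀(H) = 1`). -/
noncomputable def independencePolynomial {V : Type*} [Fintype V] [DecidableEq V]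
    (H : SimpleGraph V) [DecidableRel H.Adj] : Polynomial ℝ :=
  ∑ k ∈ Finset.range (Fintype.card V + 1),
    Polynomial.C ((H.indepSetFinset k).card : ℝ) * Polynomial.X ^ k

/-- The number `X` of copies of `H` in a graph on the vertex set `Fin n`: the number of
(not necessarily induced) subgraphs isomorphic to `H`. -/
noncomputable def subgraphCount {V : Type*} (H : SimpleGraph V) (n : ℕ) (G : SimpleGraph (Fin n)) :
    ℝ :=
  (G.copyCount H : ℝ)

/-- The expected number of copies of `H` in the binomial random graph `G(n, p)`. -/
noncomputable def expectedCount {V : Type*} (H : SimpleGraph V) (n : ℕ) (p : I) : ℝ :=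
  ∫ G, subgraphCount H n G ∂G(Fin n, p)

/-- The upper tail probability `ℙ(X ≥ (1 + δ) 𝔼[X])` in the binomial random graph `G(n, p)`. -/
noncomputable def upperTailProb {V : Type*} (H : SimpleGraph V) (δ : ℝ) (n : ℕ) (p : I) : ℝ :=
  G(Fin n, p).real {G | (1 + δ) * expectedCount H n p ≤ subgraphCount H n G}

/-! The upper tail is governed by the cheapest edge set `S` whose presence raises the conditional
expected number of copies of `H` to about `(1 + δ) 𝔼[X]`; forcing `S` costs `#S * log (1 / p)` in
the exponent. Embeddings replace copies throughout, the two counts differing by the factor `|Aut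
H|`, and `condSum H S p` is the expected number of embeddings given `S`. Write `v` and `e(H)` for
the numbers of vertices and edges of `H`, `L = log (1 / p)` and `q = edens S`.

Lower bound on the probability. A clique on about `δ^(1/v) n p^(Δ/2)` vertices adds `δ 𝔼[X]` and has
about `(δ^(2/v) / 2) n² p^Δ` edges (`exists_clique_planting`). A hub, that is about `θ n p^Δ`
vertices joined to everything, multiplies the expectation by about `P_H(θ)`: the vertices of `H`
sent into the hub may form any independent set `A`, and each such `A` saves `Δ #A` factors `p`
(`exists_hub_planting`). The hub is available only if `n p^Δ → ∞`; otherwise its prescribed size is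
not a large number.

No small set does better. Expanding `condSum` over the subgraphs `J` of `H` mapped into `S` gives
homomorphism densities, which Finner's inequality bounds by `q^(#J/Δ)`, the order of `p^#J` if `S`
has `O(n² p^Δ)` edges. Variants of that inequality, restricted to degree conditions, show that all
homomorphisms are negligible except those of full stars at an independent set sent to vertices of
high degree, and those of the whole of `H` avoiding such vertices (`hom_structure`). The relative
gain is thus at most `indepSum H x + y^(v/2)` up to small errors, where `x + y/2` is essentially at
most `#S / (n² p^Δ)`, and convexity puts the maximum at a pure hub or a pure clique
(`indepSum_add_rpow_le`).

Upper bound on the probability. A truncated moment of order `n² p^Δ L` shows that a large count is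
unlikely unless the graph contains a core, an edge set with large conditional expectation in which
every edge matters (`upper_tail_le_cores`). A union bound over cores suffices because only
`p^(-o(m))` cores have `m` edges (`eventually_card_cores_le`): apart from few edges, a core lives on
vertices of large degree and on pairs with a large product of degrees, so a short record of the
degrees nearly determines it. If `n p^Δ` is small, edges at vertices of tiny degree must be excluded
too; this uses Finner weights perturbed along an odd closed walk (`expect_hom_dens_lt_le`), hence a
nonbipartite `H`, and the logarithmic factor in the lower bound on `p`. -/

namespace UpperTail

open Finset
open scoped BigOperators

set_option linter.unusedSectionVars false

/-! ### Finner's inequality on finite product spaces. -/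

section Finner

variable {V Ω ι : Type*} [Fintype V] [DecidableEq V] [Fintype Ω] [Nonempty Ω]

/-- Hölder's inequality for averages, with weights of total at most one. -/
lemma expect_prod_rpow_le (t : Finset ι) (G : ι → Ω → ℝ) (hG : ∀ j ∈ t, ∀ u, 0 ≤ G j u)
    (c : ι → ℝ) (hc : ∀ j ∈ t, 0 < c j) (hsum : ∑ j ∈ t, c j ≤ 1) :
    𝔼 u, ∏ j ∈ t, G j u ^ c j ≤ ∏ j ∈ t, (𝔼 u, G j u) ^ c j := by
  classical
  have hE : ∀ j ∈ t, 0 ≤ 𝔼 u, G j u := fun j hj => expect_nonneg fun u _ => hG j hj u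
  by_cases h0 : ∃ j ∈ t, 𝔼 u, G j u = 0
  · obtain ⟨j, hj, hj0⟩ := h0
    have hz : ∀ u, G j u = 0 := by
      intro u
      have := (Finset.expect_eq_zero_iff_of_nonneg (fun u _ => hG j hj u)).1 hj0
      exact this u (mem_univ u)
    have : ∀ u, ∏ j ∈ t, G j u ^ c j = 0 := fun u =>
      prod_eq_zero hj (by rw [hz u, Real.zero_rpow (hc j hj).ne'])
    simp only [this, expect_const_zero]
    exact prod_nonneg fun j hj => Real.rpow_nonneg (hE j hj) _
  · push Not at h0
    have hpos : ∀ j ∈ t, 0 < 𝔼 u, G j u := fun j hj => lt_of_le_of_ne (hE j hj) (h0 j hj).symm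
    have key : ∀ u, ∏ j ∈ t, (G j u / 𝔼 u, G j u) ^ c j ≤
        ∑ j ∈ t, c j * (G j u / 𝔼 u, G j u) + (1 - ∑ j ∈ t, c j) := by
      intro u
      -- The extra index `none` carries the constant `1` with the missing weight `1 - ∑ c j`, so
      -- that the weights of the arithmetic-geometric mean inequality add up to one.
      have := Real.geom_mean_le_arith_mean_weighted (insertNone t)
        (fun o => o.elim (1 - ∑ j ∈ t, c j) c)
        (fun o => o.elim 1 fun j => G j u / 𝔼 u, G j u) ?_ ?_ ?_
      · simpa [Finset.prod_insertNone, Finset.sum_insertNone, add_comm] using this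
      · intro o ho
        cases o with
        | none => simpa using hsum
        | some j => exact (hc j (by simpa using ho)).le
      · simp [Finset.sum_insertNone]
      · intro o ho
        cases o with
        | none => simp
        | some j =>
          have hj : j ∈ t := by simpa using ho
          exact div_nonneg (hG j hj u) (hE j hj)
    have hprod : ∀ u, ∏ j ∈ t, G j u ^ c j =
        (∏ j ∈ t, (G j u / 𝔼 u, G j u) ^ c j) * ∏ j ∈ t, (𝔼 u, G j u) ^ c j := by
      intro u
      rw [← prod_mul_distrib]
      refine prod_congr rfl fun j hj => ?_
      rw [← Real.mul_rpow (div_nonneg (hG j hj u) (hE j hj)) (hE j hj),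
        div_mul_cancel₀ _ (hpos j hj).ne']
    simp_rw [hprod]
    rw [← expect_mul]
    refine mul_le_of_le_one_left (prod_nonneg fun j hj => Real.rpow_nonneg (hE j hj) _) ?_
    refine (expect_le_expect fun u _ => key u).trans ?_
    rw [expect_add_distrib, expect_const univ_nonempty, expect_sum_comm]
    have : ∀ j ∈ t, 𝔼 u, c j * (G j u / 𝔼 u, G j u) = c j := by
      intro j hj
      rw [← mul_expect, ← expect_div, div_self (hpos j hj).ne', mul_one]
    rw [sum_congr rfl this]
    linarith

/-- Resampling one coordinate does not change an average. -/
lemma expect_update (a : V) (F : (V → Ω) → ℝ) :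
    𝔼 φ : V → Ω, 𝔼 u : Ω, F (Function.update φ a u) = 𝔼 φ, F φ := by
  classical
  rw [← expect_product' univ univ (fun φ u => F (Function.update φ a u))]
  have h2 : 𝔼 φ, F φ = 𝔼 x ∈ (univ : Finset (V → Ω)) ×ˢ (univ : Finset Ω), F x.1 := by
    rw [expect_product' univ univ (fun φ _ => F φ)]
    simp
  rw [h2]
  -- Exchanging the new value with the coordinate it replaces is an involution of the product.
  refine Finset.expect_nbij' (fun x => (Function.update x.1 a x.2, x.1 a))
    (fun x => (Function.update x.1 a x.2, x.1 a)) ?_ ?_ ?_ ?_ ?_ <;> simp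

lemma expect_eval (a : V) (g : Ω → ℝ) : 𝔼 φ : V → Ω, g (φ a) = 𝔼 u, g u := by
  rw [← expect_update a fun φ => g (φ a)]
  simp

lemma expect_eval₂ {a b : V} (hab : a ≠ b) (g : Ω → Ω → ℝ) :
    𝔼 φ : V → Ω, g (φ a) (φ b) = 𝔼 u, 𝔼 v, g u v := by
  rw [← expect_update b fun φ => g (φ a) (φ b)]
  simp only [Function.update_self, Function.update_of_ne hab]
  exact expect_eval a fun u => 𝔼 v, g u v

/-- The average of `F` over the coordinates in `s`. -/
noncomputable def partialAvg (s : Finset V) (F : (V → Ω) → ℝ) (φ : V → Ω) : ℝ :=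
  𝔼 ψ : V → Ω, F (s.piecewise ψ φ)

/-- `F` does not depend on the coordinate `a`. -/
def IndepOf (F : (V → Ω) → ℝ) (a : V) : Prop := ∀ φ u, F (Function.update φ a u) = F φ

lemma piecewise_update_of_notMem {s : Finset V} {b : V} (hb : b ∉ s) (ψ φ : V → Ω) (u : Ω) :
    s.piecewise ψ (Function.update φ b u) = Function.update (s.piecewise ψ φ) b u := by
  ext x
  by_cases hx : x = b
  · subst hx; simp [Finset.piecewise, hb]
  · simp [Finset.piecewise, hx]

lemma partialAvg_insert {s : Finset V} {a : V} (ha : a ∉ s) (F : (V → Ω) → ℝ) (φ : V → Ω) :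
    partialAvg (insert a s) F φ = 𝔼 u, partialAvg s F (Function.update φ a u) := by
  unfold partialAvg
  rw [expect_comm, ← expect_update a]
  refine expect_congr rfl fun ψ _ => expect_congr rfl fun u _ => ?_
  congr 1
  ext x
  by_cases hx : x = a
  · subst hx; simp [Finset.piecewise, ha]
  · simp [Finset.piecewise, hx]

lemma IndepOf.partialAvg {s : Finset V} {a : V} (ha : a ∉ s) {F : (V → Ω) → ℝ}
    (h : IndepOf F a) : IndepOf (partialAvg s F) a := by
  intro φ u
  unfold UpperTail.partialAvg
  refine expect_congr rfl fun ψ _ => ?_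
  rw [piecewise_update_of_notMem ha, h]

lemma partialAvg_nonneg {s : Finset V} {F : (V → Ω) → ℝ} (h : ∀ φ, 0 ≤ F φ) (φ : V → Ω) :
    0 ≤ partialAvg s F φ := expect_nonneg fun _ _ => h _

/-- **Finner's inequality**, averaged over the coordinates in `s` only. -/
theorem finner (s : Finset V) (t : Finset ι) (F : ι → (V → Ω) → ℝ)
    (hF : ∀ j ∈ t, ∀ φ, 0 ≤ F j φ) (c : ι → ℝ) (hc : ∀ j ∈ t, 0 < c j)
    (dep : ι → Finset V) (hdep : ∀ j ∈ t, ∀ a ∉ dep j, IndepOf (F j) a)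
    (hsum : ∀ a ∈ s, ∑ j ∈ t with a ∈ dep j, c j ≤ 1) :
    𝔼 φ, ∏ j ∈ t, F j φ ^ c j ≤ 𝔼 φ, ∏ j ∈ t, partialAvg s (F j) φ ^ c j := by
  induction s using Finset.induction_on with
  | empty =>
    refine le_of_eq (expect_congr rfl fun φ _ => prod_congr rfl fun j _ => ?_)
    simp [partialAvg]
  | insert a s ha ih =>
    refine (ih fun b hb => hsum b (mem_insert_of_mem hb)).trans ?_
    -- With all coordinates but `a` frozen, the factors that do not depend on `a` are constants, and
    -- Hölder's inequality applies to the others, whose weights total at most one.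
    rw [← expect_update a]
    refine expect_le_expect fun φ _ => ?_
    have hsplit : ∀ g : ι → ℝ, ∏ j ∈ t, g j =
        (∏ j ∈ t with a ∈ dep j, g j) * ∏ j ∈ t with ¬ a ∈ dep j, g j := fun g =>
      (prod_filter_mul_prod_filter_not _ _ _).symm
    have hconst : ∀ u, ∏ j ∈ t with ¬ a ∈ dep j, partialAvg s (F j) (Function.update φ a u) ^ c j
        = ∏ j ∈ t with ¬ a ∈ dep j, partialAvg (insert a s) (F j) φ ^ c j := by
      intro u
      refine prod_congr rfl fun j hj => ?_
      rw [mem_filter] at hj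
      have h := (hdep j hj.1 a hj.2).partialAvg ha
      rw [partialAvg_insert ha, h]
      congr 1
      rw [expect_congr rfl fun u _ => h φ u]
      simp
    simp_rw [hsplit fun j => partialAvg s (F j) (Function.update φ a _) ^ c j, hconst]
    rw [← expect_mul, hsplit]
    refine mul_le_mul_of_nonneg_right ?_ (prod_nonneg fun j hj => Real.rpow_nonneg
      (partialAvg_nonneg (hF j (mem_filter.1 hj).1) _) _)
    simp_rw [partialAvg_insert ha]
    refine expect_prod_rpow_le _ _ ?_ c ?_ (hsum a (mem_insert_self a s))
    · exact fun j hj u => partialAvg_nonneg (hF j (mem_filter.1 hj).1) _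
    · exact fun j hj => hc j (mem_filter.1 hj).1

lemma partialAvg_of_indep {s : Finset V} {F : (V → Ω) → ℝ}
    (f : (V → Ω) → ℝ) (h : ∀ ψ φ, F (s.piecewise ψ φ) = f φ) (φ : V → Ω) :
    partialAvg s F φ = f φ := by
  unfold partialAvg
  simp [h]

lemma partialAvg_pair_mem_mem {s : Finset V} {a b : V} (hab : a ≠ b) (ha : a ∈ s) (hb : b ∈ s)
    (g : Ω → Ω → ℝ) (φ : V → Ω) :
    partialAvg s (fun φ => g (φ a) (φ b)) φ = 𝔼 u, 𝔼 v, g u v := by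
  unfold partialAvg
  simp only [Finset.piecewise_eq_of_mem _ _ _ ha, Finset.piecewise_eq_of_mem _ _ _ hb]
  exact expect_eval₂ hab g

lemma partialAvg_pair_notMem_mem {s : Finset V} {a b : V} (ha : a ∉ s) (hb : b ∈ s)
    (g : Ω → Ω → ℝ) (φ : V → Ω) :
    partialAvg s (fun φ => g (φ a) (φ b)) φ = 𝔼 v, g (φ a) v := by
  unfold partialAvg
  simp only [Finset.piecewise_eq_of_notMem _ _ _ ha, Finset.piecewise_eq_of_mem _ _ _ hb]
  exact expect_eval b fun v => g (φ a) v

lemma partialAvg_pair_notMem_notMem {s : Finset V} {a b : V} (ha : a ∉ s) (hb : b ∉ s)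
    (g : Ω → Ω → ℝ) (φ : V → Ω) :
    partialAvg s (fun φ => g (φ a) (φ b)) φ = g (φ a) (φ b) := by
  unfold partialAvg
  simp only [Finset.piecewise_eq_of_notMem _ _ _ ha, Finset.piecewise_eq_of_notMem _ _ _ hb]
  simp

end Finner

/-! ### Real-valued indicators. -/

/-- The `0`-`1`-valued indicator of a proposition. -/
noncomputable def ind (P : Prop) : ℝ := open Classical in if P then 1 else 0

lemma ind_of_true {P : Prop} (h : P) : ind P = 1 := if_pos h
lemma ind_of_false {P : Prop} (h : ¬ P) : ind P = 0 := if_neg h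
lemma ind_nonneg (P : Prop) : 0 ≤ ind P := by unfold ind; split_ifs <;> norm_num
lemma ind_le_one (P : Prop) : ind P ≤ 1 := by unfold ind; split_ifs <;> norm_num
lemma ind_mono {P Q : Prop} (h : P → Q) : ind P ≤ ind Q := by
  by_cases hP : P
  · rw [ind_of_true hP, ind_of_true (h hP)]
  · rw [ind_of_false hP]; exact ind_nonneg Q
lemma ind_and (P Q : Prop) : ind (P ∧ Q) = ind P * ind Q := by
  by_cases hP : P <;> by_cases hQ : Q <;> simp [ind, hP, hQ]
lemma ind_rpow (P : Prop) {c : ℝ} (hc : 0 < c) : ind P ^ c = ind P := by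
  by_cases hP : P
  · simp [ind, hP]
  · simp [ind, hP, Real.zero_rpow hc.ne']
lemma ind_prod {ι : Type*} (t : Finset ι) (P : ι → Prop) :
    ∏ j ∈ t, ind (P j) = ind (∀ j ∈ t, P j) := by
  by_cases h : ∀ j ∈ t, P j
  · rw [ind_of_true h]; exact prod_eq_one fun j hj => ind_of_true (h j hj)
  · rw [ind_of_false h]; push Not at h
    obtain ⟨j, hj, hP⟩ := h
    exact prod_eq_zero hj (ind_of_false hP)
lemma ind_or_le (P Q : Prop) : ind (P ∨ Q) ≤ ind P + ind Q := by
  by_cases hP : P <;> by_cases hQ : Q <;> simp [ind, hP, hQ]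
lemma ind_congr {P Q : Prop} (h : P ↔ Q) : ind P = ind Q := by rw [propext h]

/-! ### Homomorphism densities under degree conditions. -/

section Kernel

variable {V Ω : Type*} [Fintype V] [DecidableEq V] [Fintype Ω] [Nonempty Ω]

/-- The adjacency kernel of an edge set. -/
noncomputable def adj (S : Finset (Sym2 Ω)) (u v : Ω) : ℝ := ind (s(u, v) ∈ S)

/-- The normalized degree of a vertex. -/
noncomputable def dens (S : Finset (Sym2 Ω)) (u : Ω) : ℝ := 𝔼 v, adj S u v

/-- The edge density. -/
noncomputable def edens (S : Finset (Sym2 Ω)) : ℝ := 𝔼 u, dens S u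

/-- `φ` maps all edges in `J` to edges in `S`. -/
def Hom (S : Finset (Sym2 Ω)) (J : Finset (Sym2 V)) (φ : V → Ω) : Prop := ∀ e ∈ J, e.map φ ∈ S

/-- The number of edges of `J` at `a`. -/
def edeg (J : Finset (Sym2 V)) (a : V) : ℕ := #{e ∈ J | a ∈ e}

lemma adj_nonneg (S : Finset (Sym2 Ω)) (u v : Ω) : 0 ≤ adj S u v := ind_nonneg _
lemma adj_comm (S : Finset (Sym2 Ω)) (u v : Ω) : adj S u v = adj S v u := by
  unfold adj; rw [Sym2.eq_swap]
lemma dens_nonneg (S : Finset (Sym2 Ω)) (u : Ω) : 0 ≤ dens S u :=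
  expect_nonneg fun _ _ => adj_nonneg _ _ _
lemma edens_nonneg (S : Finset (Sym2 Ω)) : 0 ≤ edens S :=
  expect_nonneg fun _ _ => dens_nonneg _ _

/-- The indicator that the edge `e` is mapped into `S`. -/
noncomputable def edgeInd (S : Finset (Sym2 Ω)) (e : Sym2 V) (φ : V → Ω) : ℝ := ind (e.map φ ∈ S)

lemma edgeInd_mk (S : Finset (Sym2 Ω)) (a b : V) :
    edgeInd S s(a, b) = fun φ => adj S (φ a) (φ b) := rfl

lemma map_update_of_notMem {e : Sym2 V} {a : V} (ha : a ∉ e) (φ : V → Ω) (u : Ω) :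
    e.map (Function.update φ a u) = e.map φ :=
  Sym2.map_congr fun x hx => by
    rw [Function.update_of_ne]; rintro rfl; exact ha hx

lemma partialAvg_edgeInd_of_subset (S : Finset (Sym2 Ω)) {e : Sym2 V} (he : ¬ e.IsDiag)
    {s : Finset V} (hs : ∀ x ∈ e, x ∈ s) (φ : V → Ω) :
    partialAvg s (edgeInd S e) φ = edens S := by
  induction e using Sym2.ind with
  | _ a b =>
    rw [edgeInd_mk, partialAvg_pair_mem_mem (by simpa using he) (hs a (by simp)) (hs b (by simp))]
    rfl

lemma partialAvg_edgeInd_of_mem (S : Finset (Sym2 Ω)) {a b : V}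
    {s : Finset V} (ha : a ∉ s) (hb : b ∈ s) (φ : V → Ω) :
    partialAvg s (edgeInd S s(a, b)) φ = dens S (φ a) := by
  rw [edgeInd_mk, partialAvg_pair_notMem_mem ha hb]
  rfl

lemma partialAvg_edgeInd_of_mem' (S : Finset (Sym2 Ω)) {a : V} {e : Sym2 V} (hae : a ∈ e)
    {s : Finset V} (ha : a ∉ s) (hb : ∀ x ∈ e, x ≠ a → x ∈ s) (he : ¬ e.IsDiag) (φ : V → Ω) :
    partialAvg s (edgeInd S e) φ = dens S (φ a) := by
  obtain ⟨b, rfl⟩ := hae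
  refine partialAvg_edgeInd_of_mem S ha (hb b (by simp) ?_) φ
  rintro rfl; simp at he

/-- Finner's inequality for homomorphisms satisfying a condition on the coordinates outside `s`. -/
lemma finner_hom (S : Finset (Sym2 Ω)) (J : Finset (Sym2 V)) (s : Finset V) (c : Sym2 V → ℝ)
    (hc : ∀ e ∈ J, 0 < c e) (hsum : ∀ a ∈ s, ∑ e ∈ J with a ∈ e, c e ≤ 1) (P : (V → Ω) → Prop)
    (hP : ∀ φ, ∀ a ∈ s, ∀ u, P (Function.update φ a u) ↔ P φ) :
    𝔼 φ, ind (Hom S J φ ∧ P φ) ≤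
      𝔼 φ, ind (P φ) * ∏ e ∈ J, partialAvg s (edgeInd S e) φ ^ c e := by
  classical
  have hPpw : ∀ ψ φ : V → Ω, P (s.piecewise ψ φ) ↔ P φ := by
    intro ψ φ
    have : ∀ t ⊆ s, P (t.piecewise ψ φ) ↔ P φ := by
      intro t
      induction t using Finset.induction_on with
      | empty => simp
      | insert a t ha ih =>
        intro hts
        rw [Finset.piecewise_insert, hP _ a (hts (mem_insert_self a t)),
          ih fun x hx => hts (mem_insert_of_mem hx)]
    exact this s subset_rfl
  -- The event `P` enters as a further factor of weight one, at the index `none`. It depends only on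
  -- coordinates outside `s`, where the weights are unconstrained.
  have key := finner s (insertNone J)
    (fun o φ => o.elim (ind (P φ)) fun e => edgeInd S e φ)
    (by rintro (_ | e) _ φ <;> exact ind_nonneg _) (fun o => o.elim 1 c)
    (by
      rintro (_ | e) h
      · exact one_pos
      · exact hc e (by simpa using h))
    (fun o => o.elim sᶜ fun e => univ.filter (· ∈ e))
    (by
      rintro (_ | e) h a ha φ u
      · exact ind_congr (hP φ a (by simpa using ha) u)
      · refine congrArg (fun x => ind (x ∈ S)) (map_update_of_notMem (by simpa using ha) φ u))
    (by
      intro a ha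
      rw [sum_filter, sum_insertNone]
      simp only [Option.elim, mem_compl, ha, not_true_eq_false, if_false, zero_add, mem_filter,
        mem_univ, true_and]
      rw [← sum_filter]
      exact hsum a ha)
  simp only [prod_insertNone, Option.elim, Real.rpow_one] at key
  refine le_trans (le_of_eq ?_) (key.trans (le_of_eq ?_))
  · refine expect_congr rfl fun φ _ => ?_
    rw [ind_and, mul_comm]
    congr 1
    rw [show Hom S J φ = ∀ e ∈ J, e.map φ ∈ S from rfl, ← ind_prod]
    exact prod_congr rfl fun e he => (ind_rpow _ (hc e he)).symm
  · refine expect_congr rfl fun φ _ => ?_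
    congr 1
    exact partialAvg_of_indep (fun φ => ind (P φ)) (fun ψ φ => ind_congr (hPpw ψ φ)) φ

/-- Finner's inequality for homomorphisms with a condition on every edge. -/
lemma finner_edge {Δ : ℕ} (hΔ : 0 < Δ) (J : Finset (Sym2 V))
    (hdeg : ∀ a, edeg J a ≤ Δ) (Q : Sym2 V → (V → Ω) → Prop)
    (hQ : ∀ e ∈ J, ∀ a ∉ e, ∀ φ u, Q e (Function.update φ a u) ↔ Q e φ)
    (r : Sym2 V → ℝ) (hr : ∀ e ∈ J, 𝔼 φ, ind (Q e φ) ≤ r e) :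
    𝔼 φ, ind (∀ e ∈ J, Q e φ) ≤ ∏ e ∈ J, r e ^ (1 / (Δ : ℝ)) := by
  have hΔ' : (0 : ℝ) < Δ := by exact_mod_cast hΔ
  have key := finner univ J (fun e φ => ind (Q e φ)) (fun _ _ _ => ind_nonneg _)
    (fun _ => 1 / (Δ : ℝ)) (fun _ _ => by positivity) (fun e => {a | a ∈ e})
    (by
      intro e he a ha φ u
      exact ind_congr (hQ e he a (by simpa using ha) φ u))
    (by
      intro a _
      simp only [mem_filter, mem_univ, true_and, sum_const, nsmul_eq_mul]
      rw [mul_one_div, div_le_one hΔ']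
      exact_mod_cast hdeg a)
  refine le_trans (le_of_eq ?_) (key.trans ?_)
  · refine expect_congr rfl fun φ _ => ?_
    rw [← ind_prod]
    exact prod_congr rfl fun e _ => (ind_rpow _ (by positivity)).symm
  · have : ∀ φ : V → Ω, ∀ e ∈ J, partialAvg univ (fun φ => ind (Q e φ)) φ ≤ r e := by
      intro φ e he
      refine le_trans (le_of_eq ?_) (hr e he)
      unfold partialAvg
      simp
    refine (expect_le_expect fun φ _ => prod_le_prod (fun e _ => Real.rpow_nonneg
      (partialAvg_nonneg (fun _ => ind_nonneg _) _) _) fun e he => Real.rpow_le_rpow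
      (partialAvg_nonneg (fun _ => ind_nonneg _) _) (this φ e he) (by positivity)).trans ?_
    simp

lemma expect_edgeInd (S : Finset (Sym2 Ω)) {e : Sym2 V} (he : ¬ e.IsDiag) :
    𝔼 φ : V → Ω, ind (e.map φ ∈ S) = edens S := by
  obtain ⟨φ⟩ : Nonempty (V → Ω) := inferInstance
  rw [← partialAvg_edgeInd_of_subset S he (s := univ) (by simp) φ]
  unfold partialAvg
  simp [edgeInd]

/-- The number of homomorphisms is at most what the edge density predicts. -/
lemma expect_hom_le (S : Finset (Sym2 Ω)) {Δ : ℕ} (hΔ : 0 < Δ) (J : Finset (Sym2 V))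
    (hJ : ∀ e ∈ J, ¬ e.IsDiag) (hdeg : ∀ a, edeg J a ≤ Δ) :
    𝔼 φ, ind (Hom S J φ) ≤ (edens S ^ (1 / (Δ : ℝ))) ^ #J := by
  refine (finner_edge hΔ J hdeg (fun e φ => e.map φ ∈ S) ?_ (fun _ => edens S)
    fun e he => (expect_edgeInd S (hJ e he)).le).trans (by simp)
  intro e _ a ha φ u
  rw [map_update_of_notMem ha]

/-- Homomorphisms that map a given edge into a sparse relation are rare. -/
lemma expect_hom_rel_le (S : Finset (Sym2 Ω)) {Δ : ℕ} (hΔ : 0 < Δ) (J : Finset (Sym2 V))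
    (hJ : ∀ e ∈ J, ¬ e.IsDiag) (hdeg : ∀ a, edeg J a ≤ Δ) {a b : V} (hab : s(a, b) ∈ J)
    (R : Ω → Ω → Prop) {r : ℝ} (hr : 𝔼 u, 𝔼 v, ind (s(u, v) ∈ S ∧ R u v) ≤ r) :
    𝔼 φ, ind (Hom S J φ ∧ R (φ a) (φ b)) ≤
      r ^ (1 / (Δ : ℝ)) * (edens S ^ (1 / (Δ : ℝ))) ^ (#J - 1) := by
  have hne : a ≠ b := by simpa using hJ _ hab
  refine le_trans ?_ ((finner_edge hΔ J hdeg
    (fun e φ => e.map φ ∈ S ∧ (e = s(a, b) → R (φ a) (φ b))) ?_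
    (fun e => if e = s(a, b) then r else edens S) ?_).trans (le_of_eq ?_))
  · refine expect_le_expect fun φ _ => ind_mono ?_
    rintro ⟨h, hR⟩ e he
    exact ⟨h e he, fun _ => hR⟩
  · intro e _ x hx φ u
    rw [map_update_of_notMem hx]
    refine and_congr_right fun _ => forall_congr' fun h => ?_
    subst h
    rw [Function.update_of_ne, Function.update_of_ne] <;> rintro rfl <;> simp at hx
  · intro e he
    split_ifs with h
    · subst h
      refine le_trans (le_of_eq ?_) hr
      rw [← expect_eval₂ hne fun u v => ind (s(u, v) ∈ S ∧ R u v)]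
      simp
    · simp only [h, false_imp_iff, and_true]
      exact (expect_edgeInd S (hJ e he)).le
  · rw [← mul_prod_erase J _ hab]
    congr 1
    · simp
    · rw [prod_congr rfl (g := fun _ => edens S ^ (1 / (Δ : ℝ)))]
      · rw [prod_const, card_erase_of_mem hab]
      · intro e he
        rw [if_neg (ne_of_mem_erase he)]

lemma sum_const_weight {Δ : ℕ} (hΔ : 0 < Δ) {J : Finset (Sym2 V)} (hdeg : ∀ a, edeg J a ≤ Δ)
    (a : V) : ∑ e ∈ J with a ∈ e, 1 / (Δ : ℝ) ≤ 1 := by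
  have hΔ' : (0 : ℝ) < Δ := by exact_mod_cast hΔ
  rw [sum_const, nsmul_eq_mul, mul_one_div, div_le_one hΔ']
  exact_mod_cast hdeg a

lemma mem_mk_of_both_mem {a b : V} (hne : a ≠ b) {e : Sym2 V} (ha : a ∈ e) (hb : b ∈ e) :
    e = s(a, b) := (Sym2.mem_and_mem_iff hne).1 ⟨ha, hb⟩

/-- Homomorphisms that map an edge with both ends of full degree to a pair with small product of
degrees are rare. -/
lemma expect_hom_prod_dens_le (S : Finset (Sym2 Ω)) {Δ : ℕ} (hΔ : 0 < Δ) (J : Finset (Sym2 V))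
    (hJ : ∀ e ∈ J, ¬ e.IsDiag) (hdeg : ∀ a, edeg J a ≤ Δ) {a b : V} (hab : s(a, b) ∈ J)
    (ha : edeg J a = Δ) (hb : edeg J b = Δ) {γ : ℝ} (hγ : 0 ≤ γ) :
    𝔼 φ, ind (Hom S J φ ∧ dens S (φ a) * dens S (φ b) < γ * edens S) ≤
      (γ ^ (1 / (Δ : ℝ))) ^ (Δ - 1) * (edens S ^ (1 / (Δ : ℝ))) ^ #J := by
  have hne : a ≠ b := by simpa using hJ _ hab
  have hΔ' : (0 : ℝ) < Δ := by exact_mod_cast hΔ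
  set q := edens S with hq
  have hq0 : 0 ≤ q := edens_nonneg S
  -- Only the coordinates other than `a` and `b` are averaged: the edge `ab` survives as an
  -- indicator, the other `Δ - 1` edges at each end leave powers of the two degrees, and every
  -- remaining edge leaves a power of the density. On the event, the product of the degrees is
  -- replaced by `γ * q`.
  set s : Finset V := (univ.erase a).erase b with hs
  have hs_iff : ∀ x, x ∈ s ↔ x ≠ b ∧ x ≠ a := by simp [hs]
  refine (finner_hom S J s (fun _ => 1 / (Δ : ℝ)) (fun _ _ => by positivity)
    (fun x _ => sum_const_weight hΔ hdeg x)
    (fun φ => dens S (φ a) * dens S (φ b) < γ * q) ?_).trans ?_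
  · intro φ x hx u
    rw [hs_iff] at hx
    rw [Function.update_of_ne (Ne.symm hx.2), Function.update_of_ne (Ne.symm hx.1)]
  set Ja := (J.erase s(a, b)).filter (a ∈ ·) with hJa
  set J' := (J.erase s(a, b)).filter (¬ a ∈ ·) with hJ'
  set Jb := J'.filter (b ∈ ·) with hJb
  set Jr := J'.filter (¬ b ∈ ·) with hJr
  have cJa : #Ja = Δ - 1 := by
    have : Ja = (J.filter (a ∈ ·)).erase s(a, b) := by rw [hJa, filter_erase]
    rw [this, card_erase_of_mem (by simp [hab])]
    rw [← ha]; rfl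
  have cJb : #Jb = Δ - 1 := by
    have : Jb = (J.filter (b ∈ ·)).erase s(a, b) := by
      ext e
      simp only [hJb, hJ', mem_filter, mem_erase]
      constructor
      · rintro ⟨⟨⟨h1, h2⟩, -⟩, h3⟩; exact ⟨h1, h2, h3⟩
      · rintro ⟨h1, h2, h3⟩
        exact ⟨⟨⟨h1, h2⟩, fun h => h1 (mem_mk_of_both_mem hne h h3)⟩, h3⟩
    rw [this, card_erase_of_mem (by simp [hab])]
    rw [← hb]; rfl
  have cJ : #J = 1 + (#Ja + (#Jb + #Jr)) := by
    rw [hJb, hJr, card_filter_add_card_filter_not, hJa, hJ', card_filter_add_card_filter_not,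
      card_erase_of_mem hab]
    have := card_pos.2 ⟨_, hab⟩
    omega
  have hprod : ∀ φ : V → Ω, ∏ e ∈ J, partialAvg s (edgeInd S e) φ ^ (1 / (Δ : ℝ)) =
      adj S (φ a) (φ b) * ((dens S (φ a) ^ (1 / (Δ : ℝ))) ^ (Δ - 1) *
        ((dens S (φ b) ^ (1 / (Δ : ℝ))) ^ (Δ - 1) * (q ^ (1 / (Δ : ℝ))) ^ #Jr)) := by
    intro φ
    rw [← mul_prod_erase J _ hab, ← prod_filter_mul_prod_filter_not (J.erase s(a, b)) (a ∈ ·),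
      ← hJa, ← hJ', ← prod_filter_mul_prod_filter_not J' (b ∈ ·), ← hJb, ← hJr]
    congr 1
    · rw [edgeInd_mk, partialAvg_pair_notMem_notMem (by simp [hs]) (by simp [hs])]
      exact ind_rpow _ (by positivity)
    congr 1
    · rw [prod_congr rfl (g := fun _ => dens S (φ a) ^ (1 / (Δ : ℝ))), prod_const, cJa]
      intro e he
      simp only [hJa, mem_filter, mem_erase] at he
      rw [partialAvg_edgeInd_of_mem' S he.2 (by simp [hs]) ?_ (hJ e he.1.2)]
      intro x hx hxa
      rw [hs_iff]
      refine ⟨?_, hxa⟩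
      rintro rfl
      exact he.1.1 (mem_mk_of_both_mem hne he.2 hx)
    congr 1
    · rw [prod_congr rfl (g := fun _ => dens S (φ b) ^ (1 / (Δ : ℝ))), prod_const, cJb]
      intro e he
      simp only [hJb, hJ', mem_filter, mem_erase] at he
      rw [partialAvg_edgeInd_of_mem' S he.2 (by simp [hs]) ?_ (hJ e he.1.1.2)]
      intro x hx hxb
      rw [hs_iff]
      refine ⟨hxb, ?_⟩
      rintro rfl
      exact he.1.2 hx
    · rw [prod_congr rfl (g := fun _ => q ^ (1 / (Δ : ℝ))), prod_const]
      intro e he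
      simp only [hJr, hJ', mem_filter, mem_erase] at he
      rw [partialAvg_edgeInd_of_subset S (hJ e he.1.1.2)]
      intro x hx
      rw [hs_iff]
      constructor <;> rintro rfl
      · exact he.2 hx
      · exact he.1.2 hx
  simp_rw [hprod]
  have hpt : ∀ φ : V → Ω, ind (dens S (φ a) * dens S (φ b) < γ * q) *
      (adj S (φ a) (φ b) * ((dens S (φ a) ^ (1 / (Δ : ℝ))) ^ (Δ - 1) *
        ((dens S (φ b) ^ (1 / (Δ : ℝ))) ^ (Δ - 1) * (q ^ (1 / (Δ : ℝ))) ^ #Jr))) ≤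
      adj S (φ a) (φ b) * (((γ * q) ^ (1 / (Δ : ℝ))) ^ (Δ - 1) * (q ^ (1 / (Δ : ℝ))) ^ #Jr) := by
    intro φ
    have hadj := adj_nonneg S (φ a) (φ b)
    have h1 := dens_nonneg S (φ a)
    have h2 := dens_nonneg S (φ b)
    by_cases h : dens S (φ a) * dens S (φ b) < γ * q
    · rw [ind_of_true h, one_mul]
      refine mul_le_mul_of_nonneg_left ?_ hadj
      rw [← mul_assoc, ← mul_pow, ← Real.mul_rpow h1 h2]
      gcongr
    · rw [ind_of_false h, zero_mul]
      positivity
  refine (expect_le_expect fun φ _ => hpt φ).trans (le_of_eq ?_)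
  rw [← expect_mul, expect_eval₂ hne (adj S)]
  change q * _ = _
  rw [Real.mul_rpow hγ hq0, cJ, cJa, cJb]
  have hqΔ : (q ^ (1 / (Δ : ℝ))) ^ Δ = q := by
    rw [← Real.rpow_natCast, ← Real.rpow_mul hq0, one_div, inv_mul_cancel₀ hΔ'.ne', Real.rpow_one]
  set z := q ^ (1 / (Δ : ℝ))
  have : (1 + (Δ - 1 + (Δ - 1 + #Jr))) = Δ + ((Δ - 1) + #Jr) := by omega
  rw [this, pow_add, hqΔ, pow_add, mul_pow]
  ring

/-- Homomorphisms that map a neighbour of a vertex of non-full degree to a vertex of small degree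
are rare. -/
lemma expect_hom_dens_le (S : Finset (Sym2 Ω)) {Δ : ℕ} (hΔ : 0 < Δ) (J : Finset (Sym2 V))
    (hJ : ∀ e ∈ J, ¬ e.IsDiag) (hdeg : ∀ a, edeg J a ≤ Δ) {a b : V} (hab : s(a, b) ∈ J)
    (hb : edeg J b < Δ) {η : ℝ} (hη : 0 ≤ η) :
    𝔼 φ, ind (Hom S J φ ∧ dens S (φ a) < η) ≤
      η ^ (1 / (Δ : ℝ)) * (edens S ^ (1 / (Δ : ℝ))) ^ #J := by
  have hne : a ≠ b := by simpa using hJ _ hab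
  have hΔ' : (0 : ℝ) < Δ := by exact_mod_cast hΔ
  set q := edens S with hq
  have hq0 : 0 ≤ q := edens_nonneg S
  set s : Finset V := univ.erase a with hs
  -- The spare weight at `b` is spent on doubling the weight of `ab`. An overload at `a` is harmless
  -- because `a` is not averaged; the surplus is a factor `dens S (φ a) ^ (1 / Δ)`, which the event
  -- bounds.
  set c : Sym2 V → ℝ := fun e => if e = s(a, b) then 2 / (Δ : ℝ) else 1 / (Δ : ℝ) with hc
  refine (finner_hom S J s c (fun e _ => by simp only [hc]; split_ifs <;> positivity) ?_
    (fun φ => dens S (φ a) < η) ?_).trans ?_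
  · intro x hx
    have hxa : x ≠ a := by simpa [hs] using hx
    have hc' : ∀ e, c e = 1 / (Δ : ℝ) + if e = s(a, b) then 1 / (Δ : ℝ) else 0 := by
      intro e; simp only [hc]; split_ifs <;> ring
    simp_rw [hc']
    rw [sum_add_distrib, sum_const, nsmul_eq_mul, sum_ite_eq']
    by_cases hxb : x = b
    · subst hxb
      rw [if_pos (by simp [hab]), ← add_one_mul, mul_one_div, div_le_one hΔ']
      exact_mod_cast hb
    · rw [if_neg (by simp [hxa, hxb]), add_zero, mul_one_div, div_le_one hΔ']
      exact_mod_cast hdeg x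
  · intro φ x hx u
    have hxa : x ≠ a := by simpa [hs] using hx
    rw [Function.update_of_ne hxa.symm]
  set Ja := (J.erase s(a, b)).filter (a ∈ ·) with hJa
  set J' := (J.erase s(a, b)).filter (¬ a ∈ ·) with hJ'
  have cJ : #J = 1 + (#Ja + #J') := by
    rw [hJa, hJ', card_filter_add_card_filter_not, card_erase_of_mem hab]
    have := card_pos.2 ⟨_, hab⟩
    omega
  have cJa : #Ja + 1 ≤ Δ := by
    have : Ja = (J.filter (a ∈ ·)).erase s(a, b) := by rw [hJa, filter_erase]
    rw [this, card_erase_of_mem (by simp [hab])]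
    have h1 : 0 < #(J.filter (a ∈ ·)) := card_pos.2 ⟨s(a, b), by simp [hab]⟩
    have h2 : #(J.filter (a ∈ ·)) ≤ Δ := hdeg a
    omega
  have hprod : ∀ φ : V → Ω, ∏ e ∈ J, partialAvg s (edgeInd S e) φ ^ c e =
      dens S (φ a) ^ (2 / (Δ : ℝ)) * ((dens S (φ a) ^ (1 / (Δ : ℝ))) ^ #Ja *
        (q ^ (1 / (Δ : ℝ))) ^ #J') := by
    intro φ
    rw [← mul_prod_erase J _ hab, ← prod_filter_mul_prod_filter_not (J.erase s(a, b)) (a ∈ ·),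
      ← hJa, ← hJ']
    congr 1
    · rw [partialAvg_edgeInd_of_mem S (by simp [hs]) (by simp [hs, hne.symm])]
      simp [hc]
    congr 1
    · rw [prod_congr rfl (g := fun _ => dens S (φ a) ^ (1 / (Δ : ℝ))), prod_const]
      intro e he
      simp only [hJa, mem_filter, mem_erase] at he
      rw [partialAvg_edgeInd_of_mem' S he.2 (by simp [hs]) (by simp [hs]) (hJ e he.1.2)]
      simp [hc, he.1.1]
    · rw [prod_congr rfl (g := fun _ => q ^ (1 / (Δ : ℝ))), prod_const]
      intro e he
      simp only [hJ', mem_filter, mem_erase] at he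
      rw [partialAvg_edgeInd_of_subset S (hJ e he.1.2)]
      · simp [hc, he.1.1, ← hq]
      intro x hx
      simp only [hs, mem_erase, mem_univ, and_true]
      rintro rfl
      exact he.2 hx
  simp_rw [hprod]
  have hpt : ∀ φ : V → Ω, ind (dens S (φ a) < η) * (dens S (φ a) ^ (2 / (Δ : ℝ)) *
      ((dens S (φ a) ^ (1 / (Δ : ℝ))) ^ #Ja * (q ^ (1 / (Δ : ℝ))) ^ #J')) ≤
      dens S (φ a) ^ ((#Ja + 1 : ℕ) / (Δ : ℝ)) *
        (η ^ (1 / (Δ : ℝ)) * (q ^ (1 / (Δ : ℝ))) ^ #J') := by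
    intro φ
    have h1 := dens_nonneg S (φ a)
    by_cases h : dens S (φ a) < η
    · rw [ind_of_true h, one_mul]
      have e1 : dens S (φ a) ^ (2 / (Δ : ℝ)) =
          dens S (φ a) ^ (1 / (Δ : ℝ)) * dens S (φ a) ^ (1 / (Δ : ℝ)) := by
        rw [← Real.rpow_add_of_nonneg h1 (by positivity) (by positivity)]
        congr 1; ring
      have e2 : dens S (φ a) ^ ((#Ja + 1 : ℕ) / (Δ : ℝ)) =
          (dens S (φ a) ^ (1 / (Δ : ℝ))) ^ #Ja * dens S (φ a) ^ (1 / (Δ : ℝ)) := by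
        rw [← pow_succ, ← Real.rpow_natCast, ← Real.rpow_mul h1]
        congr 1; ring
      have e3 : dens S (φ a) ^ (1 / (Δ : ℝ)) ≤ η ^ (1 / (Δ : ℝ)) := by gcongr
      rw [e1, e2]
      set x := dens S (φ a) ^ (1 / (Δ : ℝ))
      have hx : 0 ≤ x := Real.rpow_nonneg h1 _
      calc x * x * (x ^ #Ja * (q ^ (1 / (Δ : ℝ))) ^ #J')
          = x * (x ^ #Ja * x * (q ^ (1 / (Δ : ℝ))) ^ #J') := by ring
        _ ≤ η ^ (1 / (Δ : ℝ)) * (x ^ #Ja * x * (q ^ (1 / (Δ : ℝ))) ^ #J') := by gcongr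
        _ = _ := by ring
    · rw [ind_of_false h, zero_mul]
      positivity
  refine (expect_le_expect fun φ _ => hpt φ).trans ?_
  rw [← expect_mul, expect_eval a fun u => dens S u ^ ((#Ja + 1 : ℕ) / (Δ : ℝ))]
  -- Jensen's inequality for a concave power, as the case of a single factor in Hölder's inequality.
  have hJen : 𝔼 u, dens S u ^ ((#Ja + 1 : ℕ) / (Δ : ℝ)) ≤ q ^ ((#Ja + 1 : ℕ) / (Δ : ℝ)) := by
    have := expect_prod_rpow_le (Ω := Ω) ({()} : Finset Unit) (fun _ => dens S)
      (fun _ _ => dens_nonneg S) (fun _ => ((#Ja + 1 : ℕ) / (Δ : ℝ))) (fun _ _ => by positivity)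
      (by
        rw [sum_singleton, div_le_one hΔ']
        exact_mod_cast cJa)
    simp only [prod_singleton] at this
    exact this
  have e2 : q ^ ((#Ja + 1 : ℕ) / (Δ : ℝ)) = (q ^ (1 / (Δ : ℝ))) ^ (#Ja + 1) := by
    rw [← Real.rpow_natCast, ← Real.rpow_mul hq0]
    congr 1; ring
  rw [e2] at hJen
  refine (mul_le_mul_of_nonneg_right hJen (by positivity)).trans (le_of_eq ?_)
  rw [cJ]
  ring

end Kernel

/-! ### Homomorphisms of stars whose centres go to hubs. -/

section Hub

variable {V Ω : Type*} [Fintype V] [DecidableEq V] [Fintype Ω] [Nonempty Ω]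

/-- The density of edges with first endpoint in `U`. -/
noncomputable def hubDens (S : Finset (Sym2 Ω)) (U : Ω → Prop) : ℝ := 𝔼 u, ind (U u) * dens S u

lemma hubDens_nonneg (S : Finset (Sym2 Ω)) (U : Ω → Prop) : 0 ≤ hubDens S U :=
  expect_nonneg fun _ _ => mul_nonneg (ind_nonneg _) (dens_nonneg _ _)

lemma expect_expect_hub (S : Finset (Sym2 Ω)) (U : Ω → Prop) :
    𝔼 u, 𝔼 v, ind (s(u, v) ∈ S ∧ U u) = hubDens S U := by
  refine expect_congr rfl fun u _ => ?_
  unfold dens adj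
  rw [mul_expect]
  exact expect_congr rfl fun v _ => by rw [ind_and, mul_comm]

lemma sum_edeg (J : Finset (Sym2 V)) (A : Finset V) :
    ∑ a ∈ A, edeg J a = ∑ e ∈ J, #{a ∈ A | a ∈ e} := by
  unfold edeg
  exact sum_card_bipartiteAbove_eq_sum_card_bipartiteBelow _

/-- Double counting: every edge of `J` has exactly one end in `A`. -/
lemma card_eq_mul_of_cover {Δ : ℕ} (J : Finset (Sym2 V)) (A : Finset V)
    (hA : ∀ e ∈ J, ∃ a b, e = s(a, b) ∧ a ∈ A ∧ b ∉ A) (hfull : ∀ a ∈ A, edeg J a = Δ) :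
    #J = Δ * #A := by
  have h := sum_edeg J A
  rw [sum_congr rfl hfull, sum_const, smul_eq_mul, mul_comm] at h
  rw [h, card_eq_sum_ones]
  refine sum_congr rfl fun e he => ?_
  obtain ⟨a, b, rfl, ha, hb⟩ := hA e he
  rw [eq_comm, card_eq_one]
  refine ⟨a, ?_⟩
  ext x
  simp only [mem_filter, Sym2.mem_iff, mem_singleton]
  constructor
  · rintro ⟨h1, rfl | rfl⟩
    · rfl
    · exact absurd h1 hb
  · rintro rfl; exact ⟨ha, Or.inl rfl⟩

/-- Homomorphisms of a union of full stars centred in `A` that map `A` into `U`. -/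
lemma expect_hom_hub_le (S : Finset (Sym2 Ω)) {Δ : ℕ} (hΔ : 0 < Δ) (J : Finset (Sym2 V))
    (hdeg : ∀ a, edeg J a ≤ Δ) (A : Finset V)
    (hA : ∀ e ∈ J, ∃ a b, e = s(a, b) ∧ a ∈ A ∧ b ∉ A) (hfull : ∀ a ∈ A, edeg J a = Δ)
    (U : Ω → Prop) :
    𝔼 φ, ind (Hom S J φ ∧ ∀ a ∈ A, U (φ a)) ≤ hubDens S U ^ #A := by
  -- The condition on `A` is distributed over the edges. Each has exactly one end in `A`, so each
  -- edge factor has density at most `hubDens S U`, and `#J = Δ * #A` turns the exponents `1 / Δ`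
  -- into `#A`.
  refine le_trans ?_ ((finner_edge hΔ J hdeg
    (fun e φ => e.map φ ∈ S ∧ ∀ a ∈ e, a ∈ A → U (φ a)) ?_
    (fun e => hubDens S U) ?_).trans (le_of_eq ?_))
  · refine expect_le_expect fun φ _ => ind_mono ?_
    rintro ⟨h, hU⟩ e he
    exact ⟨h e he, fun a _ ha => hU a ha⟩
  · intro e _ x hx φ u
    rw [map_update_of_notMem hx]
    refine and_congr_right fun _ => forall_congr' fun a => forall_congr' fun hae => ?_
    rw [Function.update_of_ne]
    rintro rfl; exact hx hae
  · intro e he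
    obtain ⟨a, b, rfl, ha, hb⟩ := hA e he
    have hne : a ≠ b := by rintro rfl; exact hb ha
    rw [← expect_expect_hub, ← expect_eval₂ hne fun u v => ind (s(u, v) ∈ S ∧ U u)]
    refine expect_le_expect fun φ _ => ind_mono ?_
    rintro ⟨h1, h2⟩
    exact ⟨h1, h2 a (by simp) ha⟩
  · have hΔ' : (0 : ℝ) < Δ := by exact_mod_cast hΔ
    rw [prod_const, card_eq_mul_of_cover J A hA hfull, pow_mul, ← Real.rpow_natCast (_ ^ _) Δ,
      ← Real.rpow_mul (hubDens_nonneg _ _), one_div, inv_mul_cancel₀ hΔ'.ne', Real.rpow_one]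

end Hub

/-! ### Finner weights perturbed along an odd closed walk. -/

section OddWalk

variable {V : Type*} [Fintype V] [DecidableEq V] (H : SimpleGraph V)

/-- The alternating sign pattern along a walk. -/
def walkSign {H : SimpleGraph V} : {u v : V} → H.Walk u v → Sym2 V → ℝ
  | _, _, .nil, _ => 0
  | u, _, .cons (v := v) _ p, e => (if e = s(u, v) then 1 else 0) - walkSign p e

variable {H}

/-- Consecutive edges have opposite signs and cancel at each inner visit of the walk. For a closed
walk of odd length the two end terms add up, so the signs can raise the Finner weight at the base
while leaving all other vertex sums unchanged. -/
lemma sum_walkSign [DecidableRel H.Adj] {u w : V} (p : H.Walk u w) (a : V) :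
    ∑ e ∈ H.edgeFinset with a ∈ e, walkSign p e =
      (if a = u then 1 else 0) + (-1) ^ (p.length + 1) * (if a = w then 1 else 0) := by
  induction p with
  | nil => simp only [walkSign, sum_const_zero, SimpleGraph.Walk.length_nil]; split_ifs <;> norm_num
  | @cons u v w h p ih =>
    simp only [walkSign, sum_sub_distrib, ih, sum_ite_eq', mem_filter, SimpleGraph.mem_edgeFinset,
      SimpleGraph.mem_edgeSet, h, true_and, Sym2.mem_iff, SimpleGraph.Walk.length_cons]
    have hne := h.ne
    by_cases h1 : a = u
    · subst h1
      simp only [hne, if_true, if_false, true_or]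
      ring
    · by_cases h2 : a = v
      · subst h2
        simp only [h1, if_true, if_false, or_true]
        ring
      · simp only [h1, h2, if_false, or_false]
        ring

lemma abs_walkSign_le {u w : V} (p : H.Walk u w) (e : Sym2 V) :
    |walkSign p e| ≤ p.edges.count e := by
  induction p with
  | nil => simp [walkSign]
  | @cons u v w h p ih =>
    simp only [walkSign, SimpleGraph.Walk.edges_cons, List.count_cons, beq_iff_eq]
    refine (abs_sub _ _).trans ?_
    by_cases he : e = s(u, v)
    · subst he
      simp only [if_true, abs_one]
      push_cast
      linarith
    · simp only [he, if_false, abs_zero, Ne.symm he]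
      push_cast
      linarith

/-- In a connected nonbipartite graph, every vertex is the base of an odd closed walk that uses no
edge more than three times. -/
lemma exists_odd_closed_walk (hconn : H.Connected) (hnb : ¬ H.IsBipartite) (b : V) :
    ∃ p : H.Walk b b, Odd p.length ∧ ∀ e, p.edges.count e ≤ 3 := by
  -- Otherwise the parity of the distance from `b` is a proper 2-colouring.
  have hex : ∃ x y, H.Adj x y ∧ H.dist b x % 2 = H.dist b y % 2 := by
    by_contra hcon
    push Not at hcon
    refine hnb ⟨SimpleGraph.Coloring.mk (fun x => Fin.ofNat 2 (H.dist b x)) ?_⟩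
    intro x y hxy heq
    exact hcon x y hxy (by simpa [Fin.ext_iff] using heq)
  obtain ⟨x, y, hxy, hpar⟩ := hex
  obtain ⟨p, hp, hpl⟩ := hconn.exists_path_of_dist b x
  obtain ⟨r, hr, hrl⟩ := hconn.exists_path_of_dist b y
  -- Two shortest paths and the edge joining their ends: each of the three pieces uses an edge at
  -- most once.
  refine ⟨p.append (.cons hxy r.reverse), ?_, ?_⟩
  · rw [SimpleGraph.Walk.length_append, SimpleGraph.Walk.length_cons,
      SimpleGraph.Walk.length_reverse, hpl, hrl, Nat.odd_iff]
    omega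
  · intro e
    rw [SimpleGraph.Walk.edges_append, SimpleGraph.Walk.edges_cons, SimpleGraph.Walk.edges_reverse,
      List.count_append, List.count_cons, List.count_reverse]
    have h1 := List.nodup_iff_count_le_one.1 hp.isTrail.edges_nodup e
    have h2 := List.nodup_iff_count_le_one.1 hr.isTrail.edges_nodup e
    split_ifs <;> omega

lemma edeg_edgeFinset [DecidableRel H.Adj] (a : V) : edeg H.edgeFinset a = H.degree a := by
  rw [← SimpleGraph.card_incidenceFinset_eq_degree, SimpleGraph.incidenceFinset_eq_filter]
  rfl

lemma two_mul_sum_edges [DecidableRel H.Adj] (g : Sym2 V → ℝ) :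
    ∑ a, ∑ e ∈ H.edgeFinset with a ∈ e, g e = 2 * ∑ e ∈ H.edgeFinset, g e := by
  simp_rw [sum_filter]
  rw [sum_comm, mul_sum]
  refine sum_congr rfl fun e he => ?_
  rw [← sum_filter, sum_const, nsmul_eq_mul]
  congr 1
  rw [SimpleGraph.mem_edgeFinset] at he
  induction e using Sym2.ind with
  | _ x y =>
    have hne : x ≠ y := H.ne_of_adj he
    have : (univ.filter (· ∈ s(x, y)) : Finset V) = {x, y} := by ext; simp
    rw [this, card_pair hne]
    norm_num

variable {Ω : Type*} [Fintype Ω] [Nonempty Ω]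

/-- Homomorphisms of a connected nonbipartite regular graph that use a vertex of very small degree
are rare. -/
lemma expect_hom_dens_lt_le [DecidableRel H.Adj] {Δ : ℕ} (hΔ : 0 < Δ)
    (hreg : H.IsRegularOfDegree Δ) (hconn : H.Connected) (hnb : ¬ H.IsBipartite)
    (S : Finset (Sym2 Ω)) (hq : 0 < edens S) (b : V) {τ : ℝ} (hτ : 0 < τ) :
    𝔼 φ, ind (Hom S H.edgeFinset φ ∧ dens S (φ b) < τ) ≤
      (τ ^ 2 / edens S) ^ (1 / (4 * Δ : ℝ)) * (edens S ^ (1 / (Δ : ℝ))) ^ #H.edgeFinset := by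
  have hΔ' : (0 : ℝ) < Δ := by exact_mod_cast hΔ
  obtain ⟨p, hodd, hcount⟩ := exists_odd_closed_walk hconn hnb b
  set q := edens S with hqdef
  set κ : ℝ := 1 / (4 * Δ : ℝ) with hκ
  have hκ0 : 0 < κ := by positivity
  -- Since `1 / Δ = 4 * κ` and the signs are at least `-3`, all weights are positive. Their sum is
  -- `1` at every vertex except `b`, where it is `1 + 2 * κ`; the surplus power of the degree of `φ
  -- b` yields the factor `τ ^ (2 * κ)`.
  set c : Sym2 V → ℝ := fun e => 1 / (Δ : ℝ) + κ * walkSign p e with hc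
  have hcpos : ∀ e, 0 < c e := by
    intro e
    have h1 := (abs_le.1 ((abs_walkSign_le p e).trans (Nat.cast_le.2 (hcount e)))).1
    have h3 : (1 : ℝ) / Δ = 4 * κ := by rw [hκ]; field_simp
    simp only [hc, h3]
    push_cast at h1
    nlinarith
  have hsumE : ∀ a, ∑ e ∈ H.edgeFinset with a ∈ e, c e = 1 + if a = b then 2 * κ else 0 := by
    intro a
    have hd : (#{e ∈ H.edgeFinset | a ∈ e} : ℝ) = Δ := by
      have := edeg_edgeFinset (H := H) a
      rw [hreg a] at this
      exact_mod_cast this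
    simp only [hc]
    rw [sum_add_distrib, ← mul_sum, sum_walkSign, (hodd.add_one).neg_one_pow, sum_const,
      nsmul_eq_mul, hd, mul_one_div, div_self hΔ'.ne']
    split_ifs <;> ring
  have htot : ∑ e ∈ H.edgeFinset, c e = #H.edgeFinset / (Δ : ℝ) + κ := by
    have h1 : ∑ e ∈ H.edgeFinset, walkSign p e = 1 := by
      have := two_mul_sum_edges (H := H) (walkSign p)
      simp_rw [sum_walkSign, (hodd.add_one).neg_one_pow, one_mul] at this
      rw [sum_add_distrib, sum_ite_eq', if_pos (mem_univ _)] at this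
      linarith
    simp only [hc]
    rw [sum_add_distrib, ← mul_sum, h1, sum_const, nsmul_eq_mul]
    ring
  refine (finner_hom S H.edgeFinset (univ.erase b) c (fun e _ => hcpos e) ?_
    (fun φ => dens S (φ b) < τ) ?_).trans ?_
  · intro a ha
    rw [hsumE, if_neg (by simpa using ha), add_zero]
  · intro φ a ha u
    rw [Function.update_of_ne (by simpa using (ne_of_mem_erase ha).symm)]
  have hnd : ∀ e ∈ H.edgeFinset, ¬ e.IsDiag := fun e he =>
    H.not_isDiag_of_mem_edgeSet (SimpleGraph.mem_edgeFinset.1 he)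
  have hsum2 : ∑ e ∈ H.edgeFinset with ¬ b ∈ e, c e = #H.edgeFinset / (Δ : ℝ) - 1 - κ := by
    have := sum_filter_add_sum_filter_not H.edgeFinset (b ∈ ·) c
    rw [htot, hsumE, if_pos rfl] at this
    linarith
  have hprod : ∀ φ : V → Ω, ∏ e ∈ H.edgeFinset, partialAvg (univ.erase b) (edgeInd S e) φ ^ c e =
      dens S (φ b) ^ (1 + 2 * κ) * q ^ (#H.edgeFinset / (Δ : ℝ) - 1 - κ) := by
    intro φ
    rw [← prod_filter_mul_prod_filter_not H.edgeFinset (b ∈ ·)]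
    congr 1
    · rw [prod_congr rfl (g := fun e => dens S (φ b) ^ c e),
        ← Real.rpow_sum_of_nonneg (dens_nonneg _ _) (fun e _ => (hcpos e).le), hsumE, if_pos rfl]
      intro e he
      rw [mem_filter] at he
      rw [partialAvg_edgeInd_of_mem' S he.2 (by simp) (by simp) (hnd e he.1)]
    · rw [prod_congr rfl (g := fun e => q ^ c e),
        ← Real.rpow_sum_of_nonneg hq.le (fun e _ => (hcpos e).le), hsum2]
      intro e he
      rw [mem_filter] at he
      rw [partialAvg_edgeInd_of_subset S (hnd e he.1)]
      intro x hx
      simp only [mem_erase, mem_univ, and_true]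
      rintro rfl
      exact he.2 hx
  simp_rw [hprod]
  have hpt : ∀ φ : V → Ω, ind (dens S (φ b) < τ) *
      (dens S (φ b) ^ (1 + 2 * κ) * q ^ (#H.edgeFinset / (Δ : ℝ) - 1 - κ)) ≤
      dens S (φ b) * (τ ^ (2 * κ) * q ^ (#H.edgeFinset / (Δ : ℝ) - 1 - κ)) := by
    intro φ
    have h1 := dens_nonneg S (φ b)
    by_cases h : dens S (φ b) < τ
    · rw [ind_of_true h, one_mul, Real.rpow_add_of_nonneg h1 (by norm_num) (by positivity),
        Real.rpow_one, mul_assoc]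
      gcongr
    · rw [ind_of_false h, zero_mul]
      positivity
  refine (expect_le_expect fun φ _ => hpt φ).trans (le_of_eq ?_)
  rw [← expect_mul, expect_eval b (dens S)]
  change q * _ = _
  rw [Real.div_rpow (by positivity) hq.le, ← Real.rpow_natCast τ 2, ← Real.rpow_mul hτ.le,
    ← Real.rpow_natCast (q ^ _), ← Real.rpow_mul hq.le, Real.rpow_sub hq, Real.rpow_sub hq,
    Real.rpow_one]
  have hqκ : 0 < q ^ κ := Real.rpow_pos_of_pos hq _
  rw [one_div_mul_eq_div]
  push_cast
  field_simp

end OddWalk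

/-! ### Alternation of high and low vertices along a subgraph. -/

section Propagation

variable {V : Type*} [Fintype V] [DecidableEq V] {H : SimpleGraph V} [DecidableRel H.Adj]

/-- The edges of `H` incident with `A`. -/
def starEdges (H : SimpleGraph V) [DecidableRel H.Adj] (A : Finset V) : Finset (Sym2 V) :=
  H.edgeFinset.filter fun e => ∃ a ∈ A, a ∈ e

lemma edge_mem_of_edeg_eq {Δ : ℕ} (hreg : H.IsRegularOfDegree Δ) {J : Finset (Sym2 V)}
    (hJ : J ⊆ H.edgeFinset) {a : V} (ha : edeg J a = Δ) {e : Sym2 V} (he : e ∈ H.edgeFinset)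
    (hae : a ∈ e) : e ∈ J := by
  have h1 : J.filter (a ∈ ·) ⊆ H.edgeFinset.filter (a ∈ ·) := filter_subset_filter _ hJ
  have h2 : J.filter (a ∈ ·) = H.edgeFinset.filter (a ∈ ·) := by
    refine eq_of_subset_of_card_le h1 ?_
    have h3 : edeg H.edgeFinset a = Δ := by rw [edeg_edgeFinset, hreg a]
    exact (h3.trans ha.symm).le
  have : e ∈ H.edgeFinset.filter (a ∈ ·) := by simp [hae, SimpleGraph.mem_edgeFinset.1 he]
  rw [← h2] at this
  exact (mem_filter.1 this).1

lemma edeg_le {Δ : ℕ} (hreg : H.IsRegularOfDegree Δ) {J : Finset (Sym2 V)}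
    (hJ : J ⊆ H.edgeFinset) (a : V) : edeg J a ≤ Δ := by
  rw [← hreg a, ← edeg_edgeFinset]
  exact card_le_card (filter_subset_filter _ hJ)

lemma not_isDiag_of_mem {J : Finset (Sym2 V)} (hJ : J ⊆ H.edgeFinset) (e : Sym2 V) (he : e ∈ J) :
    ¬ e.IsDiag := H.not_isDiag_of_mem_edgeSet (SimpleGraph.mem_edgeFinset.1 (hJ he))

/-- If along `J` the predicate `hi` alternates, then either `J` consists of all edges at an
independent set on which `hi` holds, or `J` is everything and `hi` holds nowhere. -/
lemma star_or_all {Δ : ℕ} (hreg : H.IsRegularOfDegree Δ) (hconn : H.Connected)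
    {J : Finset (Sym2 V)} (hJ : J ⊆ H.edgeFinset) (hi : V → Prop)
    (h2 : ∀ a b, s(a, b) ∈ J → ¬ (hi a ∧ hi b))
    (hprop : ∀ a b c, s(a, b) ∈ J → s(b, c) ∈ J → hi a → hi c)
    (hpart : ∀ a b, s(a, b) ∈ J → edeg J b < Δ → hi a) :
    (∃ A : Finset V, H.IsIndepSet A ∧ starEdges H A = J ∧ ∀ a ∈ A, hi a) ∨
      (J = H.edgeFinset ∧ ∀ e ∈ J, ∀ a ∈ e, ¬ hi a) := by
  classical
  by_cases hbad : ∃ a b, s(a, b) ∈ J ∧ ¬ hi a ∧ ¬ hi b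
  · right
    -- The vertices on an edge of `J` without a high end. By `hpart` they have full degree, by
    -- `hprop` the property passes to all their neighbours, and so by connectedness it reaches every
    -- vertex.
    set B : V → Prop := fun x => ∃ y, s(x, y) ∈ J ∧ ¬ hi x ∧ ¬ hi y with hB
    have hfull : ∀ x, B x → edeg J x = Δ := by
      rintro x ⟨y, hxy, hx, hy⟩
      refine le_antisymm (edeg_le hreg hJ x) (not_lt.1 fun hlt => hy ?_)
      exact hpart y x (by rwa [Sym2.eq_swap]) hlt
    have hstep : ∀ x z, B x → H.Adj x z → B z := by
      intro x z hx hxz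
      have hxzJ : s(x, z) ∈ J := edge_mem_of_edeg_eq hreg hJ (hfull x hx)
        (SimpleGraph.mem_edgeFinset.2 hxz) (by simp)
      obtain ⟨y, hxy, hx', hy⟩ := hx
      refine ⟨x, by rwa [Sym2.eq_swap], fun hz => hy ?_, hx'⟩
      exact hprop z x y (by rwa [Sym2.eq_swap]) hxy hz
    obtain ⟨a0, b0, h0⟩ := hbad
    have hall : ∀ x, B x := by
      intro x
      obtain ⟨w⟩ := hconn.preconnected a0 x
      have h0' : B a0 := ⟨b0, h0⟩
      clear h0
      induction w with
      | nil => exact h0'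
      | cons h w ih => exact ih (hstep _ _ h0' h)
    refine ⟨Subset.antisymm hJ fun e he => ?_, fun e _ a _ => ?_⟩
    · induction e using Sym2.ind with
      | _ x z => exact edge_mem_of_edeg_eq hreg hJ (hfull x (hall x)) he (by simp)
    · obtain ⟨_, -, ha, -⟩ := hall a
      exact ha
  · left
    push Not at hbad
    -- A high vertex that meets `J` has full degree, since otherwise `hpart` would make its
    -- neighbour high as well, against `h2`. Hence these vertices are independent, and their stars
    -- exhaust `J`.
    set A : Finset V := univ.filter fun a => hi a ∧ 0 < edeg J a with hA
    have hfull : ∀ a ∈ A, edeg J a = Δ := by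
      intro a ha
      simp only [hA, mem_filter, mem_univ, true_and] at ha
      refine le_antisymm (edeg_le hreg hJ a) (not_lt.1 fun hlt => ?_)
      obtain ⟨e, he⟩ := card_pos.1 ha.2
      rw [mem_filter] at he
      obtain ⟨b, rfl⟩ := he.2
      have hb := hpart b a (by rw [Sym2.eq_swap]; exact he.1) hlt
      exact h2 a b he.1 ⟨ha.1, hb⟩
    refine ⟨A, ?_, ?_, fun a ha => ?_⟩
    · intro a ha b hb _ hadj
      have := edge_mem_of_edeg_eq hreg hJ (hfull a ha) (e := s(a, b))
        (SimpleGraph.mem_edgeFinset.2 hadj) (by simp)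
      simp only [hA, coe_filter, mem_univ, true_and, Set.mem_ofPred_eq] at ha hb
      exact h2 a b this ⟨ha.1, hb.1⟩
    · ext e
      simp only [starEdges, mem_filter]
      constructor
      · rintro ⟨he, a, ha, hae⟩
        exact edge_mem_of_edeg_eq hreg hJ (hfull a ha) he hae
      · intro he
        refine ⟨hJ he, ?_⟩
        have hpos : ∀ x ∈ e, 0 < edeg J x := fun x hx => card_pos.2 ⟨e, by simp [he, hx]⟩
        induction e using Sym2.ind with
        | _ x y =>
          by_cases hx : hi x
          · exact ⟨x, by simp [hA, hx, hpos x (by simp)], by simp⟩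
          · exact ⟨y, by simp [hA, hbad x y he hx, hpos y (by simp)], by simp⟩
    · simp only [hA, mem_filter] at ha
      exact ha.2.1

lemma exists_mem_notMem_of_mem_starEdges {A : Finset V} (hA : H.IsIndepSet A) {e : Sym2 V}
    (he : e ∈ starEdges H A) : ∃ a b, e = s(a, b) ∧ a ∈ A ∧ b ∉ A := by
  simp only [starEdges, mem_filter, SimpleGraph.mem_edgeFinset] at he
  obtain ⟨he, a, ha, b, rfl⟩ := he
  refine ⟨a, b, rfl, ha, fun hb => ?_⟩
  exact hA (by exact_mod_cast ha) (by exact_mod_cast hb) (H.ne_of_adj he) he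

lemma edeg_starEdges {Δ : ℕ} (hreg : H.IsRegularOfDegree Δ) {A : Finset V} {a : V} (ha : a ∈ A) :
    edeg (starEdges H A) a = Δ := by
  rw [← hreg a, ← edeg_edgeFinset]
  unfold edeg starEdges
  congr 1
  ext e
  simp only [mem_filter]
  constructor
  · rintro ⟨⟨h1, -⟩, h2⟩; exact ⟨h1, h2⟩
  · rintro ⟨h1, h2⟩; exact ⟨⟨h1, a, ha, h2⟩, h2⟩

lemma card_starEdges {Δ : ℕ} (hreg : H.IsRegularOfDegree Δ) {A : Finset V}
    (hA : H.IsIndepSet A) : #(starEdges H A) = Δ * #A :=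
  card_eq_mul_of_cover _ A (fun _ he => exists_mem_notMem_of_mem_starEdges hA he)
    fun _ ha => edeg_starEdges hreg ha

lemma two_mul_card_edges {Δ : ℕ} (hreg : H.IsRegularOfDegree Δ) :
    2 * #H.edgeFinset = Δ * Fintype.card V := by
  rw [← H.sum_degrees_eq_twice_card_edges, sum_congr rfl fun a _ => hreg a, sum_const, card_univ,
    smul_eq_mul, mul_comm]

end Propagation

/-! ### Markov bounds on degrees and the edge budget. -/

section Markov

variable {Ω : Type*} [Fintype Ω] [Nonempty Ω]

lemma mul_expect_dens_ge_le (S : Finset (Sym2 Ω)) (η : ℝ) :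
    η * 𝔼 u, ind (η ≤ dens S u) ≤ edens S := by
  rw [mul_expect]
  refine expect_le_expect fun u _ => ?_
  by_cases h : η ≤ dens S u
  · rw [ind_of_true h, mul_one]; exact h
  · rw [ind_of_false h, mul_zero]; exact dens_nonneg S u

lemma expect_dens_ge_le (S : Finset (Sym2 Ω)) {η : ℝ} (hη : 0 < η) :
    𝔼 u, ind (η ≤ dens S u) ≤ edens S / η := by
  rw [le_div_iff₀ hη, mul_comm]
  exact mul_expect_dens_ge_le S η

lemma expect_prod_ind (P Q : Ω → Prop) :
    𝔼 u, 𝔼 v, ind (P u ∧ Q v) = (𝔼 u, ind (P u)) * 𝔼 v, ind (Q v) := by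
  simp_rw [ind_and]
  rw [expect_mul]
  exact expect_congr rfl fun u _ => by rw [mul_expect]

/-- The edges of `S` avoiding `U`. -/
noncomputable def avoid (S : Finset (Sym2 Ω)) (U : Ω → Prop) : Finset (Sym2 Ω) :=
  open Classical in S.filter fun e => ∀ x ∈ e, ¬ U x

lemma mem_avoid {S : Finset (Sym2 Ω)} {U : Ω → Prop} {e : Sym2 Ω} :
    e ∈ avoid S U ↔ e ∈ S ∧ ∀ x ∈ e, ¬ U x := by
  simp [avoid]

/-- In terms of ordered pairs, an edge touching `U` is counted once from each end in `U`, so twice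
only if both ends lie in `U`; such pairs have density at most the square of that of `U`. This is the
source of the budget `x + y / 2`. -/
lemma hubDens_add_avoid_le (S : Finset (Sym2 Ω)) (U : Ω → Prop) :
    hubDens S U + edens (avoid S U) / 2 ≤ (edens S + (𝔼 u, ind (U u)) ^ 2) / 2 := by
  have h1 : hubDens S U = 𝔼 u, 𝔼 v, adj S u v * ind (U u) := by
    unfold hubDens dens
    simp_rw [mul_expect]
    exact expect_congr rfl fun u _ => expect_congr rfl fun v _ => mul_comm _ _
  have h2 : hubDens S U = 𝔼 u, 𝔼 v, adj S u v * ind (U v) := by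
    rw [h1, expect_comm]
    exact expect_congr rfl fun u _ => expect_congr rfl fun v _ => by rw [adj_comm]
  have h3 : (𝔼 u, ind (U u)) ^ 2 = 𝔼 u, 𝔼 v, ind (U u ∧ U v) := by
    rw [expect_prod_ind, sq]
  have key : 𝔼 u, 𝔼 v, (adj S u v * ind (U u) + adj S u v * ind (U v) + adj (avoid S U) u v) ≤
      𝔼 u, 𝔼 v, (adj S u v + ind (U u ∧ U v)) := by
    refine expect_le_expect fun u _ => expect_le_expect fun v _ => ?_
    unfold adj avoid
    by_cases hS : s(u, v) ∈ S <;> by_cases hu : U u <;> by_cases hv : U v <;>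
      simp [ind, hS, hu, hv]
  simp_rw [expect_add_distrib] at key
  rw [← h1, ← h2, ← h3] at key
  change _ + edens (avoid S U) ≤ edens S + _ at key
  linarith

end Markov

/-! ### Independent sets as a finite family. -/

section IndepSets

variable {V : Type*} [Fintype V] [DecidableEq V]

/-- The independent sets of `H`. -/
noncomputable def indepSets (H : SimpleGraph V) : Finset (Finset V) :=
  open Classical in univ.filter fun A => H.IsIndepSet A

lemma mem_indepSets {H : SimpleGraph V} {A : Finset V} : A ∈ indepSets H ↔ H.IsIndepSet A := by
  simp [indepSets]

end IndepSets

/-! ### Typical homomorphisms are hub-like or avoid the hubs. -/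

section Structure

variable {V Ω : Type*} [Fintype V] [DecidableEq V] [Fintype Ω] [Nonempty Ω]
  {H : SimpleGraph V} [DecidableRel H.Adj]

/-- The exceptional events in the structure theorem for homomorphisms. -/
def Exceptional (S : Finset (Sym2 Ω)) (Δ : ℕ) (J : Finset (Sym2 V)) (ξ η : ℝ) (a b : V)
    (φ : V → Ω) : Prop :=
  (Hom S J φ ∧ (ξ ^ 2 * η ≤ dens S (φ a) ∧ dens S (φ a) < η)) ∨
  (Hom S J φ ∧ (η ≤ dens S (φ a) ∧ η ≤ dens S (φ b))) ∨
  (Hom S J φ ∧ (η ≤ dens S (φ a) ∧ edens S / (η * ξ) ≤ dens S (φ b))) ∨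
  ((edeg J a = Δ ∧ edeg J b = Δ) ∧
    (Hom S J φ ∧ dens S (φ a) * dens S (φ b) < ξ * edens S)) ∨
  (edeg J b < Δ ∧ (Hom S J φ ∧ dens S (φ a) < ξ ^ 2 * η))

/-- Outside of the exceptional events, homomorphisms are either hub-like or avoid all vertices of
high degree. -/
lemma hom_structure {Δ : ℕ} (hreg : H.IsRegularOfDegree Δ) (hconn : H.Connected)
    (S : Finset (Sym2 Ω)) {J : Finset (Sym2 V)} (hJ : J ⊆ H.edgeFinset)
    {ξ η : ℝ} (hξ : 0 < ξ) (hη : 0 < η) (hq : 0 < edens S)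
    {φ : V → Ω} (hφ : Hom S J φ)
    (hex : ∀ a b, s(a, b) ∈ J → ¬ Exceptional S Δ J ξ η a b φ) :
    (∃ A : Finset V, H.IsIndepSet A ∧ starEdges H A = J ∧ ∀ a ∈ A, η ≤ dens S (φ a)) ∨
      (J = H.edgeFinset ∧ Hom (avoid S fun u => η ≤ dens S u) H.edgeFinset φ) := by
  have h1 : ∀ a b, s(a, b) ∈ J → ξ ^ 2 * η ≤ dens S (φ a) → η ≤ dens S (φ a) := by
    intro a b hab h
    by_contra hlt
    exact hex a b hab (Or.inl ⟨hφ, h, not_le.1 hlt⟩)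
  have h2 : ∀ a b, s(a, b) ∈ J → ¬ (η ≤ dens S (φ a) ∧ η ≤ dens S (φ b)) := fun a b hab h =>
    hex a b hab (Or.inr (Or.inl ⟨hφ, h⟩))
  have h3 : ∀ a b, s(a, b) ∈ J → η ≤ dens S (φ a) → dens S (φ b) < edens S / (η * ξ) := by
    intro a b hab h
    by_contra hlt
    exact hex a b hab (Or.inr (Or.inr (Or.inl ⟨hφ, h, not_lt.1 hlt⟩)))
  have h4 : ∀ a b, s(a, b) ∈ J → edeg J a = Δ → edeg J b = Δ →
      ξ * edens S ≤ dens S (φ a) * dens S (φ b) := by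
    intro a b hab ha hb
    by_contra hlt
    exact hex a b hab (Or.inr (Or.inr (Or.inr (Or.inl ⟨⟨ha, hb⟩, hφ, not_le.1 hlt⟩))))
  have h5 : ∀ a b, s(a, b) ∈ J → edeg J b < Δ → η ≤ dens S (φ a) := by
    intro a b hab hb
    refine h1 a b hab ?_
    by_contra hlt
    exact hex a b hab (Or.inr (Or.inr (Or.inr (Or.inr ⟨hb, hφ, not_le.1 hlt⟩))))
  have hswap : ∀ a b, s(a, b) ∈ J → s(b, a) ∈ J := fun a b h => by rwa [Sym2.eq_swap]
  have hprop : ∀ a b c, s(a, b) ∈ J → s(b, c) ∈ J → η ≤ dens S (φ a) → η ≤ dens S (φ c) := by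
    intro a b c hab hbc ha
    rcases (edeg_le hreg hJ b).lt_or_eq with hb | hb
    · exact h5 c b (hswap _ _ hbc) hb
    rcases (edeg_le hreg hJ c).lt_or_eq with hc | hc
    · exact absurd ⟨ha, h5 b c hbc hc⟩ (h2 a b hab)
    -- Next to the high vertex `a`, the degree at `b` is below `q / (η * ξ)`. If the degree at `c`
    -- were below `ξ ^ 2 * η`, the product over `bc` would be below `ξ * q`, which is excluded for
    -- ends of full degree; the gap in the degrees then makes `c` high.
    refine h1 c b (hswap _ _ hbc) ?_
    by_contra hlt
    push Not at hlt
    have hb3 := h3 a b hab ha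
    have hbc4 := h4 b c hbc hb hc
    have : dens S (φ b) * dens S (φ c) < edens S / (η * ξ) * (ξ ^ 2 * η) :=
      mul_lt_mul'' hb3 hlt (dens_nonneg _ _) (dens_nonneg _ _)
    have heq : edens S / (η * ξ) * (ξ ^ 2 * η) = ξ * edens S := by field_simp
    linarith
  rcases star_or_all hreg hconn hJ (fun a => η ≤ dens S (φ a)) h2 hprop h5 with h | ⟨hJE, h⟩
  · exact Or.inl h
  · refine Or.inr ⟨hJE, fun e he => ?_⟩
    have heJ : e ∈ J := hJE ▸ he
    refine mem_avoid.2 ⟨hφ e heJ, fun x hx => ?_⟩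
    obtain ⟨a, ha, rfl⟩ := Sym2.mem_map.1 hx
    exact h e heJ a ha

/-- Each of the five events loses a factor `ξ ^ (1 / Δ)` against Finner's bound. The first three put
the image of `ab` into a relation of density at most `ξ * edens S`, by `hmid` or by Markov's
inequality for both degrees; the last two are `expect_hom_prod_dens_le` and `expect_hom_dens_le`. -/
lemma expect_exceptional_le {Δ : ℕ} (hΔ : 2 ≤ Δ) (hreg : H.IsRegularOfDegree Δ)
    (S : Finset (Sym2 Ω)) {J : Finset (Sym2 V)} (hJ : J ⊆ H.edgeFinset)
    {ξ η : ℝ} (hξ : 0 < ξ) (hξ1 : ξ ≤ 1) (hη : 0 < η) (hη1 : η ≤ 1)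
    (hqη : edens S ≤ ξ * η ^ 2)
    (hmid : hubDens S (fun u => ξ ^ 2 * η ≤ dens S u ∧ dens S u < η) ≤ ξ * edens S)
    {a b : V} (hab : s(a, b) ∈ J) :
    𝔼 φ, ind (Exceptional S Δ J ξ η a b φ) ≤
      5 * (ξ ^ (1 / (Δ : ℝ)) * (edens S ^ (1 / (Δ : ℝ))) ^ #J) := by
  have hΔ0 : 0 < Δ := by omega
  have hq0 : 0 ≤ edens S := edens_nonneg S
  have hnd := not_isDiag_of_mem (H := H) hJ
  have hdeg := edeg_le hreg hJ
  set q := edens S with hq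
  set K := ξ ^ (1 / (Δ : ℝ)) * (q ^ (1 / (Δ : ℝ))) ^ #J with hK
  have hK0 : 0 ≤ K := by positivity
  have hJpos : 0 < #J := card_pos.2 ⟨_, hab⟩
  have hrel : ∀ R : Ω → Ω → Prop, 𝔼 u, 𝔼 v, ind (s(u, v) ∈ S ∧ R u v) ≤ ξ * q →
      𝔼 φ, ind (Hom S J φ ∧ R (φ a) (φ b)) ≤ K := by
    intro R hR
    refine (expect_hom_rel_le S hΔ0 J hnd hdeg hab R hR).trans (le_of_eq ?_)
    rw [Real.mul_rpow hξ.le hq0, mul_assoc, ← hq, ← pow_succ', Nat.sub_add_cancel hJpos]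
  have hmono : ∀ P Q R : Ω → Ω → Prop, (∀ u v, P u v → Q u v) →
      𝔼 u, 𝔼 v, ind (P u v) ≤ 𝔼 u, 𝔼 v, ind (Q u v) := fun P Q _ h =>
    expect_le_expect fun u _ => expect_le_expect fun v _ => ind_mono (h u v)
  have hprodle : ∀ t : ℝ, 0 < t → q * q ≤ ξ * q * (η * t) →
      𝔼 u, 𝔼 v, ind (s(u, v) ∈ S ∧ (η ≤ dens S u ∧ t ≤ dens S v)) ≤ ξ * q := by
    intro t ht hle
    refine (hmono _ (fun u v => η ≤ dens S u ∧ t ≤ dens S v) (fun _ _ => True)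
      fun u v h => h.2).trans ?_
    rw [expect_prod_ind]
    refine (mul_le_mul (expect_dens_ge_le S hη) (expect_dens_ge_le S ht)
      (expect_nonneg fun _ _ => ind_nonneg _) (by positivity)).trans ?_
    rw [div_mul_div_comm, div_le_iff₀ (by positivity)]
    exact hle
  have b1 : 𝔼 φ : V → Ω, ind (Hom S J φ ∧ (ξ ^ 2 * η ≤ dens S (φ a) ∧ dens S (φ a) < η)) ≤ K :=
    hrel (fun u _ => ξ ^ 2 * η ≤ dens S u ∧ dens S u < η) (by
      rw [expect_expect_hub S fun u => ξ ^ 2 * η ≤ dens S u ∧ dens S u < η]; exact hmid)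
  have b2 : 𝔼 φ : V → Ω, ind (Hom S J φ ∧ (η ≤ dens S (φ a) ∧ η ≤ dens S (φ b))) ≤ K :=
    hrel (fun u v => η ≤ dens S u ∧ η ≤ dens S v) (hprodle η hη (by nlinarith))
  have b3 : 𝔼 φ : V → Ω,
      ind (Hom S J φ ∧ (η ≤ dens S (φ a) ∧ q / (η * ξ) ≤ dens S (φ b))) ≤ K := by
    -- For `q = 0` the threshold `q / (η * ξ)` is `0` and Markov's inequality says nothing, but then
    -- the density of homomorphisms of `J` vanishes.
    rcases hq0.eq_or_lt with h0 | hpos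
    · refine (expect_le_expect fun φ _ => ind_mono (Q := Hom S J φ) fun h => h.1).trans ?_
      refine (expect_hom_le S hΔ0 J hnd hdeg).trans ?_
      rw [hK, ← hq, ← h0, Real.zero_rpow (by positivity), zero_pow hJpos.ne', mul_zero]
    · exact hrel (fun u v => η ≤ dens S u ∧ q / (η * ξ) ≤ dens S v)
        (hprodle _ (by positivity) (le_of_eq (by field_simp)))
  have b4 : 𝔼 φ : V → Ω, ind ((edeg J a = Δ ∧ edeg J b = Δ) ∧
      (Hom S J φ ∧ dens S (φ a) * dens S (φ b) < ξ * q)) ≤ K := by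
    simp_rw [ind_and (edeg J a = Δ ∧ edeg J b = Δ)]
    rw [← mul_expect]
    by_cases h : edeg J a = Δ ∧ edeg J b = Δ
    · rw [ind_of_true h, one_mul]
      refine (expect_hom_prod_dens_le S hΔ0 J hnd hdeg hab h.1 h.2 hξ.le).trans ?_
      refine mul_le_mul_of_nonneg_right ?_ (by positivity)
      exact pow_le_of_le_one (by positivity) (Real.rpow_le_one hξ.le hξ1 (by positivity))
        (by omega)
    · rw [ind_of_false h, zero_mul]; exact hK0
  have b5 : 𝔼 φ : V → Ω, ind (edeg J b < Δ ∧ (Hom S J φ ∧ dens S (φ a) < ξ ^ 2 * η)) ≤ K := by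
    simp_rw [ind_and (edeg J b < Δ)]
    rw [← mul_expect]
    by_cases h : edeg J b < Δ
    · rw [ind_of_true h, one_mul]
      refine (expect_hom_dens_le S hΔ0 J hnd hdeg hab h (by positivity)).trans ?_
      refine mul_le_mul_of_nonneg_right ?_ (by positivity)
      refine Real.rpow_le_rpow (by positivity) ?_ (by positivity)
      have : ξ * η ≤ 1 := mul_le_one₀ hξ1 hη.le hη1
      nlinarith
    · rw [ind_of_false h, zero_mul]; exact hK0
  have hpt : ∀ φ : V → Ω, ind (Exceptional S Δ J ξ η a b φ) ≤
      ind (Hom S J φ ∧ (ξ ^ 2 * η ≤ dens S (φ a) ∧ dens S (φ a) < η)) +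
      (ind (Hom S J φ ∧ (η ≤ dens S (φ a) ∧ η ≤ dens S (φ b))) +
      (ind (Hom S J φ ∧ (η ≤ dens S (φ a) ∧ q / (η * ξ) ≤ dens S (φ b))) +
      (ind ((edeg J a = Δ ∧ edeg J b = Δ) ∧
        (Hom S J φ ∧ dens S (φ a) * dens S (φ b) < ξ * q)) +
      ind (edeg J b < Δ ∧ (Hom S J φ ∧ dens S (φ a) < ξ ^ 2 * η))))) := by
    intro φ
    unfold Exceptional
    refine (ind_or_le _ _).trans (add_le_add_right ?_ _)
    refine (ind_or_le _ _).trans (add_le_add_right ?_ _)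
    refine (ind_or_le _ _).trans (add_le_add_right ?_ _)
    exact ind_or_le _ _
  refine (expect_le_expect fun φ _ => hpt φ).trans ?_
  simp_rw [expect_add_distrib]
  linarith

-- The three terms correspond to the two outcomes of `hom_structure` and to the exceptional events,
-- summed over ordered pairs of vertices.
open Classical in
lemma expect_hom_le_star_add {Δ : ℕ} (hΔ : 2 ≤ Δ) (hreg : H.IsRegularOfDegree Δ)
    (hconn : H.Connected) (S : Finset (Sym2 Ω)) {J : Finset (Sym2 V)} (hJ : J ⊆ H.edgeFinset)
    {ξ η : ℝ} (hξ : 0 < ξ) (hξ1 : ξ ≤ 1) (hη : 0 < η) (hη1 : η ≤ 1) (hq : 0 < edens S)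
    (hqη : edens S ≤ ξ * η ^ 2)
    (hmid : hubDens S (fun u => ξ ^ 2 * η ≤ dens S u ∧ dens S u < η) ≤ ξ * edens S) :
    𝔼 φ, ind (Hom S J φ) ≤
      ∑ A ∈ indepSets H with starEdges H A = J, hubDens S (fun u => η ≤ dens S u) ^ #A +
      (if J = H.edgeFinset then
        (edens (avoid S fun u => η ≤ dens S u) ^ (1 / (Δ : ℝ))) ^ #H.edgeFinset else 0) +
      5 * Fintype.card V ^ 2 * (ξ ^ (1 / (Δ : ℝ)) * (edens S ^ (1 / (Δ : ℝ))) ^ #J) := by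
  have hΔ0 : 0 < Δ := by omega
  set U : Ω → Prop := fun u => η ≤ dens S u with hU
  set K := ξ ^ (1 / (Δ : ℝ)) * (edens S ^ (1 / (Δ : ℝ))) ^ #J with hK
  have hK0 : 0 ≤ K := by have := edens_nonneg S; positivity
  have hpt : ∀ φ : V → Ω, ind (Hom S J φ) ≤
      ∑ A ∈ indepSets H with starEdges H A = J, ind (Hom S J φ ∧ ∀ a ∈ A, U (φ a)) +
      (if J = H.edgeFinset then ind (Hom (avoid S U) H.edgeFinset φ) else 0) +
      ∑ x : V × V, if s(x.1, x.2) ∈ J then ind (Exceptional S Δ J ξ η x.1 x.2 φ) else 0 := by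
    intro φ
    have n1 : 0 ≤ ∑ A ∈ indepSets H with starEdges H A = J,
        ind (Hom S J φ ∧ ∀ a ∈ A, U (φ a)) := sum_nonneg fun _ _ => ind_nonneg _
    have n2 : 0 ≤ if J = H.edgeFinset then ind (Hom (avoid S U) H.edgeFinset φ) else 0 := by
      split_ifs
      · exact ind_nonneg _
      · exact le_rfl
    have n3 : ∀ x : V × V, 0 ≤
        if s(x.1, x.2) ∈ J then ind (Exceptional S Δ J ξ η x.1 x.2 φ) else 0 := by
      intro x
      split_ifs
      · exact ind_nonneg _
      · exact le_rfl
    have n3' := sum_nonneg fun x (_ : x ∈ (univ : Finset (V × V))) => n3 x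
    by_cases hφ : Hom S J φ
    · rw [ind_of_true hφ]
      by_cases hex : ∀ a b, s(a, b) ∈ J → ¬ Exceptional S Δ J ξ η a b φ
      · rcases hom_structure hreg hconn S hJ hξ hη hq hφ hex with ⟨A, hA, hAJ, hAU⟩ | ⟨hJE, h⟩
        · have : (1 : ℝ) ≤ ∑ A ∈ indepSets H with starEdges H A = J,
              ind (Hom S J φ ∧ ∀ a ∈ A, U (φ a)) := by
            rw [← ind_of_true (P := Hom S J φ ∧ ∀ a ∈ A, U (φ a)) ⟨hφ, hAU⟩]
            refine single_le_sum (f := fun A => ind (Hom S J φ ∧ ∀ a ∈ A, U (φ a)))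
              (fun _ _ => ind_nonneg _) ?_
            rw [mem_filter]
            exact ⟨mem_indepSets.2 hA, hAJ⟩
          linarith
        · rw [if_pos hJE, ind_of_true h]
          linarith
      · push Not at hex
        obtain ⟨a, b, hab, hx⟩ := hex
        have := single_le_sum (f := fun x : V × V =>
          if s(x.1, x.2) ∈ J then ind (Exceptional S Δ J ξ η x.1 x.2 φ) else 0)
          (fun x _ => n3 x) (mem_univ (a, b))
        simp only [hab, if_true, ind_of_true hx] at this
        linarith
    · rw [ind_of_false hφ]
      linarith
  refine (expect_le_expect fun φ _ => hpt φ).trans ?_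
  simp_rw [expect_add_distrib, expect_sum_comm]
  refine add_le_add (add_le_add ?_ ?_) ?_
  · refine sum_le_sum fun A hA => ?_
    rw [mem_filter, mem_indepSets] at hA
    obtain ⟨hA, rfl⟩ := hA
    exact expect_hom_hub_le S hΔ0 _ (edeg_le hreg hJ) A
      (fun e he => exists_mem_notMem_of_mem_starEdges hA he)
      (fun a ha => edeg_starEdges hreg ha) U
  · split_ifs with h
    · exact expect_hom_le _ hΔ0 _ (not_isDiag_of_mem (H := H) subset_rfl)
        (edeg_le hreg subset_rfl)
    · simp
  · have : ∀ x ∈ (univ : Finset (V × V)), 𝔼 φ : V → Ω,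
        (if s(x.1, x.2) ∈ J then ind (Exceptional S Δ J ξ η x.1 x.2 φ) else 0) ≤ 5 * K := by
      intro x _
      split_ifs with h
      · exact expect_exceptional_le hΔ hreg S hJ hξ hξ1 hη hη1 hqη hmid h
      · simp; exact hK0
    refine (sum_le_sum this).trans (le_of_eq ?_)
    rw [sum_const, card_univ, Fintype.card_prod, nsmul_eq_mul]
    push_cast
    ring

end Structure

/-! ### The independence polynomial and the convexity of the gain. -/

section IndepSum

variable {V : Type*} [Fintype V] [DecidableEq V] (H : SimpleGraph V)

/-- The independence polynomial without its constant term, as a sum over independent sets. -/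
noncomputable def indepSum (x : ℝ) : ℝ := ∑ A ∈ (indepSets H).erase ∅, x ^ #A

lemma empty_mem_indepSets : (∅ : Finset V) ∈ indepSets H := by
  rw [mem_indepSets]; simp [SimpleGraph.IsIndepSet]

lemma sum_indepSets (x : ℝ) : ∑ A ∈ indepSets H, x ^ #A = 1 + indepSum H x := by
  unfold indepSum
  rw [← add_sum_erase _ _ (empty_mem_indepSets H)]
  simp

lemma eval_independencePolynomial [DecidableRel H.Adj] (x : ℝ) :
    (independencePolynomial H).eval x = 1 + indepSum H x := by
  classical
  rw [← sum_indepSets, independencePolynomial, Polynomial.eval_finsetSum,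
    ← sum_fiberwise_of_maps_to (s := indepSets H) (t := range (Fintype.card V + 1)) (g := card)
      (fun A _ => mem_range.2 (Nat.lt_succ_of_le (card_le_univ A)))]
  refine sum_congr rfl fun k _ => ?_
  have : ∀ A ∈ (indepSets H).filter (fun A => #A = k), x ^ #A = x ^ k := by
    intro A hA; rw [(mem_filter.1 hA).2]
  rw [sum_congr rfl this, sum_const, nsmul_eq_mul]
  simp only [Polynomial.eval_mul, Polynomial.eval_C, Polynomial.eval_pow, Polynomial.eval_X]
  congr 3
  ext A
  simp [mem_indepSets, SimpleGraph.mem_indepSetFinset_iff, SimpleGraph.isNIndepSet_iff]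

lemma indepSum_zero : indepSum H 0 = 0 := by
  refine sum_eq_zero fun A hA => zero_pow ?_
  rw [mem_erase] at hA
  exact (card_pos.2 (nonempty_iff_ne_empty.2 hA.1)).ne'

lemma continuous_indepSum : Continuous (indepSum H) := by
  unfold indepSum; fun_prop

lemma indepSum_nonneg {x : ℝ} (hx : 0 ≤ x) : 0 ≤ indepSum H x :=
  sum_nonneg fun _ _ => pow_nonneg hx _

lemma singleton_mem_indepSets (a : V) : ({a} : Finset V) ∈ (indepSets H).erase ∅ := by
  rw [mem_erase, mem_indepSets]
  exact ⟨singleton_ne_empty a, by simp [SimpleGraph.IsIndepSet]⟩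

lemma strictMonoOn_indepSum [Nonempty V] : StrictMonoOn (indepSum H) (Set.Ici 0) := by
  intro x hx y _ hxy
  obtain ⟨a⟩ := ‹Nonempty V›
  refine sum_lt_sum (fun A _ => pow_le_pow_left₀ hx hxy.le _)
    ⟨{a}, singleton_mem_indepSets H a, by simpa using hxy⟩

lemma le_indepSum [Nonempty V] {x : ℝ} (hx : 0 ≤ x) : x ≤ indepSum H x := by
  obtain ⟨a⟩ := ‹Nonempty V›
  have := single_le_sum (f := fun A : Finset V => x ^ #A) (fun A _ => pow_nonneg hx _)
    (singleton_mem_indepSets H a)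
  rw [card_singleton, pow_one] at this
  exact this

/-- The intermediate value theorem on `[0, δ]`, where `le_indepSum` provides the upper end. -/
lemma exists_indepSum_eq [Nonempty V] {δ : ℝ} (hδ : 0 < δ) : ∃ θ, 0 < θ ∧ indepSum H θ = δ := by
  obtain ⟨θ, hθ, h⟩ := intermediate_value_Icc hδ.le (continuous_indepSum H).continuousOn
    (show δ ∈ Set.Icc (indepSum H 0) (indepSum H δ) from
      ⟨by rw [indepSum_zero]; exact hδ.le, le_indepSum H hδ.le⟩)
  refine ⟨θ, hθ.1.lt_of_ne ?_, h⟩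
  rintro rfl
  rw [indepSum_zero] at h
  exact hδ.ne h

lemma pow_le_mul_pow {x s : ℝ} (hx : 0 ≤ x) (hs : 0 < s) (hxs : x ≤ s) {k : ℕ} (hk : k ≠ 0) :
    x ^ k ≤ x / s * s ^ k := by
  obtain ⟨k, rfl⟩ := Nat.exists_eq_succ_of_ne_zero hk
  rw [pow_succ', pow_succ', ← mul_assoc, div_mul_cancel₀ _ hs.ne']
  exact mul_le_mul_of_nonneg_left (pow_le_pow_left₀ hx hxs _) hx

lemma rpow_le_mul_rpow {x s r : ℝ} (hx : 0 ≤ x) (hs : 0 < s) (hxs : x ≤ s) (hr : 1 ≤ r) :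
    x ^ r ≤ x / s * s ^ r := by
  have h1 : x ^ r = x * x ^ (r - 1) := by
    rw [← Real.rpow_one_add' hx (by linarith)]; congr 1; ring
  have h2 : s ^ r = s * s ^ (r - 1) := by
    rw [← Real.rpow_one_add' hs.le (by linarith)]; congr 1; ring
  rw [h1, h2, ← mul_assoc, div_mul_cancel₀ _ hs.ne']
  exact mul_le_mul_of_nonneg_left (Real.rpow_le_rpow hx hxs (by linarith)) hx

/-- Both summands vanish at `0` and lie below their chords to `s` and `2 * s`. The gain is thus at
most a convex combination of the two extreme strategies, hub only and clique only, and this is why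
the theorem has a minimum of two costs. -/
lemma indepSum_add_rpow_le {x y s r : ℝ} (hx : 0 ≤ x) (hy : 0 ≤ y) (hs : 0 < s)
    (hxy : x + y / 2 ≤ s) (hr : 1 ≤ r) :
    indepSum H x + y ^ r ≤ max (indepSum H s) ((2 * s) ^ r) := by
  have h1 : indepSum H x ≤ x / s * indepSum H s := by
    unfold indepSum
    rw [mul_sum]
    refine sum_le_sum fun A hA => pow_le_mul_pow hx hs (by linarith) ?_
    rw [mem_erase] at hA
    exact (card_pos.2 (nonempty_iff_ne_empty.2 hA.1)).ne'
  have h2 : y ^ r ≤ y / (2 * s) * (2 * s) ^ r :=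
    rpow_le_mul_rpow hy (by linarith) (by linarith) hr
  set m := max (indepSum H s) ((2 * s) ^ r)
  have hm0 : 0 ≤ m := (indepSum_nonneg H hs.le).trans (le_max_left _ _)
  have h3 : x / s * indepSum H s ≤ x / s * m := by gcongr; exact le_max_left _ _
  have h4 : y / (2 * s) * (2 * s) ^ r ≤ y / (2 * s) * m := by gcongr; exact le_max_right _ _
  have h5 : x / s + y / (2 * s) ≤ 1 := by
    have : x / s + y / (2 * s) = (x + y / 2) / s := by field_simp
    rw [this, div_le_one hs]; exact hxy
  have h6 := mul_le_mul_of_nonneg_right h5 hm0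
  linarith

end IndepSum

/-! ### The total gain over all subgraphs of `H`. -/

section Sum

variable {V Ω : Type*} [Fintype V] [DecidableEq V] [Fintype Ω] [Nonempty Ω]
  {H : SimpleGraph V} [DecidableRel H.Adj]

/-- The degree windows for different `k` are disjoint, so the edge masses in them add up to at most
`edens S`, and one of `R ≥ 1 / ξ` windows carries at most a fraction `ξ`. This makes the degree gap
used in `hom_structure` cheap to assume. -/
lemma exists_sparse_scale (S : Finset (Sym2 Ω)) {ξ : ℝ} (hξ : 0 < ξ) (hξ1 : ξ ≤ 1) {R : ℕ}
    (hR : 1 ≤ ξ * R) : ∃ k < R,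
      hubDens S (fun u => ξ ^ 2 * (ξ ^ 2) ^ k ≤ dens S u ∧ dens S u < (ξ ^ 2) ^ k) ≤
        ξ * edens S := by
  by_contra hcon
  push Not at hcon
  have hR0 : R ≠ 0 := by rintro rfl; norm_num at hR
  have h1 : ∑ k ∈ range R, ξ * edens S < ∑ k ∈ range R,
      hubDens S (fun u => ξ ^ 2 * (ξ ^ 2) ^ k ≤ dens S u ∧ dens S u < (ξ ^ 2) ^ k) :=
    sum_lt_sum_of_nonempty (nonempty_range_iff.2 hR0) fun k hk => hcon k (mem_range.1 hk)
  have h2 : ∑ k ∈ range R,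
      hubDens S (fun u => ξ ^ 2 * (ξ ^ 2) ^ k ≤ dens S u ∧ dens S u < (ξ ^ 2) ^ k) ≤ edens S := by
    unfold hubDens
    rw [← expect_sum_comm]
    refine expect_le_expect fun u _ => ?_
    rw [← sum_mul]
    refine mul_le_of_le_one_left (dens_nonneg S u) ?_
    have hk : ∀ k, ind (ξ ^ 2 * (ξ ^ 2) ^ k ≤ dens S u ∧ dens S u < (ξ ^ 2) ^ k) ≤
        ind ((ξ ^ 2) ^ (k + 1) ≤ dens S u) - ind ((ξ ^ 2) ^ k ≤ dens S u) := by
      intro k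
      have hle : (ξ ^ 2) ^ (k + 1) ≤ (ξ ^ 2) ^ k :=
        pow_le_pow_of_le_one (by positivity) (pow_le_one₀ hξ.le hξ1) (Nat.le_succ k)
      rw [← pow_succ']
      by_cases h : (ξ ^ 2) ^ k ≤ dens S u
      · rw [ind_of_true h, ind_of_true (hle.trans h), ind_of_false (fun h' => h'.2.not_ge h)]
        norm_num
      · rw [ind_of_false h, sub_zero]
        exact ind_mono fun h' => h'.1
    refine (sum_le_sum fun k _ => hk k).trans ?_
    rw [sum_range_sub fun k => ind ((ξ ^ 2) ^ k ≤ dens S u)]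
    have a := ind_le_one ((ξ ^ 2) ^ R ≤ dens S u)
    have b := ind_nonneg ((ξ ^ 2) ^ 0 ≤ dens S u)
    linarith
  rw [sum_const, card_range, nsmul_eq_mul] at h1
  have h3 := mul_le_mul_of_nonneg_right hR (edens_nonneg S)
  linarith

lemma rpow_inv_pow_card_le {Δ : ℕ} (hΔ : 0 < Δ) {q p C : ℝ} (hq : 0 ≤ q) (hp : 0 < p) (hC : 1 ≤ C)
    (hqp : q ≤ C * p ^ Δ) (k : ℕ) : (q ^ (1 / (Δ : ℝ))) ^ k ≤ C ^ k * p ^ k := by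
  have hΔ' : (0 : ℝ) < Δ := by exact_mod_cast hΔ
  rw [← mul_pow]
  refine pow_le_pow_left₀ (by positivity) ?_ k
  have hC0 : 0 < C := by linarith
  calc q ^ (1 / (Δ : ℝ)) ≤ (C ^ Δ * p ^ Δ) ^ (1 / (Δ : ℝ)) := by
        refine Real.rpow_le_rpow hq (hqp.trans ?_) (by positivity)
        gcongr
        exact le_self_pow₀ hC hΔ.ne'
    _ = C * p := by
        rw [← mul_pow, ← Real.rpow_natCast, ← Real.rpow_mul (by positivity), mul_one_div,
          div_self hΔ'.ne', Real.rpow_one]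

/-- The normalized homomorphism counts of all nonempty subgraphs of `H` into `S` are controlled by
a hub part `x` and a remaining part `y`. -/
lemma exists_sum_hom_le {Δ : ℕ} (hΔ : 2 ≤ Δ) (hreg : H.IsRegularOfDegree Δ)
    (hconn : H.Connected) (S : Finset (Sym2 Ω)) {ξ p C : ℝ} (hξ : 0 < ξ) (hξ1 : ξ ≤ 1)
    (hp : 0 < p) (hC : 1 ≤ C) {R : ℕ} (hR : 1 ≤ ξ * R)
    (hq1 : edens S ≤ ξ * ((ξ ^ 2) ^ R) ^ 2) (hq2 : edens S ≤ C * p ^ Δ) :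
    ∃ x y : ℝ, 0 ≤ x ∧ 0 ≤ y ∧ x + y / 2 ≤ (1 + ξ) * edens S / (2 * p ^ Δ) ∧
      ((∀ u, dens S u < (ξ ^ 2) ^ R) → x = 0) ∧
      ∑ J ∈ H.edgeFinset.powerset.erase ∅, (𝔼 φ : V → Ω, ind (Hom S J φ)) / p ^ #J ≤
        indepSum H x + y ^ ((Fintype.card V : ℝ) / 2) +
          2 ^ #H.edgeFinset * (5 * Fintype.card V ^ 2 * (ξ ^ (1 / (Δ : ℝ)) *
            C ^ #H.edgeFinset)) := by
  classical
  have hΔ0 : 0 < Δ := by omega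
  have hΔ' : (0 : ℝ) < Δ := by exact_mod_cast hΔ0
  have hv : 0 < Fintype.card V := Fintype.card_pos_iff.2 hconn.nonempty
  rcases (edens_nonneg S).eq_or_lt with h0 | hq
  · refine ⟨0, 0, le_rfl, le_rfl, by rw [← h0]; simp, fun _ => rfl, ?_⟩
    have : ∀ J ∈ H.edgeFinset.powerset.erase ∅,
        (𝔼 φ : V → Ω, ind (Hom S J φ)) / p ^ #J ≤ 0 := by
      intro J hJ
      rw [mem_erase, mem_powerset] at hJ
      refine div_nonpos_of_nonpos_of_nonneg ?_ (by positivity)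
      refine (expect_hom_le S hΔ0 J (not_isDiag_of_mem hJ.2) (edeg_le hreg hJ.2)).trans ?_
      rw [← h0, Real.zero_rpow (by positivity),
        zero_pow (card_pos.2 (nonempty_iff_ne_empty.2 hJ.1)).ne']
    refine (sum_nonpos this).trans ?_
    have := indepSum_nonneg H le_rfl
    have hC0 : 0 < C := by linarith
    positivity
  obtain ⟨k, hkR, hmid⟩ := exists_sparse_scale S hξ hξ1 hR
  set η := (ξ ^ 2) ^ k with hη
  have hη0 : 0 < η := by positivity
  have hη1 : η ≤ 1 := pow_le_one₀ (by positivity) (pow_le_one₀ hξ.le hξ1)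
  have hηR : (ξ ^ 2) ^ R ≤ η :=
    pow_le_pow_of_le_one (by positivity) (pow_le_one₀ hξ.le hξ1) hkR.le
  have hqη : edens S ≤ ξ * η ^ 2 := hq1.trans (by gcongr)
  set U : Ω → Prop := fun u => η ≤ dens S u with hU
  -- The hub part and the part avoiding the hubs, in units of `p ^ Δ`.
  refine ⟨hubDens S U / p ^ Δ, edens (avoid S U) / p ^ Δ,
    div_nonneg (hubDens_nonneg _ _) (by positivity), div_nonneg (edens_nonneg _) (by positivity),
    ?_, ?_, ?_⟩
  · have h1 := hubDens_add_avoid_le S U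
    have hμ : 𝔼 u, ind (U u) ≤ edens S / η := expect_dens_ge_le S hη0
    -- Hubs are so few that the pairs inside `U` are negligible in the budget.
    have h2 : (𝔼 u, ind (U u)) ^ 2 ≤ ξ * edens S := by
      calc (𝔼 u, ind (U u)) ^ 2 ≤ (edens S / η) ^ 2 :=
            pow_le_pow_left₀ (expect_nonneg fun _ _ => ind_nonneg _) hμ 2
        _ = edens S * edens S / η ^ 2 := by ring
        _ ≤ ξ * edens S := by
            rw [div_le_iff₀ (by positivity)]
            nlinarith
    rw [div_div, mul_comm (p ^ Δ) 2, ← mul_div_mul_left (hubDens S U) (p ^ Δ) two_ne_zero,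
      ← add_div]
    gcongr
    linarith
  · intro h
    have : hubDens S U = 0 := by
      refine expect_eq_zero fun u _ => ?_
      rw [ind_of_false, zero_mul]
      exact not_le.2 ((h u).trans_le hηR)
    rw [this, zero_div]
  have hEne : H.edgeFinset ∈ H.edgeFinset.powerset.erase ∅ := by
    simp only [mem_erase, mem_powerset, subset_refl, and_true]
    intro h
    have h2 := two_mul_card_edges hreg
    rw [h] at h2
    simp only [card_empty, mul_zero] at h2
    exact (Nat.mul_pos hΔ0 hv).ne h2
  have hJ : ∀ J ∈ H.edgeFinset.powerset.erase ∅, (𝔼 φ : V → Ω, ind (Hom S J φ)) / p ^ #J ≤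
      ∑ A ∈ indepSets H with starEdges H A = J, (hubDens S U / p ^ Δ) ^ #A +
      (if J = H.edgeFinset then (edens (avoid S U) / p ^ Δ) ^ ((Fintype.card V : ℝ) / 2) else 0) +
      5 * Fintype.card V ^ 2 * (ξ ^ (1 / (Δ : ℝ)) * C ^ #H.edgeFinset) := by
    intro J hJ
    rw [mem_erase, mem_powerset] at hJ
    have key := expect_hom_le_star_add hΔ hreg hconn S hJ.2 hξ hξ1 hη0 hη1 hq hqη hmid
    rw [div_le_iff₀ (by positivity)]
    refine key.trans ?_
    rw [add_mul, add_mul, sum_mul]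
    refine add_le_add (add_le_add (sum_le_sum ?_) ?_) ?_
    · intro A hA
      rw [mem_filter, mem_indepSets] at hA
      obtain ⟨hA, rfl⟩ := hA
      rw [card_starEdges hreg hA, pow_mul, ← mul_pow, div_mul_cancel₀ _ (by positivity)]
    · split_ifs with h
      · rw [h, Real.div_rpow (edens_nonneg _) (by positivity), ← Real.rpow_natCast,
          ← Real.rpow_mul (edens_nonneg _)]
        have hcard : (#H.edgeFinset : ℝ) = Δ * (Fintype.card V / 2) := by
          have := two_mul_card_edges hreg
          have h' : (2 : ℝ) * #H.edgeFinset = Δ * Fintype.card V := by exact_mod_cast this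
          linarith
        rw [← Real.rpow_natCast p #H.edgeFinset, hcard, ← Real.rpow_natCast p Δ,
          ← Real.rpow_mul hp.le, div_mul_cancel₀ _ (Real.rpow_pos_of_pos hp _).ne']
        apply le_of_eq
        congr 1
        field_simp
      · simp
    · have h1 : (edens S ^ (1 / (Δ : ℝ))) ^ #J ≤ C ^ #H.edgeFinset * p ^ #J := by
        refine (rpow_inv_pow_card_le hΔ0 hq.le hp hC hq2 #J).trans ?_
        gcongr ?_ * _
        exact pow_le_pow_right₀ hC (card_le_card hJ.2)
      calc _ ≤ 5 * (Fintype.card V : ℝ) ^ 2 *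
            (ξ ^ (1 / (Δ : ℝ)) * (C ^ #H.edgeFinset * p ^ #J)) := by gcongr
        _ = _ := by ring
  refine (sum_le_sum hJ).trans ?_
  rw [sum_add_distrib, sum_add_distrib]
  refine add_le_add (add_le_add ?_ ?_) ?_
  -- Every independent set `A` is counted for at most one `J`, its star edges; the empty set is not
  -- counted because its star is empty.
  · simp_rw [sum_filter]
    rw [sum_comm]
    unfold indepSum
    have hx0 : 0 ≤ hubDens S U / p ^ Δ := div_nonneg (hubDens_nonneg _ _) (by positivity)
    rw [← add_sum_erase _ _ (empty_mem_indepSets H)]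
    have hz : starEdges H (∅ : Finset V) = ∅ := by simp [starEdges]
    simp_rw [sum_ite_eq, hz]
    simp only [mem_erase, ne_eq, not_true_eq_false, false_and, if_false, zero_add]
    refine sum_le_sum fun A _ => ?_
    split_ifs
    · exact le_rfl
    · positivity
  · rw [sum_ite_eq', if_pos hEne]
  · rw [sum_const, nsmul_eq_mul]
    have hC0 : 0 < C := by linarith
    gcongr
    have : #(H.edgeFinset.powerset.erase ∅) ≤ 2 ^ #H.edgeFinset := by
      rw [← card_powerset]
      exact card_le_card (erase_subset _ _)
    exact_mod_cast this

end Sum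

/-! ### Densities versus numbers of edges. -/

section EdgeCount

variable {Ω : Type*} [Fintype Ω] [Nonempty Ω]

lemma card_filter_mk_eq [DecidableEq Ω] {e : Sym2 Ω} (he : ¬ e.IsDiag) :
    #{x : Ω × Ω | s(x.1, x.2) = e} = 2 := by
  induction e using Sym2.ind with
  | _ a b =>
    have hne : a ≠ b := by simpa using he
    have : (univ.filter fun x : Ω × Ω => s(x.1, x.2) = s(a, b)) = {(a, b), (b, a)} := by
      ext ⟨x, y⟩
      simp
    rw [this, card_pair]
    simp [hne]

lemma card_sq_mul_edens (S : Finset (Sym2 Ω)) (hS : ∀ e ∈ S, ¬ e.IsDiag) :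
    (Fintype.card Ω : ℝ) ^ 2 * edens S = 2 * #S := by
  classical
  have h1 : (Fintype.card Ω : ℝ) ^ 2 * edens S = ∑ x : Ω × Ω, adj S x.1 x.2 := by
    unfold edens dens
    rw [sq, mul_assoc, Fintype.card_mul_expect, mul_sum, Fintype.sum_prod_type]
    exact sum_congr rfl fun u _ => Fintype.card_mul_expect _
  rw [h1]
  have h2 : ∀ x : Ω × Ω, adj S x.1 x.2 = ∑ e ∈ S, if s(x.1, x.2) = e then 1 else 0 := by
    intro x
    rw [sum_ite_eq]
    unfold adj ind
    congr
  simp_rw [h2]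
  rw [sum_comm]
  have h3 : ∀ e ∈ S, ∑ x : Ω × Ω, (if s(x.1, x.2) = e then (1 : ℝ) else 0) = 2 := by
    intro e he
    rw [sum_boole, card_filter_mk_eq (hS e he)]
    norm_num
  rw [sum_congr rfl h3, sum_const, nsmul_eq_mul, mul_comm]

open Classical in
lemma card_mul_dens (S : Finset (Sym2 Ω)) (u : Ω) :
    (Fintype.card Ω : ℝ) * dens S u = #{v | s(u, v) ∈ S} := by
  unfold dens
  rw [Fintype.card_mul_expect, ← sum_boole]
  exact sum_congr rfl fun v _ => by unfold adj ind; congr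

lemma card_mul_dens_le (S : Finset (Sym2 Ω)) (u : Ω) :
    (Fintype.card Ω : ℝ) * dens S u ≤ #S := by
  classical
  rw [card_mul_dens]
  norm_cast
  refine card_le_card_of_injOn (fun v => s(u, v)) ?_ ?_
  · intro v hv
    simpa using hv
  · intro v _ w _ h
    exact Sym2.congr_right.1 h

end EdgeCount

/-! ### The conditional expectation given a planted edge set. -/

section CondSum

variable {V Ω : Type*} [Fintype V] [DecidableEq V] [Fintype Ω] [DecidableEq Ω]
  (H : SimpleGraph V) [DecidableRel H.Adj]

/-- The edge set of the copy of `H` given by an embedding. -/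
def copyEdges (φ : V ↪ Ω) : Finset (Sym2 Ω) := H.edgeFinset.image (Sym2.map φ)

/-- The expected number of embeddings of `H` into the random graph, conditioned on containing
`S`. -/
noncomputable def condSum (S : Finset (Sym2 Ω)) (p : ℝ) : ℝ :=
  ∑ φ : V ↪ Ω, p ^ #(copyEdges H φ \ S)

/-- The edges of `H` that are mapped into `S`. -/
def pulled (S : Finset (Sym2 Ω)) (φ : V ↪ Ω) : Finset (Sym2 V) :=
  H.edgeFinset.filter fun e => e.map φ ∈ S

variable {H}

lemma card_copyEdges (φ : V ↪ Ω) : #(copyEdges H φ) = #H.edgeFinset :=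
  card_image_of_injective _ (Sym2.map.injective φ.injective)

lemma card_copyEdges_sdiff (S : Finset (Sym2 Ω)) (φ : V ↪ Ω) :
    #(copyEdges H φ \ S) = #H.edgeFinset - #(pulled H S φ) := by
  have h : copyEdges H φ \ S = (H.edgeFinset.filter fun e => ¬ e.map φ ∈ S).image (Sym2.map φ) := by
    ext x
    simp only [copyEdges, Finset.mem_sdiff, mem_image, mem_filter]
    constructor
    · rintro ⟨⟨e, he, rfl⟩, hx⟩; exact ⟨e, ⟨he, hx⟩, rfl⟩
    · rintro ⟨e, ⟨he, hx⟩, rfl⟩; exact ⟨⟨e, he, rfl⟩, hx⟩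
  rw [h, card_image_of_injective _ (Sym2.map.injective φ.injective)]
  have := card_filter_add_card_filter_not (s := H.edgeFinset) (fun e => e.map φ ∈ S)
  unfold pulled
  omega

lemma copyEdges_not_isDiag (φ : V ↪ Ω) (e : Sym2 Ω) (he : e ∈ copyEdges H φ) : ¬ e.IsDiag := by
  simp only [copyEdges, mem_image, SimpleGraph.mem_edgeFinset] at he
  obtain ⟨e, he, rfl⟩ := he
  induction e using Sym2.ind with
  | _ a b =>
    have := H.ne_of_adj he
    simpa using this

lemma hom_pulled (S : Finset (Sym2 Ω)) (φ : V ↪ Ω) : Hom S (pulled H S φ) φ :=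
  fun _ he => (mem_filter.1 he).2

lemma pulled_subset (S : Finset (Sym2 Ω)) (φ : V ↪ Ω) : pulled H S φ ⊆ H.edgeFinset :=
  filter_subset _ _

lemma condSum_empty (p : ℝ) :
    condSum H (∅ : Finset (Sym2 Ω)) p = Fintype.card (V ↪ Ω) * p ^ #H.edgeFinset := by
  unfold condSum
  simp_rw [sdiff_empty, card_copyEdges]
  simp

lemma sum_embedding_le (f : (V → Ω) → ℝ) (hf : ∀ φ, 0 ≤ f φ) :
    ∑ φ : V ↪ Ω, f φ ≤ (Fintype.card Ω : ℝ) ^ Fintype.card V * 𝔼 φ : V → Ω, f φ := by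
  have h : (Fintype.card Ω : ℝ) ^ Fintype.card V = (Fintype.card (V → Ω) : ℝ) := by simp
  rw [h, Fintype.card_mul_expect]
  rw [← sum_image (s := univ) (g := fun φ : V ↪ Ω => (φ : V → Ω))
    (fun a _ b _ h => DFunLike.coe_injective h)]
  exact sum_le_sum_of_subset_of_nonneg (subset_univ _) fun _ _ _ => hf _

/-- An embedding for which exactly the edges in `J` land in `S` has weight `p ^ (e(H) - #J)`.
Summing over all nonempty `J` with `Hom S J φ` only overcounts, and passing from injective maps to
all maps produces homomorphism densities. -/
lemma condSum_le (S : Finset (Sym2 Ω)) {p : ℝ} (hp : 0 < p) :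
    condSum H S p ≤ condSum H (∅ : Finset (Sym2 Ω)) p +
      (Fintype.card Ω : ℝ) ^ Fintype.card V * p ^ #H.edgeFinset *
        ∑ J ∈ H.edgeFinset.powerset.erase ∅, (𝔼 φ : V → Ω, ind (Hom S J φ)) / p ^ #J := by
  have hpt : ∀ φ : V ↪ Ω, p ^ #(copyEdges H φ \ S) ≤ p ^ #H.edgeFinset +
      p ^ #H.edgeFinset * ∑ J ∈ H.edgeFinset.powerset.erase ∅, ind (Hom S J φ) / p ^ #J := by
    intro φ
    have hnn : ∀ J ∈ H.edgeFinset.powerset.erase ∅, 0 ≤ ind (Hom S J φ) / p ^ #J :=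
      fun J _ => div_nonneg (ind_nonneg _) (by positivity)
    rw [card_copyEdges_sdiff]
    by_cases h : pulled H S φ = ∅
    · rw [h, card_empty, Nat.sub_zero]
      have := sum_nonneg hnn
      nlinarith [pow_pos hp #H.edgeFinset]
    · have hmem : pulled H S φ ∈ H.edgeFinset.powerset.erase ∅ := by
        rw [mem_erase, mem_powerset]; exact ⟨h, pulled_subset S φ⟩
      have h1 := single_le_sum hnn hmem
      rw [ind_of_true (hom_pulled S φ)] at h1
      have h2 : p ^ (#H.edgeFinset - #(pulled H S φ)) =
          p ^ #H.edgeFinset * (1 / p ^ #(pulled H S φ)) := by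
        rw [mul_one_div, eq_div_iff (by positivity), ← pow_add,
          Nat.sub_add_cancel (card_le_card (pulled_subset S φ))]
      rw [h2]
      have h3 := mul_le_mul_of_nonneg_left h1 (pow_pos hp #H.edgeFinset).le
      linarith [pow_pos hp #H.edgeFinset]
  refine (sum_le_sum fun φ _ => hpt φ).trans ?_
  rw [sum_add_distrib, condSum_empty, sum_const, card_univ, nsmul_eq_mul]
  refine add_le_add_right ?_ _
  rw [← mul_sum, sum_comm, mul_comm (_ ^ _) (p ^ _), mul_assoc]
  refine mul_le_mul_of_nonneg_left ?_ (by positivity)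
  rw [mul_sum]
  refine sum_le_sum fun J _ => ?_
  rw [← sum_div, mul_div_assoc']
  refine div_le_div_of_nonneg_right ?_ (by positivity)
  exact sum_embedding_le (fun φ : V → Ω => ind (Hom S J φ)) fun _ => ind_nonneg _

/-- The total effect of removing single edges of `F` from `S`. -/
lemma sum_condSum_sub_le (S : Finset (Sym2 Ω)) {F : Finset (Sym2 Ω)} (hF : F ⊆ S) {p : ℝ}
    (hp : 0 < p) :
    ∑ e ∈ F, (condSum H S p - condSum H (S.erase e) p) ≤
      (Fintype.card Ω : ℝ) ^ Fintype.card V * p ^ #H.edgeFinset *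
        ∑ J ∈ H.edgeFinset.powerset, ∑ e ∈ J,
          (𝔼 φ : V → Ω, ind (Hom S J φ ∧ e.map φ ∈ F)) / p ^ #J := by
  have h1 : ∀ φ : V ↪ Ω, ∑ e ∈ F, (p ^ #(copyEdges H φ \ S) - p ^ #(copyEdges H φ \ S.erase e)) ≤
      p ^ #H.edgeFinset *
        ∑ J ∈ H.edgeFinset.powerset, ∑ e ∈ J, ind (Hom S J φ ∧ e.map φ ∈ F) / p ^ #J := by
    intro φ
    have hmem : pulled H S φ ∈ H.edgeFinset.powerset := mem_powerset.2 (pulled_subset S φ)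
    have h2 : p ^ #(copyEdges H φ \ S) =
        p ^ #H.edgeFinset * (1 / p ^ #(pulled H S φ)) := by
      rw [card_copyEdges_sdiff, mul_one_div, eq_div_iff (by positivity), ← pow_add,
        Nat.sub_add_cancel (card_le_card (pulled_subset S φ))]
    -- Removing an edge outside the copy has no effect; removing an edge of the copy lowers the
    -- weight by at most the weight itself.
    have h3 : ∑ e ∈ F, (p ^ #(copyEdges H φ \ S) - p ^ #(copyEdges H φ \ S.erase e)) ≤
        ∑ e ∈ F with e ∈ copyEdges H φ, p ^ #(copyEdges H φ \ S) := by
      rw [sum_filter]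
      refine sum_le_sum fun e _ => ?_
      split_ifs with he
      · have : 0 ≤ p ^ #(copyEdges H φ \ S.erase e) := by positivity
        linarith
      · have : copyEdges H φ \ S.erase e = copyEdges H φ \ S := by
          ext x
          simp only [Finset.mem_sdiff, mem_erase]
          constructor
          · rintro ⟨hx, h⟩
            refine ⟨hx, fun hxS => h ⟨?_, hxS⟩⟩
            rintro rfl; exact he hx
          · rintro ⟨hx, h⟩; exact ⟨hx, fun h' => h h'.2⟩
        rw [this, sub_self]
    refine h3.trans ?_
    rw [sum_const, nsmul_eq_mul, h2]
    have h4 : (#{e ∈ F | e ∈ copyEdges H φ} : ℝ) ≤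
        ∑ e ∈ pulled H S φ, ind (Hom S (pulled H S φ) φ ∧ e.map φ ∈ F) := by
      have h5 : {e ∈ F | e ∈ copyEdges H φ} ⊆
          ((pulled H S φ).filter fun e => e.map φ ∈ F).image (Sym2.map φ) := by
        intro x hx
        simp only [mem_filter, copyEdges, mem_image] at hx
        obtain ⟨hxF, e, he, rfl⟩ := hx
        exact mem_image.2 ⟨e, by simp only [pulled, mem_filter]; exact ⟨⟨he, hF hxF⟩, hxF⟩, rfl⟩
      have h6 := (card_le_card h5).trans card_image_le
      refine (Nat.cast_le.2 h6).trans (le_of_eq ?_)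
      rw [← sum_boole]
      refine sum_congr rfl fun e _ => ?_
      rw [ind_and, ind_of_true (hom_pulled S φ), one_mul]
      unfold ind
      congr
    have h7 := single_le_sum (f := fun J => ∑ e ∈ J, ind (Hom S J φ ∧ e.map φ ∈ F) / p ^ #J)
      (fun J _ => sum_nonneg fun e _ => div_nonneg (ind_nonneg _) (by positivity)) hmem
    rw [← sum_div] at h7
    have hpE := pow_pos hp #H.edgeFinset
    calc (#{e ∈ F | e ∈ copyEdges H φ} : ℝ) * (p ^ #H.edgeFinset * (1 / p ^ #(pulled H S φ)))
        ≤ (∑ e ∈ pulled H S φ, ind (Hom S (pulled H S φ) φ ∧ e.map φ ∈ F)) *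
          (p ^ #H.edgeFinset * (1 / p ^ #(pulled H S φ))) := by gcongr
      _ = p ^ #H.edgeFinset * ((∑ e ∈ pulled H S φ,
          ind (Hom S (pulled H S φ) φ ∧ e.map φ ∈ F)) / p ^ #(pulled H S φ)) := by ring
      _ ≤ _ := mul_le_mul_of_nonneg_left h7 hpE.le
  unfold condSum
  simp_rw [← sum_sub_distrib]
  rw [sum_comm]
  refine (sum_le_sum fun φ _ => h1 φ).trans ?_
  rw [← mul_sum, sum_comm, mul_comm (_ ^ _) (p ^ _), mul_assoc]
  refine mul_le_mul_of_nonneg_left ?_ (by positivity)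
  rw [mul_sum]
  refine sum_le_sum fun J _ => ?_
  rw [sum_comm, mul_sum]
  refine sum_le_sum fun e _ => ?_
  rw [← sum_div, mul_div_assoc']
  refine div_le_div_of_nonneg_right ?_ (by positivity)
  exact sum_embedding_le (fun φ : V → Ω => ind (Hom S J φ ∧ e.map φ ∈ F)) fun _ => ind_nonneg _

end CondSum

/-! ### The variational problem: small edge sets gain too little. -/

section Variational

variable {V : Type*} [Fintype V] [DecidableEq V] {H : SimpleGraph V} [DecidableRel H.Adj]

lemma tendsto_card_embedding (V : Type*) [Fintype V] :
    Tendsto (fun n : ℕ => (Fintype.card (V ↪ Fin n) : ℝ) / (n : ℝ) ^ Fintype.card V)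
      atTop (𝓝 1) := by
  have h : ∀ n : ℕ, (Fintype.card (V ↪ Fin n) : ℝ) / (n : ℝ) ^ Fintype.card V =
      (n.descFactorial (Fintype.card V) : ℝ) / (n : ℝ) ^ Fintype.card V := by
    intro n
    rw [Fintype.card_embedding_eq, Fintype.card_fin]
  simp_rw [h]
  induction Fintype.card V with
  | zero => simp
  | succ k ih =>
    have h2 : Tendsto (fun n : ℕ => ((n - k : ℕ) : ℝ) / n) atTop (𝓝 1) := by
      have h3 : Tendsto (fun n : ℕ => 1 - (k : ℝ) / n) atTop (𝓝 (1 - 0)) :=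
        tendsto_const_nhds.sub (tendsto_const_div_atTop_nhds_zero_nat (k : ℝ))
      rw [sub_zero] at h3
      refine h3.congr' ?_
      filter_upwards [eventually_ge_atTop (k + 1)] with n hn
      have : (n : ℝ) ≠ 0 := by exact_mod_cast (by omega : n ≠ 0)
      rw [Nat.cast_sub (by omega)]
      field_simp
    have := h2.mul ih
    rw [one_mul] at this
    refine this.congr fun n => ?_
    rw [Nat.descFactorial_succ, pow_succ']
    push_cast
    rw [div_mul_div_comm]

/-- Edge sets with few edges do not increase the conditional expectation by much more than a hub
part `x` and a remaining part `y` of total size bounded by the number of edges. -/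
lemma exists_condSum_le {Δ : ℕ} (hΔ : 2 ≤ Δ) (hreg : H.IsRegularOfDegree Δ)
    (hconn : H.Connected) {c c' ζ : ℝ} (hc : 0 < c) (hcc' : c < c') (hζ : 0 < ζ) :
    ∃ p₀ > 0, ∀ᶠ n : ℕ in atTop, ∀ p : ℝ, 0 < p → p < p₀ → ∀ S : Finset (Sym2 (Fin n)),
      (∀ e ∈ S, ¬ e.IsDiag) → (#S : ℝ) ≤ c * ((n : ℝ) ^ 2 * p ^ Δ) →
      ∃ x y : ℝ, 0 ≤ x ∧ 0 ≤ y ∧ x + y / 2 ≤ c' ∧ ((n : ℝ) * p ^ Δ < p₀ → x = 0) ∧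
        condSum H S p ≤ condSum H (∅ : Finset (Sym2 (Fin n))) p *
          (1 + (1 + ζ) * (indepSum H x + y ^ ((Fintype.card V : ℝ) / 2) + ζ)) := by
  have hΔ0 : 0 < Δ := by omega
  have hΔ' : (0 : ℝ) < Δ := by exact_mod_cast hΔ0
  set C : ℝ := 2 * c + 1 with hC
  have hC1 : 1 ≤ C := by linarith
  have hξex : ∃ ξ : ℝ, 0 < ξ ∧ ξ ≤ 1 ∧ (1 + ξ) * c ≤ c' ∧
      2 ^ #H.edgeFinset * (5 * Fintype.card V ^ 2 * (ξ ^ (1 / (Δ : ℝ)) *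
        C ^ #H.edgeFinset)) ≤ ζ := by
    have hcont : Tendsto (fun ξ : ℝ => 2 ^ #H.edgeFinset * (5 * (Fintype.card V : ℝ) ^ 2 *
        (ξ ^ (1 / (Δ : ℝ)) * C ^ #H.edgeFinset))) (𝓝[>] 0) (𝓝 0) := by
      have h1 : Tendsto (fun ξ : ℝ => ξ ^ (1 / (Δ : ℝ))) (𝓝[>] 0) (𝓝 0) := by
        have := (Real.continuousAt_rpow_const (0 : ℝ) (1 / (Δ : ℝ)) (Or.inr (by positivity))).tendsto
        rw [Real.zero_rpow (by positivity)] at this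
        exact this.mono_left nhdsWithin_le_nhds
      have h2 := ((h1.mul_const (C ^ #H.edgeFinset)).const_mul
        (5 * (Fintype.card V : ℝ) ^ 2)).const_mul (2 ^ #H.edgeFinset : ℝ)
      simpa using h2
    have e1 := hcont.eventually_le_const hζ
    have e2 : ∀ᶠ ξ : ℝ in 𝓝[>] 0, (1 + ξ) * c ≤ c' := by
      have : Tendsto (fun ξ : ℝ => (1 + ξ) * c) (𝓝[>] 0) (𝓝 ((1 + 0) * c)) :=
        ((continuous_const.add continuous_id).mul continuous_const).continuousAt.tendsto.mono_left
          nhdsWithin_le_nhds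
      refine this.eventually_le_const ?_
      linarith
    have e3 : ∀ᶠ ξ : ℝ in 𝓝[>] 0, ξ ≤ 1 :=
      nhdsWithin_le_nhds (eventually_le_nhds one_pos)
    obtain ⟨ξ, h1, h2, h3, h4⟩ := (e1.and (e2.and (e3.and self_mem_nhdsWithin))).exists
    exact ⟨ξ, h4, h3, h2, h1⟩
  obtain ⟨ξ, hξ, hξ1, hξc, hξζ⟩ := hξex
  obtain ⟨R, hR⟩ := exists_nat_ge (1 / ξ)
  have hR' : 1 ≤ ξ * R := by rw [div_le_iff₀ hξ] at hR; linarith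
  set η : ℝ := (ξ ^ 2) ^ R with hη
  have hη0 : 0 < η := by positivity
  -- The second entry makes `edens S ≤ 2 * c * p ^ Δ` small compared with all `R` degree scales. The
  -- third pushes every degree, at most `c * n * p ^ Δ`, below `η` once `n * p ^ Δ < p₀`, so that no
  -- hub exists.
  set p₀ : ℝ := min 1 (min (ξ * η ^ 2 / (2 * c)) (η / c)) with hp₀
  refine ⟨p₀, by positivity, ?_⟩
  have hN : ∀ᶠ n : ℕ in atTop, (1 + ζ)⁻¹ <
      (Fintype.card (V ↪ Fin n) : ℝ) / (n : ℝ) ^ Fintype.card V := by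
    refine (tendsto_card_embedding V).eventually_const_lt ?_
    exact inv_lt_one_of_one_lt₀ (by linarith)
  filter_upwards [hN, eventually_gt_atTop 0] with n hn hn0 p hp hpp₀ S hS hcard
  have : Nonempty (Fin n) := ⟨⟨0, hn0⟩⟩
  have hnR : (0 : ℝ) < n := by exact_mod_cast hn0
  have hp1 : p ≤ 1 := (hpp₀.trans_le (min_le_left _ _)).le
  have hpΔ : p ^ Δ ≤ p := pow_le_of_le_one hp.le hp1 hΔ0.ne'
  have hq : edens S ≤ 2 * c * p ^ Δ := by
    have h1 := card_sq_mul_edens S hS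
    rw [Fintype.card_fin] at h1
    have h2 : (n : ℝ) ^ 2 * edens S ≤ (n : ℝ) ^ 2 * (2 * c * p ^ Δ) := by
      rw [h1]; linarith
    exact le_of_mul_le_mul_left h2 (by positivity)
  have hp2 : p < ξ * η ^ 2 / (2 * c) := hpp₀.trans_le ((min_le_right _ _).trans (min_le_left _ _))
  have hpη : p₀ ≤ η / c := (min_le_right _ _).trans (min_le_right _ _)
  rw [lt_div_iff₀ (by positivity)] at hp2
  have hq1 : edens S ≤ ξ * ((ξ ^ 2) ^ R) ^ 2 := by
    refine hq.trans ?_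
    rw [← hη]
    nlinarith
  have hq2 : edens S ≤ C * p ^ Δ := by
    refine hq.trans ?_
    rw [hC]
    nlinarith [pow_pos hp Δ]
  obtain ⟨x, y, hx, hy, hxy, hx0, hsum⟩ :=
    exists_sum_hom_le hΔ hreg hconn S hξ hξ1 hp hC1 hR' hq1 hq2
  refine ⟨x, y, hx, hy, hxy.trans ?_, ?_, ?_⟩
  · rw [div_le_iff₀ (by positivity)]
    calc (1 + ξ) * edens S ≤ (1 + ξ) * (2 * c * p ^ Δ) := by gcongr
      _ = (1 + ξ) * c * (2 * p ^ Δ) := by ring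
      _ ≤ c' * (2 * p ^ Δ) := by gcongr
  · intro hnp
    refine hx0 fun u => ?_
    have h1 := card_mul_dens_le S u
    rw [Fintype.card_fin] at h1
    have h2 : (n : ℝ) * dens S u ≤ n * (c * (n * p ^ Δ)) := by
      refine h1.trans (hcard.trans (le_of_eq (by ring)))
    have h3 : dens S u ≤ c * (n * p ^ Δ) := le_of_mul_le_mul_left h2 hnR
    refine h3.trans_lt ?_
    have := hnp.trans_le hpη
    rw [lt_div_iff₀ hc] at this
    linarith
  · refine (condSum_le S hp).trans ?_
    rw [mul_add, mul_one]
    refine add_le_add_right ?_ _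
    rw [condSum_empty, Fintype.card_fin]
    set T := ∑ J ∈ H.edgeFinset.powerset.erase ∅, (𝔼 φ : V → Fin n, ind (Hom S J φ)) / p ^ #J
    have hT0 : 0 ≤ T := sum_nonneg fun J _ =>
      div_nonneg (expect_nonneg fun _ _ => ind_nonneg _) (by positivity)
    have hB : T ≤ indepSum H x + y ^ ((Fintype.card V : ℝ) / 2) + ζ := by linarith
    have hB0 : 0 ≤ indepSum H x + y ^ ((Fintype.card V : ℝ) / 2) + ζ := by
      have := indepSum_nonneg H hx
      positivity
    rw [lt_div_iff₀ (by positivity), inv_mul_lt_iff₀ (by linarith)] at hn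
    calc (n : ℝ) ^ Fintype.card V * p ^ #H.edgeFinset * T
        ≤ ((1 + ζ) * Fintype.card (V ↪ Fin n)) * p ^ #H.edgeFinset *
          (indepSum H x + y ^ ((Fintype.card V : ℝ) / 2) + ζ) := by
          gcongr
      _ = _ := by ring

lemma exists_slack {B δ : ℝ} (hB : B < δ) :
    ∃ ζ > 0, ∃ ε > 0, 1 + (1 + ζ) * (B + ζ) < 1 + δ - ε := by
  have : Tendsto (fun ζ : ℝ => 1 + (1 + ζ) * (B + ζ) + ζ) (𝓝[>] 0)
      (𝓝 (1 + (1 + 0) * (B + 0) + 0)) := by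
    refine (Continuous.tendsto (by fun_prop) 0).mono_left nhdsWithin_le_nhds
  have h2 := this.eventually_lt_const (show 1 + (1 + 0) * (B + 0) + 0 < 1 + δ by linarith)
  obtain ⟨ζ, h1, h3⟩ := (h2.and self_mem_nhdsWithin).exists
  exact ⟨ζ, h3, ζ, h3, by linarith⟩

lemma condSum_empty_pos [Nonempty V] {n : ℕ} (hn : Fintype.card V ≤ n) {p : ℝ} (hp : 0 < p) :
    0 < condSum H (∅ : Finset (Sym2 (Fin n))) p := by
  rw [condSum_empty]
  have : 0 < Fintype.card (V ↪ Fin n) := by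
    rw [Fintype.card_embedding_eq, Fintype.card_fin]
    exact Nat.descFactorial_pos.2 hn
  positivity

/-- Small edge sets do not make the upper tail event typical. -/
lemma condSum_lt_of_card_le {Δ : ℕ} (hΔ : 2 ≤ Δ) (hreg : H.IsRegularOfDegree Δ)
    (hconn : H.Connected) {c c' δ : ℝ} (hc : 0 < c) (hcc' : c < c')
    (h1 : indepSum H c' < δ) (h2 : (2 * c') ^ ((Fintype.card V : ℝ) / 2) < δ) :
    ∃ ε > 0, ∃ p₀ > 0, ∀ᶠ n : ℕ in atTop, ∀ p : ℝ, 0 < p → p < p₀ →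
      ∀ S : Finset (Sym2 (Fin n)), (∀ e ∈ S, ¬ e.IsDiag) →
      (#S : ℝ) ≤ c * ((n : ℝ) ^ 2 * p ^ Δ) →
        condSum H S p < (1 + δ - ε) * condSum H (∅ : Finset (Sym2 (Fin n))) p := by
  have := hconn.nonempty
  obtain ⟨ζ, hζ, ε, hε, hlt⟩ := exists_slack (max_lt h1 h2)
  obtain ⟨p₀, hp₀, hev⟩ := exists_condSum_le hΔ hreg hconn hc hcc' hζ
  refine ⟨ε, hε, p₀, hp₀, ?_⟩
  filter_upwards [hev, eventually_ge_atTop (Fintype.card V)] with n hn hnv p hp hpp₀ S hS hcard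
  obtain ⟨x, y, hx, hy, hxy, -, hle⟩ := hn p hp hpp₀ S hS hcard
  refine hle.trans_lt ?_
  have hr : 1 ≤ (Fintype.card V : ℝ) / 2 := by
    obtain ⟨a⟩ := hconn.nonempty
    have : 2 < Fintype.card V + 1 := by
      have := H.degree_lt_card_verts a
      rw [hreg a] at this
      omega
    rw [le_div_iff₀ two_pos]
    exact_mod_cast Nat.lt_succ_iff.1 this
  have hB := indepSum_add_rpow_le H hx hy (hc.trans hcc') hxy hr
  rw [mul_comm]
  refine mul_lt_mul_of_pos_right (lt_of_le_of_lt ?_ hlt) (condSum_empty_pos hnv hp)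
  gcongr

/-- If `n * p ^ Δ` is small, a set of this size contains no hub, so `x = 0` and only the clique term
has to stay below `δ`. -/
lemma condSum_lt_of_card_le_of_sparse {Δ : ℕ} (hΔ : 2 ≤ Δ) (hreg : H.IsRegularOfDegree Δ)
    (hconn : H.Connected) {c c' δ : ℝ} (hc : 0 < c) (hcc' : c < c')
    (h2 : (2 * c') ^ ((Fintype.card V : ℝ) / 2) < δ) :
    ∃ ε > 0, ∃ p₀ > 0, ∀ᶠ n : ℕ in atTop, ∀ p : ℝ, 0 < p → p < p₀ → (n : ℝ) * p ^ Δ < p₀ →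
      ∀ S : Finset (Sym2 (Fin n)), (∀ e ∈ S, ¬ e.IsDiag) →
      (#S : ℝ) ≤ c * ((n : ℝ) ^ 2 * p ^ Δ) →
        condSum H S p < (1 + δ - ε) * condSum H (∅ : Finset (Sym2 (Fin n))) p := by
  have := hconn.nonempty
  obtain ⟨ζ, hζ, ε, hε, hlt⟩ := exists_slack h2
  obtain ⟨p₀, hp₀, hev⟩ := exists_condSum_le hΔ hreg hconn hc hcc' hζ
  refine ⟨ε, hε, p₀, hp₀, ?_⟩
  filter_upwards [hev, eventually_ge_atTop (Fintype.card V)] with n hn hnv p hp hpp₀ hnp S hS hcard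
  obtain ⟨x, y, hx, hy, hxy, hx0, hle⟩ := hn p hp hpp₀ S hS hcard
  refine hle.trans_lt ?_
  rw [hx0 hnp] at hxy ⊢
  rw [indepSum_zero, zero_add]
  have hB : y ^ ((Fintype.card V : ℝ) / 2) ≤ (2 * c') ^ ((Fintype.card V : ℝ) / 2) :=
    Real.rpow_le_rpow hy (by linarith) (by positivity)
  rw [mul_comm]
  refine mul_lt_mul_of_pos_right (lt_of_le_of_lt ?_ hlt) (condSum_empty_pos hnv hp)
  gcongr

end Variational

/-! ### Embeddings versus copies. -/

section CopyCount

variable {V W : Type*} [Fintype V] [DecidableEq V] [Fintype W] [DecidableEq W]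
  {H : SimpleGraph V} [DecidableRel H.Adj]

lemma toSubgraph_comp_iso {G : SimpleGraph W} (f : H.Copy G) (α : H ≃g H) :
    (f.comp α.toCopy).toSubgraph = f.toSubgraph := by
  ext x y
  · simp only [SimpleGraph.Subgraph.map_verts, SimpleGraph.Subgraph.verts_top, Set.image_univ,
      Set.mem_range]
    constructor
    · rintro ⟨a, rfl⟩; exact ⟨α a, rfl⟩
    · rintro ⟨a, rfl⟩; exact ⟨α.symm a, by simp⟩
  · simp only [SimpleGraph.Subgraph.map_adj, Relation.Map, SimpleGraph.Subgraph.top_adj]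
    constructor
    · rintro ⟨a, b, hab, rfl, rfl⟩
      exact ⟨α a, α b, α.map_adj_iff.2 hab, rfl, rfl⟩
    · rintro ⟨a, b, hab, rfl, rfl⟩
      exact ⟨α.symm a, α.symm b, α.symm.map_adj_iff.2 hab, by simp, by simp⟩

/-- Together with `toSubgraph_comp_iso`: the fibres of `toSubgraph` are the orbits of the
automorphism group. -/
lemma exists_iso_of_toSubgraph_eq {G : SimpleGraph W} {f g : H.Copy G}
    (h : g.toSubgraph = f.toSubgraph) : ∃ α : H ≃g H, f.comp α.toCopy = g := by
  have hv : ∀ a, ∃ b, f b = g a := by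
    intro a
    have : g a ∈ g.toSubgraph.verts := by simp
    rw [h] at this
    simpa using this
  choose s hs using hv
  have hinj : Function.Injective s := by
    intro a b hab
    apply g.injective
    change g a = g b
    rw [← hs, ← hs, hab]
  have hadjiff : ∀ (k : H.Copy G) a b, k.toSubgraph.Adj (k a) (k b) ↔ H.Adj a b := by
    intro k a b
    simp only [SimpleGraph.Subgraph.map_adj, Relation.Map, SimpleGraph.Subgraph.top_adj]
    constructor
    · rintro ⟨x, y, hxy, hx, hy⟩
      rwa [← k.injective hx, ← k.injective hy]
    · exact fun hab => ⟨a, b, hab, rfl, rfl⟩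
  refine ⟨⟨Equiv.ofBijective s (Finite.injective_iff_bijective.1 hinj), ?_⟩, ?_⟩
  · intro a b
    rw [← hadjiff f, ← hadjiff g, h]
    simp [hs]
  · ext a
    exact hs a

/-- The number of injective homomorphisms is the number of copies times the number of
automorphisms. -/
lemma card_copy_eq (G : SimpleGraph W) [Fintype (H.Copy G)] [Fintype (H ≃g H)] :
    Fintype.card (H.Copy G) = Fintype.card (H ≃g H) * G.copyCount H := by
  classical
  have : Fintype {f : H →g G // Function.Injective f} := Fintype.ofFinite _
  rw [SimpleGraph.copyCount_eq_card_image_copyToSubgraph, ← card_univ (α := H.Copy G)]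
  have h1 : #(univ : Finset (H.Copy G)) =
      ∑ B ∈ univ.image (SimpleGraph.Copy.toSubgraph (A := H) (B := G)), Fintype.card (H ≃g H) := by
    rw [card_eq_sum_card_image (SimpleGraph.Copy.toSubgraph (A := H) (B := G))]
    refine sum_congr rfl fun B hB => ?_
    obtain ⟨f, -, rfl⟩ := mem_image.1 hB
    rw [← card_univ]
    symm
    refine card_bij (fun α _ => f.comp α.toCopy) ?_ ?_ ?_
    · intro α _
      simp only [mem_filter, mem_univ, true_and]
      exact toSubgraph_comp_iso f α
    · intro α _ τ _ h
      ext a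
      apply f.injective
      exact DFunLike.congr_fun h a
    · intro g hg
      simp only [mem_filter, mem_univ, true_and] at hg
      obtain ⟨α, hα⟩ := exists_iso_of_toSubgraph_eq hg
      exact ⟨α, mem_univ _, hα⟩
  rw [h1, sum_const, smul_eq_mul, mul_comm]
  congr!

/-- The number of embeddings of `H` into `G`. -/
noncomputable def embCount (H : SimpleGraph V) [DecidableRel H.Adj] (G : SimpleGraph W) : ℝ :=
  ∑ φ : V ↪ W, ind (↑(copyEdges H φ) ⊆ G.edgeSet)

lemma copyEdges_subset_iff (φ : V ↪ W) (G : SimpleGraph W) :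
    ↑(copyEdges H φ) ⊆ G.edgeSet ↔ ∀ a b, H.Adj a b → G.Adj (φ a) (φ b) := by
  constructor
  · intro h a b hab
    have : s(φ a, φ b) ∈ (copyEdges H φ : Set (Sym2 W)) := by
      rw [mem_coe, copyEdges, mem_image]
      exact ⟨s(a, b), SimpleGraph.mem_edgeFinset.2 hab, rfl⟩
    exact h this
  · intro h e he
    rw [mem_coe, copyEdges, mem_image] at he
    obtain ⟨e, he, rfl⟩ := he
    rw [SimpleGraph.mem_edgeFinset] at he
    induction e using Sym2.ind with
    | _ a b => exact h a b he

lemma embCount_eq (G : SimpleGraph W) [Fintype (H ≃g H)] :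
    embCount H G = Fintype.card (H ≃g H) * (G.copyCount H : ℝ) := by
  classical
  have : Fintype (H.Copy G) := Fintype.ofInjective (fun f : H.Copy G => (f : V → W))
    DFunLike.coe_injective
  rw [← Nat.cast_mul, ← card_copy_eq]
  unfold embCount ind
  rw [sum_boole, ← card_univ (α := H.Copy G)]
  norm_cast
  symm
  refine card_bij (fun f _ => f.toEmbedding) ?_ ?_ ?_
  · intro f _
    simp only [mem_filter, mem_univ, true_and]
    rw [copyEdges_subset_iff]
    exact fun a b hab => f.toHom.map_adj hab
  · intro f _ g _ h
    ext a
    exact DFunLike.congr_fun h a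
  · intro φ hφ
    simp only [mem_filter, mem_univ, true_and] at hφ
    rw [copyEdges_subset_iff] at hφ
    exact ⟨⟨⟨φ, fun {a b} hab => hφ a b hab⟩, φ.injective⟩, mem_univ _, rfl⟩

end CopyCount

/-! ### Containment probabilities in the binomial random graph. -/

section Measure

/-- With measurable singletons every set of graphs on `Fin n` is measurable, and probabilities
become finite sums. -/
instance measurableSingletonClass_simpleGraph (n : ℕ) :
    MeasurableSingletonClass (SimpleGraph (Fin n)) := by
  refine ⟨fun G => ?_⟩
  have : ({G} : Set (SimpleGraph (Fin n))) = ⋂ u, ⋂ v, {G' | G'.Adj u v ↔ G.Adj u v} := by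
    ext G'
    simp only [Set.mem_singleton_iff, Set.mem_iInter]
    constructor
    · rintro rfl u v; exact Iff.rfl
    · intro h; ext u v; exact h u v
  rw [this]
  refine MeasurableSet.iInter fun u => MeasurableSet.iInter fun v => ?_
  have hm : Measurable fun G' : SimpleGraph (Fin n) => G'.Adj u v :=
    (measurable_pi_apply v).comp ((measurable_pi_apply u).comp SimpleGraph.measurable_adj)
  by_cases h : G.Adj u v
  · simp only [h, iff_true]
    exact measurableSet_setOfPred.2 hm
  · simp only [h, iff_false]
    exact (measurableSet_setOfPred.2 hm).compl

/-- The probability that a random graph contains a given set of edges. -/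
lemma binomialRandom_real_superset (n : ℕ) (p : I) (A : Finset (Sym2 (Fin n)))
    (hA : ∀ e ∈ A, ¬ e.IsDiag) :
    G(Fin n, p).real {G | (A : Set (Sym2 (Fin n))) ⊆ G.edgeSet} = (p : ℝ) ^ #A := by
  have hmeas : MeasurableSet {G : SimpleGraph (Fin n) | (A : Set (Sym2 (Fin n))) ⊆ G.edgeSet} :=
    Set.Finite.measurableSet (Set.toFinite _)
  rw [measureReal_def, SimpleGraph.binomialRandom_eq_map,
    Measure.map_apply SimpleGraph.measurable_fromEdgeSet hmeas]
  have h1 : SimpleGraph.fromEdgeSet ⁻¹' {G : SimpleGraph (Fin n) | (A : Set _) ⊆ G.edgeSet} =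
      {s : Set (Sym2 (Fin n)) | (A : Set _) ⊆ s} := by
    ext s
    simp only [Set.mem_preimage, Set.mem_ofPred_eq, SimpleGraph.edgeSet_fromEdgeSet]
    constructor
    · exact fun h e he => (h he).1
    · intro h e he
      exact ⟨h he, by simpa using hA e (by simpa using he)⟩
  rw [h1, ProbabilityTheory.setBernoulli_apply']
  have h2 : (fun q : Sym2 (Fin n) → Prop => {i | q i}) ⁻¹'
      {s : Set (Sym2 (Fin n)) | (A : Set _) ⊆ s} = (A : Set (Sym2 (Fin n))).pi fun _ => {True} := by
    ext q
    simp only [Set.mem_preimage, Set.mem_ofPred_eq, Set.mem_pi, Set.mem_singleton_iff, eq_iff_iff,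
      iff_true]
    rfl
  rw [h2, Measure.infinitePi_pi _ (fun _ _ => MeasurableSet.singleton _)]
  have h3 : ∀ e ∈ A, (unitInterval.toNNReal p • Measure.dirac (e ∈ (Sym2.diagSetᶜ : Set (Sym2 (Fin n)))) +
      unitInterval.toNNReal (unitInterval.symm p) • Measure.dirac False) {True} =
      (unitInterval.toNNReal p : ENNReal) := by
    intro e he
    have : (e ∈ (Sym2.diagSetᶜ : Set (Sym2 (Fin n)))) = True := by
      simpa using hA e he
    rw [this]
    simp
  rw [prod_congr rfl h3, prod_const, ENNReal.toReal_pow]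
  simp

end Measure

/-! ### Planting, high moments and cores. -/

section Prob

variable {V : Type*} [Fintype V] [DecidableEq V] {H : SimpleGraph V} [DecidableRel H.Adj]
  {n : ℕ} {p : I}

lemma real_eq_sum (E : Set (SimpleGraph (Fin n))) :
    G(Fin n, p).real E = ∑ G, G(Fin n, p).real {G} * ind (G ∈ E) := by
  classical
  have h : E = ↑(univ.filter (· ∈ E)) := by ext; simp
  conv_lhs => rw [h]
  rw [← sum_measureReal_singleton, sum_filter]
  refine sum_congr rfl fun G _ => ?_
  unfold ind
  split_ifs <;> simp

lemma sum_weight_superset {A : Finset (Sym2 (Fin n))} (hA : ∀ e ∈ A, ¬ e.IsDiag) :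
    ∑ G : SimpleGraph (Fin n), G(Fin n, p).real {G} * ind ((A : Set (Sym2 (Fin n))) ⊆ G.edgeSet) =
      (p : ℝ) ^ #A := by
  rw [← binomialRandom_real_superset n p A hA, real_eq_sum]
  rfl

lemma union_copyEdges_not_isDiag {S : Finset (Sym2 (Fin n))} (hS : ∀ e ∈ S, ¬ e.IsDiag)
    (φ : V ↪ Fin n) : ∀ e ∈ S ∪ copyEdges H φ, ¬ e.IsDiag := by
  intro e he
  rcases mem_union.1 he with h | h
  · exact hS e h
  · exact copyEdges_not_isDiag φ e h

lemma card_union_copyEdges (S : Finset (Sym2 (Fin n))) (φ : V ↪ Fin n) :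
    #(S ∪ copyEdges H φ) = #S + #(copyEdges H φ \ S) := by
  rw [← union_sdiff_self_eq_union, card_union_of_disjoint disjoint_sdiff]

lemma sum_pow_union (S : Finset (Sym2 (Fin n))) (x : ℝ) :
    ∑ φ : V ↪ Fin n, x ^ #(S ∪ copyEdges H φ) = x ^ #S * condSum H S x := by
  unfold condSum
  rw [mul_sum]
  exact sum_congr rfl fun φ _ => by rw [card_union_copyEdges, pow_add]

lemma ind_superset_mul (S A : Finset (Sym2 (Fin n))) (G : SimpleGraph (Fin n)) :
    ind ((S : Set (Sym2 (Fin n))) ⊆ G.edgeSet) * ind ((A : Set (Sym2 (Fin n))) ⊆ G.edgeSet) =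
      ind (((S ∪ A : Finset (Sym2 (Fin n))) : Set (Sym2 (Fin n))) ⊆ G.edgeSet) := by
  rw [← ind_and]
  exact ind_congr (by rw [coe_union, Set.union_subset_iff])

lemma sum_weight_superset_mul_embCount {S : Finset (Sym2 (Fin n))} (hS : ∀ e ∈ S, ¬ e.IsDiag) :
    ∑ G : SimpleGraph (Fin n), G(Fin n, p).real {G} *
      (ind ((S : Set (Sym2 (Fin n))) ⊆ G.edgeSet) * embCount H G) =
      (p : ℝ) ^ #S * condSum H S p := by
  rw [← sum_pow_union]
  unfold embCount
  simp_rw [mul_sum]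
  rw [sum_comm]
  refine sum_congr rfl fun φ _ => ?_
  rw [← sum_weight_superset (union_copyEdges_not_isDiag hS φ)]
  exact sum_congr rfl fun G _ => by rw [ind_superset_mul]

lemma embCount_nonneg (G : SimpleGraph (Fin n)) : 0 ≤ embCount H G :=
  sum_nonneg fun _ _ => ind_nonneg _

lemma embCount_le (G : SimpleGraph (Fin n)) : embCount H G ≤ Fintype.card (V ↪ Fin n) := by
  refine (sum_le_sum fun φ _ => ind_le_one _).trans ?_
  simp

/-- Passing from copies to embeddings multiplies the count and the threshold by the same number of
automorphisms. -/
lemma upperTailProb_eq (δ : ℝ) : upperTailProb H δ n p =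
    ∑ G, G(Fin n, p).real {G} *
      ind ((1 + δ) * condSum H (∅ : Finset (Sym2 (Fin n))) p ≤ embCount H G) := by
  classical
  have : Fintype (H ≃g H) := Fintype.ofInjective (fun f : H ≃g H => (f : V → V))
    DFunLike.coe_injective
  have haut : (0 : ℝ) < Fintype.card (H ≃g H) := by
    exact_mod_cast Fintype.card_pos_iff.2 ⟨SimpleGraph.Iso.refl⟩
  have hexp : condSum H (∅ : Finset (Sym2 (Fin n))) p =
      Fintype.card (H ≃g H) * expectedCount H n p := by
    have h := sum_weight_superset_mul_embCount (H := H) (p := p) (S := (∅ : Finset (Sym2 (Fin n))))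
      (by simp)
    rw [card_empty, pow_zero, one_mul] at h
    rw [← h, expectedCount, integral_fintype Integrable.of_finite, mul_sum]
    refine sum_congr rfl fun G _ => ?_
    rw [ind_of_true (by simp), one_mul, embCount_eq, smul_eq_mul]
    unfold subgraphCount
    ring
  rw [upperTailProb, real_eq_sum]
  refine sum_congr rfl fun G _ => ?_
  congr 1
  refine ind_congr ?_
  rw [Set.mem_ofPred_eq, hexp, embCount_eq, ← mul_left_comm, mul_le_mul_iff_right₀ haut]
  rfl

/-- Lower bound on the upper tail probability from planting `S`. -/
lemma planting_bound {S : Finset (Sym2 (Fin n))} (hS : ∀ e ∈ S, ¬ e.IsDiag) {T : ℝ} (hT : 0 ≤ T) :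
    (p : ℝ) ^ #S * (condSum H S p - T) ≤ Fintype.card (V ↪ Fin n) *
      ∑ G, G(Fin n, p).real {G} * ind (T ≤ embCount H G) := by
  have h1 := sum_weight_superset_mul_embCount (H := H) (p := p) hS
  have h2 := sum_weight_superset (p := p) hS
  rw [mul_sub, ← h1, ← h2, sum_mul, ← sum_sub_distrib, mul_sum]
  -- Pointwise: on graphs containing `S`, the excess of the count over `T` is at most the number of
  -- all embeddings, and it is not positive outside the upper tail event.
  refine sum_le_sum fun G _ => ?_
  have hw : 0 ≤ G(Fin n, p).real {G} := measureReal_nonneg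
  have hi := ind_nonneg ((S : Set (Sym2 (Fin n))) ⊆ G.edgeSet)
  have hi1 := ind_le_one ((S : Set (Sym2 (Fin n))) ⊆ G.edgeSet)
  have hX := embCount_le (H := H) G
  rw [mul_assoc, ← mul_sub, mul_left_comm, ← mul_sub]
  refine mul_le_mul_of_nonneg_left ?_ hw
  by_cases h : T ≤ embCount H G
  · rw [ind_of_true h, mul_one]
    refine (mul_le_of_le_one_left (by linarith) hi1).trans ?_
    linarith
  · rw [ind_of_false h, mul_zero]
    exact mul_nonpos_of_nonneg_of_nonpos hi (by linarith)

/-- No edge set of size at most `m` in the graph `G` has conditional expectation above `B`. -/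
def NoSeed (H : SimpleGraph V) [DecidableRel H.Adj] (p : I) (m : ℕ) (B : ℝ)
    (G : SimpleGraph (Fin n)) : Prop :=
  ∀ S : Finset (Sym2 (Fin n)), (S : Set (Sym2 (Fin n))) ⊆ G.edgeSet → #S ≤ m → condSum H S p ≤ B

/-- One factor of the power is expanded into embeddings, whose edges are added to `S`, and induction
handles the remaining factors. The expansion costs `condSum H S p`; if this exceeds `B`, then `S`
itself violates `NoSeed` and all terms vanish. The size condition keeps every set met on the way
within the range of `NoSeed`. -/
lemma moment_bound {m : ℕ} {B : ℝ} (hB : 0 ≤ B) (k : ℕ) :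
    ∀ S : Finset (Sym2 (Fin n)), (∀ e ∈ S, ¬ e.IsDiag) → #S + #H.edgeFinset * k ≤ m →
    ∑ G, G(Fin n, p).real {G} * (ind ((S : Set (Sym2 (Fin n))) ⊆ G.edgeSet) *
      (embCount H G ^ k * ind (NoSeed H p m B G))) ≤ (p : ℝ) ^ #S * B ^ k := by
  have hw : ∀ G : SimpleGraph (Fin n), 0 ≤ G(Fin n, p).real {G} := fun G => measureReal_nonneg
  have hp0 : (0 : ℝ) ≤ p := p.2.1
  induction k with
  | zero =>
    intro S hS _
    rw [pow_zero, mul_one, ← sum_weight_superset hS]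
    refine sum_le_sum fun G _ => mul_le_mul_of_nonneg_left ?_ (hw G)
    rw [pow_zero, one_mul]
    exact mul_le_of_le_one_right (ind_nonneg _) (ind_le_one _)
  | succ k ih =>
    intro S hS hm
    by_cases hseed : condSum H S p ≤ B
    · calc ∑ G, G(Fin n, p).real {G} * (ind ((S : Set (Sym2 (Fin n))) ⊆ G.edgeSet) *
            (embCount H G ^ (k + 1) * ind (NoSeed H p m B G)))
          = ∑ φ : V ↪ Fin n, ∑ G, G(Fin n, p).real {G} *
            (ind (((S ∪ copyEdges H φ : Finset (Sym2 (Fin n))) : Set (Sym2 (Fin n))) ⊆ G.edgeSet) *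
            (embCount H G ^ k * ind (NoSeed H p m B G))) := by
            rw [sum_comm]
            refine sum_congr rfl fun G _ => ?_
            simp_rw [← ind_superset_mul]
            rw [← mul_sum]
            congr 1
            rw [← sum_mul, ← mul_sum, pow_succ]
            unfold embCount
            ring
        _ ≤ ∑ φ : V ↪ Fin n, (p : ℝ) ^ #(S ∪ copyEdges H φ) * B ^ k := by
            refine sum_le_sum fun φ _ => ih _ (union_copyEdges_not_isDiag hS φ) ?_
            have h1 := card_union_le S (copyEdges H φ)
            rw [card_copyEdges] at h1
            rw [mul_add, mul_one] at hm
            omega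
        _ = (p : ℝ) ^ #S * condSum H S p * B ^ k := by rw [← sum_mul, sum_pow_union]
        _ ≤ (p : ℝ) ^ #S * B * B ^ k := by gcongr
        _ = _ := by rw [pow_succ']; ring
    · have hz : ∀ G : SimpleGraph (Fin n), G(Fin n, p).real {G} *
          (ind ((S : Set (Sym2 (Fin n))) ⊆ G.edgeSet) *
            (embCount H G ^ (k + 1) * ind (NoSeed H p m B G))) = 0 := by
        intro G
        by_cases hG : (S : Set (Sym2 (Fin n))) ⊆ G.edgeSet
        · rw [ind_of_false (P := NoSeed H p m B G)
            (fun h => hseed (h S hG ((Nat.le_add_right _ _).trans hm)))]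
          ring
        · rw [ind_of_false hG]; ring
      simp_rw [hz]
      rw [sum_const_zero]
      positivity

/-- Edge sets all of whose edges matter for the conditional expectation. -/
noncomputable def cores (H : SimpleGraph V) [DecidableRel H.Adj] (n : ℕ) (p : I) (m : ℕ)
    (B t : ℝ) : Finset (Finset (Sym2 (Fin n))) :=
  open Classical in univ.filter fun S => (∀ e ∈ S, ¬ e.IsDiag) ∧ #S ≤ m ∧ B ≤ condSum H S p ∧
    ∀ e ∈ S, t ≤ condSum H S p - condSum H (S.erase e) p

lemma mem_cores {m : ℕ} {B t : ℝ} {S : Finset (Sym2 (Fin n))} :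
    S ∈ cores H n p m B t ↔ (∀ e ∈ S, ¬ e.IsDiag) ∧ #S ≤ m ∧ B ≤ condSum H S p ∧
      ∀ e ∈ S, t ≤ condSum H S p - condSum H (S.erase e) p := by
  simp [cores]

/-- Edges of marginal below `t` are removed one at a time; `condSum` minus `t` times the number of
edges never decreases. -/
lemma exists_core {t : ℝ} (k : ℕ) : ∀ S : Finset (Sym2 (Fin n)), #S = k →
    ∃ C ⊆ S, condSum H S p - #S * t ≤ condSum H C p - #C * t ∧
      ∀ e ∈ C, t ≤ condSum H C p - condSum H (C.erase e) p := by
  induction k with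
  | zero =>
    intro S hS
    rw [card_eq_zero] at hS
    subst hS
    exact ⟨∅, subset_rfl, le_rfl, by simp⟩
  | succ k ih =>
    intro S hS
    by_cases h : ∀ e ∈ S, t ≤ condSum H S p - condSum H (S.erase e) p
    · exact ⟨S, subset_rfl, le_rfl, h⟩
    · push Not at h
      obtain ⟨e, he, hlt⟩ := h
      have hcard : #(S.erase e) = k := by rw [card_erase_of_mem he, hS]; rfl
      obtain ⟨C, hC, h1, h2⟩ := ih (S.erase e) hcard
      refine ⟨C, hC.trans (erase_subset _ _), le_trans ?_ h1, h2⟩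
      rw [hS, hcard]
      push_cast
      linarith

/-- The upper tail probability is governed by cores. -/
lemma upper_tail_le_cores {T B t : ℝ} (hT : 0 < T) (hB : 0 ≤ B) (ht : 0 ≤ t) (k : ℕ) :
    ∑ G, G(Fin n, p).real {G} * ind (T ≤ embCount H G) ≤ (B / T) ^ k +
      ∑ C ∈ cores H n p (#H.edgeFinset * k) (B - (#H.edgeFinset * k : ℕ) * t) t, (p : ℝ) ^ #C := by
  set m := #H.edgeFinset * k with hm
  have hw : ∀ G : SimpleGraph (Fin n), 0 ≤ G(Fin n, p).real {G} := fun G => measureReal_nonneg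
  have h1 : ∑ G, G(Fin n, p).real {G} * (embCount H G ^ k * ind (NoSeed H p m B G)) ≤ B ^ k := by
    have := moment_bound (H := H) (p := p) (m := m) hB k (∅ : Finset (Sym2 (Fin n))) (by simp)
      (by rw [card_empty, zero_add])
    rw [card_empty, pow_zero, one_mul] at this
    refine le_trans (le_of_eq (sum_congr rfl fun G _ => ?_)) this
    rw [ind_of_true (P := ((∅ : Finset (Sym2 (Fin n))) : Set (Sym2 (Fin n))) ⊆ G.edgeSet) (by simp),
      one_mul]
  have h2 : ∑ C ∈ cores H n p m (B - m * t) t, (p : ℝ) ^ #C =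
      ∑ G, G(Fin n, p).real {G} * ∑ C ∈ cores H n p m (B - m * t) t,
        ind ((C : Set (Sym2 (Fin n))) ⊆ G.edgeSet) := by
    simp_rw [mul_sum]
    rw [sum_comm]
    exact sum_congr rfl fun C hC => (sum_weight_superset (mem_cores.1 hC).1).symm
  -- Without a seed, Markov's inequality for the `k`-th power applies. A seed contains a core, whose
  -- conditional expectation is smaller by at most `m * t`.
  have hpt : ∀ G : SimpleGraph (Fin n), ind (T ≤ embCount H G) ≤
      (embCount H G ^ k * ind (NoSeed H p m B G)) / T ^ k +
      ∑ C ∈ cores H n p m (B - m * t) t, ind ((C : Set (Sym2 (Fin n))) ⊆ G.edgeSet) := by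
    intro G
    have n1 : 0 ≤ (embCount H G ^ k * ind (NoSeed H p m B G)) / T ^ k :=
      div_nonneg (mul_nonneg (pow_nonneg (embCount_nonneg G) _) (ind_nonneg _)) (by positivity)
    have n2 : 0 ≤ ∑ C ∈ cores H n p m (B - m * t) t,
        ind ((C : Set (Sym2 (Fin n))) ⊆ G.edgeSet) := sum_nonneg fun _ _ => ind_nonneg _
    by_cases hTG : T ≤ embCount H G
    · rw [ind_of_true hTG]
      by_cases hN : NoSeed H p m B G
      · rw [ind_of_true hN, mul_one]
        have : 1 ≤ embCount H G ^ k / T ^ k := by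
          rw [one_le_div (by positivity)]
          exact pow_le_pow_left₀ hT.le hTG k
        rw [ind_of_true hN, mul_one] at n1
        linarith
      · have hN' := hN
        unfold NoSeed at hN'
        push Not at hN'
        obtain ⟨S, hSG, hSm, hSB⟩ := hN'
        obtain ⟨C, hCS, hC1, hC2⟩ := exists_core (H := H) (p := p) (t := t) #S S rfl
        have hCG : (C : Set (Sym2 (Fin n))) ⊆ G.edgeSet :=
          (by exact_mod_cast hCS : (C : Set (Sym2 (Fin n))) ⊆ S).trans hSG
        have hSm' : (#S : ℝ) ≤ m := by exact_mod_cast hSm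
        have hmem : C ∈ cores H n p m (B - m * t) t := by
          rw [mem_cores]
          refine ⟨fun e he => ?_, (card_le_card hCS).trans hSm, ?_, hC2⟩
          · exact G.not_isDiag_of_mem_edgeSet (hCG (by exact_mod_cast he))
          · have a1 : (#S : ℝ) * t ≤ m * t := by gcongr
            have a2 : 0 ≤ (#C : ℝ) * t := by positivity
            linarith
        have := single_le_sum (f := fun C : Finset (Sym2 (Fin n)) =>
          ind ((C : Set (Sym2 (Fin n))) ⊆ G.edgeSet)) (fun _ _ => ind_nonneg _) hmem
        simp only [ind_of_true hCG] at this
        linarith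
    · rw [ind_of_false hTG]
      linarith
  refine (sum_le_sum fun G _ => mul_le_mul_of_nonneg_left (hpt G) (hw G)).trans ?_
  simp_rw [mul_add]
  rw [sum_add_distrib, ← h2, div_pow]
  refine add_le_add_left ?_ _
  simp_rw [← mul_div_assoc]
  rw [← sum_div]
  gcongr

end Prob

/-! ### Entropy bounds for families of edge sets. -/

section Counting

/-- Giving every subset the weight `y ^ #A`, the total weight is `(1 + y) ^ #s ≤ exp (y * #s)`,
while each member of the family weighs at least `y ^ k`. -/
lemma card_bounded_subsets_le {α : Type*} [DecidableEq α] (s : Finset α) {y k : ℝ} (hy : 0 < y)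
    (hy1 : y ≤ 1) (𝒜 : Finset (Finset α)) (h𝒜 : ∀ A ∈ 𝒜, A ⊆ s ∧ (#A : ℝ) ≤ k) :
    (#𝒜 : ℝ) ≤ Real.exp (y * #s + k * Real.log (1 / y)) := by
  have h1 : (#𝒜 : ℝ) * y ^ k ≤ Real.exp (y * #s) := by
    calc (#𝒜 : ℝ) * y ^ k = ∑ A ∈ 𝒜, y ^ k := by rw [sum_const, nsmul_eq_mul]
      _ ≤ ∑ A ∈ 𝒜, y ^ #A := by
          refine sum_le_sum fun A hA => ?_
          rw [← Real.rpow_natCast]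
          exact Real.rpow_le_rpow_of_exponent_ge hy hy1 (h𝒜 A hA).2
      _ ≤ ∑ A ∈ s.powerset, y ^ #A :=
          sum_le_sum_of_subset_of_nonneg (fun A hA => mem_powerset.2 (h𝒜 A hA).1)
            fun _ _ _ => by positivity
      _ = (y + 1) ^ #s := by
          have := Finset.sum_pow_mul_eq_add_pow y 1 s
          simpa using this
      _ ≤ Real.exp y ^ #s := pow_le_pow_left₀ (by positivity) (Real.add_one_le_exp y) _
      _ = Real.exp (y * #s) := by rw [← Real.exp_nat_mul, mul_comm]
  have h2 : y ^ k = Real.exp (-(k * Real.log (1 / y))) := by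
    rw [Real.rpow_def_of_pos hy, one_div, Real.log_inv]
    congr 1; ring
  rw [h2, Real.exp_neg, ← div_eq_mul_inv, div_le_iff₀ (Real.exp_pos _), ← Real.exp_add] at h1
  exact h1

/-- A set is specified by a code `D` and then as a small subset of the ground set `g D`. -/
lemma card_coded_subsets_le {α β : Type*} [DecidableEq α] [DecidableEq β] (𝒟 : Finset β)
    (g : β → Finset α) {y k N X : ℝ} (hy : 0 < y) (hy1 : y ≤ 1)
    (hg : ∀ D ∈ 𝒟, y * (#(g D) : ℝ) ≤ N) (h𝒟 : (#𝒟 : ℝ) ≤ Real.exp X) (𝒜 : Finset (Finset α))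
    (h𝒜 : ∀ A ∈ 𝒜, (∃ D ∈ 𝒟, A ⊆ g D) ∧ (#A : ℝ) ≤ k) :
    (#𝒜 : ℝ) ≤ Real.exp (X + (N + k * Real.log (1 / y))) := by
  classical
  have h1 : 𝒜 ⊆ 𝒟.biUnion fun D => (g D).powerset.filter fun A => (#A : ℝ) ≤ k := by
    intro A hA
    obtain ⟨⟨D, hD, hAD⟩, hk⟩ := h𝒜 A hA
    exact mem_biUnion.2 ⟨D, hD, by simp [hAD, hk]⟩
  have h2 : (#𝒜 : ℝ) ≤ ∑ D ∈ 𝒟, (#((g D).powerset.filter fun A => (#A : ℝ) ≤ k) : ℝ) := by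
    exact_mod_cast (card_le_card h1).trans card_biUnion_le
  refine h2.trans ?_
  have h3 : ∀ D ∈ 𝒟, (#((g D).powerset.filter fun A => (#A : ℝ) ≤ k) : ℝ) ≤
      Real.exp (N + k * Real.log (1 / y)) := by
    intro D hD
    refine (card_bounded_subsets_le (g D) hy hy1 _ (k := k) ?_).trans ?_
    · intro A hA
      simpa using hA
    · exact Real.exp_le_exp.2 (by linarith [hg D hD])
  refine (sum_le_sum h3).trans ?_
  rw [sum_const, nsmul_eq_mul, Real.exp_add X]
  gcongr

variable {n : ℕ}

/-- The pairs touching `U`. -/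
def touching (U : Finset (Fin n)) : Finset (Sym2 (Fin n)) :=
  (U ×ˢ (univ : Finset (Fin n))).image fun x => s(x.1, x.2)

lemma card_touching_le (U : Finset (Fin n)) : #(touching U) ≤ #U * n := by
  refine card_image_le.trans ?_
  rw [card_product, card_univ, Fintype.card_fin]

/-- The pairs of vertices that are assigned numbers of product at least `r`. -/
noncomputable def heavyPairs (r : ℝ) (D : Finset (Fin n × ℕ)) : Finset (Sym2 (Fin n)) :=
  ((D ×ˢ D).filter fun x => r ≤ (x.1.2 : ℝ) * x.2.2).image fun x => s(x.1.1, x.2.1)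

/-- Markov's inequality for the product of the two numbers on `D ×ˢ D`. -/
lemma mul_card_heavyPairs_le {r : ℝ} (D : Finset (Fin n × ℕ)) :
    r * (#(heavyPairs r D) : ℝ) ≤ (∑ x ∈ D, (x.2 : ℝ)) ^ 2 := by
  rcases le_total r 0 with hr0 | hr
  · exact (mul_nonpos_of_nonpos_of_nonneg hr0 (by positivity)).trans (by positivity)
  have h1 : (#(heavyPairs r D) : ℝ) ≤ #((D ×ˢ D).filter fun x => r ≤ (x.1.2 : ℝ) * x.2.2) := by
    exact Nat.cast_le.2 card_image_le
  refine (mul_le_mul_of_nonneg_left h1 hr).trans ?_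
  rw [mul_comm, ← nsmul_eq_mul, ← sum_const, sq, sum_mul_sum, ← sum_product']
  refine (sum_le_sum fun x hx => (mem_filter.1 hx).2).trans ?_
  exact sum_le_sum_of_subset_of_nonneg (filter_subset _ _) fun _ _ _ => by positivity

/-- Each member is the union of the few edges in `F`, the edges at vertices of density at least `η`,
and edges joining two vertices of degree at least `t` whose degrees have product at least `2 * γ *
m`. At most `2 * m / (η * n)` vertices are of the former kind, and at most `2 * m / t` have degree
`t` or more. Recording the former, and the latter with their degrees, confines the edges to at most
`2 * m / η` and `2 * m / γ` pairs, from which at most `m` are selected. -/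
lemma card_family_le_of_cover {n : ℕ} {m : ℕ} (hm : 0 < m) (hn : 2 ≤ n) {f η γ t y : ℝ}
    (hη : 0 < η) (hη1 : η ≤ 1) (hγ : 0 < γ) (hγ1 : γ ≤ 1) (ht : 0 < t) (hy : 0 < y) (hy1 : y ≤ 1)
    (𝒮 : Finset (Finset (Sym2 (Fin n))))
    (h𝒮 : ∀ S ∈ 𝒮, #S = m ∧ (∀ e ∈ S, ¬ e.IsDiag) ∧ ∃ F ⊆ S, (#F : ℝ) ≤ f ∧
      ∀ u v, s(u, v) ∈ S → s(u, v) ∉ F → (η ≤ dens S u ∨ η ≤ dens S v) ∨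
        (γ * edens S ≤ dens S u * dens S v ∧ t ≤ n * dens S u ∧ t ≤ n * dens S v)) :
    (#𝒮 : ℝ) ≤ Real.exp ((y * n ^ 2 + f * Real.log (1 / y)) +
      ((1 + 2 * m / (η * n) * Real.log n) + (2 * m + m * Real.log (1 / η))) +
      ((1 + 2 * m / t * (3 * Real.log n)) + (2 * m + m * Real.log (1 / γ)))) := by
  classical
  have hnpos : 0 < n := by omega
  have : Nonempty (Fin n) := ⟨⟨0, hnpos⟩⟩
  have hnR : (2 : ℝ) ≤ n := by exact_mod_cast hn
  have hn0 : (0 : ℝ) < n := by linarith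
  have hm0 : (0 : ℝ) < m := by exact_mod_cast hm
  set u : ℝ := 2 * m / (η * n) with hu
  set w : ℝ := 2 * m / t with hw
  -- the three families
  set ℱ₁ : Finset (Finset (Sym2 (Fin n))) := univ.filter fun A => (#A : ℝ) ≤ f with hF1
  set 𝒰 : Finset (Finset (Fin n)) := univ.filter fun U => (#U : ℝ) ≤ u with hU
  set ℱ₂ : Finset (Finset (Sym2 (Fin n))) :=
    univ.filter fun A => (∃ U ∈ 𝒰, A ⊆ touching U) ∧ (#A : ℝ) ≤ m with hF2
  set 𝒟 : Finset (Finset (Fin n × ℕ)) :=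
    (univ ×ˢ range n).powerset.filter fun D =>
      (#D : ℝ) ≤ w ∧ ∑ x ∈ D, (x.2 : ℝ) ≤ 2 * m with hD
  set ℱ₃ : Finset (Finset (Sym2 (Fin n))) :=
    univ.filter fun A => (∃ D ∈ 𝒟, A ⊆ heavyPairs (2 * γ * m) D) ∧ (#A : ℝ) ≤ m with hF3
  have c1 : (#ℱ₁ : ℝ) ≤ Real.exp (y * n ^ 2 + f * Real.log (1 / y)) := by
    refine (card_bounded_subsets_le univ hy hy1 ℱ₁ (k := f) fun A hA =>
      ⟨subset_univ _, (mem_filter.1 hA).2⟩).trans (Real.exp_le_exp.2 ?_)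
    have : ((#(univ : Finset (Sym2 (Fin n))) : ℕ) : ℝ) ≤ (n : ℝ) ^ 2 := by
      have h1 : #(univ : Finset (Sym2 (Fin n))) ≤ n ^ 2 := by
        have h2 := card_le_card (show (univ : Finset (Sym2 (Fin n))) ⊆ touching univ from by
          intro e _
          induction e using Sym2.ind with
          | _ a b => exact mem_image.2 ⟨(a, b), by simp, rfl⟩)
        refine h2.trans ((card_touching_le _).trans ?_)
        rw [card_univ, Fintype.card_fin, sq]
      exact_mod_cast h1
    gcongr
  have cU : (#𝒰 : ℝ) ≤ Real.exp (1 + u * Real.log n) := by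
    refine (card_bounded_subsets_le univ (y := 1 / n) (by positivity)
      (by rw [div_le_one hn0]; linarith) 𝒰 (k := u) fun A hA =>
      ⟨subset_univ _, (mem_filter.1 hA).2⟩).trans (Real.exp_le_exp.2 ?_)
    rw [card_univ, Fintype.card_fin, one_div_one_div, one_div, inv_mul_cancel₀ hn0.ne']
  have c2 : (#ℱ₂ : ℝ) ≤ Real.exp ((1 + u * Real.log n) + (2 * m + m * Real.log (1 / η))) := by
    refine card_coded_subsets_le 𝒰 touching hη hη1 ?_ cU ℱ₂ fun A hA => (mem_filter.1 hA).2
    intro U hU'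
    have h1 : (#(touching U) : ℝ) ≤ #U * n := by exact_mod_cast card_touching_le U
    have h2 : (#U : ℝ) ≤ u := (mem_filter.1 hU').2
    calc η * (#(touching U) : ℝ) ≤ η * (u * n) := by gcongr; exact h1.trans (by gcongr)
      _ = 2 * m := by rw [hu]; field_simp
  have cD : (#𝒟 : ℝ) ≤ Real.exp (1 + w * (3 * Real.log n)) := by
    refine (card_bounded_subsets_le (univ ×ˢ range n) (y := 1 / n ^ 2) (by positivity)
      (by rw [div_le_one (by positivity)]; nlinarith) 𝒟 (k := w) fun A hA => ?_).trans
      (Real.exp_le_exp.2 ?_)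
    · rw [hD, mem_filter, mem_powerset] at hA
      exact ⟨hA.1, hA.2.1⟩
    · rw [card_product, card_univ, Fintype.card_fin, card_range, one_div_one_div, Real.log_pow]
      push_cast
      rw [← sq, one_div, inv_mul_cancel₀ (by positivity)]
      have : 0 ≤ Real.log n := Real.log_nonneg (by linarith)
      have hw0 : 0 ≤ w := by positivity
      nlinarith [mul_nonneg hw0 this]
  have c3 : (#ℱ₃ : ℝ) ≤
      Real.exp ((1 + w * (3 * Real.log n)) + (2 * m + m * Real.log (1 / γ))) := by
    refine card_coded_subsets_le 𝒟 (heavyPairs (2 * γ * m)) hγ hγ1 ?_ cD ℱ₃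
      fun A hA => (mem_filter.1 hA).2
    intro D hD'
    rw [hD, mem_filter] at hD'
    have h1 := mul_card_heavyPairs_le (r := 2 * γ * m) D
    have h2 : (∑ x ∈ D, (x.2 : ℝ)) ^ 2 ≤ (2 * m) ^ 2 :=
      pow_le_pow_left₀ (by positivity) hD'.2.2 2
    have h3 : 2 * m * (γ * (#(heavyPairs (2 * γ * m) D) : ℝ)) ≤ 2 * m * (2 * m) := by
      calc _ = 2 * γ * m * (#(heavyPairs (2 * γ * m) D) : ℝ) := by ring
        _ ≤ (2 * m) ^ 2 := h1.trans h2
        _ = _ := by ring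
    exact le_of_mul_le_mul_left h3 (by positivity)
  -- every member is a union of members of the families
  have hsub : 𝒮 ⊆ (ℱ₁ ×ˢ (ℱ₂ ×ˢ ℱ₃)).image fun x => x.1 ∪ (x.2.1 ∪ x.2.2) := by
    intro S hS
    obtain ⟨hSm, hSd, F, hFS, hFf, hcov⟩ := h𝒮 S hS
    have hedens : (n : ℝ) ^ 2 * edens S = 2 * m := by
      have := card_sq_mul_edens S hSd
      rwa [Fintype.card_fin, hSm] at this
    set U : Finset (Fin n) := univ.filter fun x => η ≤ dens S x with hUdef
    set S₂ := S.filter fun e => ∃ x ∈ e, x ∈ U with hS2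
    set S₁ := (S \ F).filter fun e => ¬ ∃ x ∈ e, x ∈ U with hS1
    set d : Fin n → ℕ := fun x => #{z | s(x, z) ∈ S} with hd
    have hdd : ∀ x, (n : ℝ) * dens S x = d x := by
      intro x
      have := card_mul_dens S x
      rw [Fintype.card_fin] at this
      rw [this, hd]
      congr!
    have hdn : ∀ x, d x < n := by
      intro x
      have h1 : ({z | s(x, z) ∈ S} : Finset (Fin n)) ⊆ univ.erase x := by
        intro z hz
        simp only [mem_filter, mem_univ, true_and] at hz
        simp only [mem_erase, mem_univ, and_true]
        rintro rfl
        exact hSd _ hz (by simp)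
      have h2 := card_le_card h1
      rw [card_erase_of_mem (mem_univ x), card_univ, Fintype.card_fin] at h2
      simp only [hd]
      omega
    have hsumd : ∑ x, (d x : ℝ) = 2 * m := by
      rw [← hedens, sq, mul_assoc]
      have h1 : (n : ℝ) * edens S = ∑ x, dens S x := by
        have := Fintype.card_mul_expect (fun x => dens S x)
        rw [Fintype.card_fin] at this
        exact this
      rw [h1, mul_sum]
      exact sum_congr rfl fun x _ => (hdd x).symm
    set W : Finset (Fin n) := univ.filter fun x => t ≤ d x with hW
    set D : Finset (Fin n × ℕ) := W.image fun x => (x, d x) with hDdef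
    have hinj : Function.Injective fun x : Fin n => (x, d x) := fun x y h => (Prod.ext_iff.1 h).1
    refine mem_image.2 ⟨(F, S₂, S₁), ?_, ?_⟩
    · simp only [mem_product]
      refine ⟨by simp [hF1, hFf], ?_, ?_⟩
      · rw [hF2, mem_filter]
        refine ⟨mem_univ _, ⟨U, ?_, ?_⟩, ?_⟩
        · rw [hU, mem_filter]
          refine ⟨mem_univ _, ?_⟩
          rw [hu, le_div_iff₀ (by positivity)]
          have h1 : (#U : ℝ) * (η * n) = ∑ x ∈ U, η * n := by rw [sum_const, nsmul_eq_mul]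
          rw [h1, ← hsumd]
          refine (sum_le_sum fun x hx => ?_).trans
            (sum_le_sum_of_subset_of_nonneg (subset_univ U) fun _ _ _ => by positivity)
          rw [← hdd, mul_comm]
          exact mul_le_mul_of_nonneg_left (mem_filter.1 hx).2 hn0.le
        · intro e he
          obtain ⟨x, ⟨z, rfl⟩, hxU⟩ := (mem_filter.1 he).2
          exact mem_image.2 ⟨(x, z), by simp [hxU], rfl⟩
        · rw [← hSm]
          exact_mod_cast card_le_card (filter_subset _ _)
      · rw [hF3, mem_filter]
        refine ⟨mem_univ _, ⟨D, ?_, ?_⟩, ?_⟩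
        · rw [hD, mem_filter, mem_powerset]
          refine ⟨?_, ?_, ?_⟩
          · intro x hx
            obtain ⟨z, -, rfl⟩ := mem_image.1 hx
            simp [hdn z]
          · rw [hDdef, card_image_of_injective _ hinj, hw, le_div_iff₀ ht]
            have h1 : (#W : ℝ) * t = ∑ x ∈ W, t := by rw [sum_const, nsmul_eq_mul]
            rw [h1, ← hsumd]
            exact (sum_le_sum fun x hx => (mem_filter.1 hx).2).trans
              (sum_le_sum_of_subset_of_nonneg (subset_univ W) fun _ _ _ => by positivity)
          · rw [hDdef, sum_image fun x _ y _ h => hinj h, ← hsumd]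
            exact sum_le_sum_of_subset_of_nonneg (subset_univ W) fun _ _ _ => by positivity
        · intro e he
          simp only [hS1, mem_filter, Finset.mem_sdiff] at he
          obtain ⟨⟨heS, heF⟩, heU⟩ := he
          induction e using Sym2.ind with
          | _ a b =>
            have hnot : ¬ (η ≤ dens S a ∨ η ≤ dens S b) := by
              rintro (h | h)
              · exact heU ⟨a, by simp, by simp [hUdef, h]⟩
              · exact heU ⟨b, by simp, by simp [hUdef, h]⟩
            obtain ⟨h1, h2, h3⟩ := (hcov a b heS heF).resolve_left hnot
            rw [hdd] at h2 h3
            refine mem_image.2 ⟨((a, d a), (b, d b)), ?_, rfl⟩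
            rw [mem_filter, mem_product]
            refine ⟨⟨mem_image.2 ⟨a, by simp [hW, h2], rfl⟩, mem_image.2 ⟨b, by simp [hW, h3], rfl⟩⟩,
              ?_⟩
            rw [← hdd, ← hdd]
            calc 2 * γ * (m : ℝ) = n ^ 2 * (γ * edens S) := by
                  rw [mul_left_comm, hedens]; ring
              _ ≤ n ^ 2 * (dens S a * dens S b) := by gcongr
              _ = _ := by ring
        · rw [← hSm]
          exact_mod_cast card_le_card ((filter_subset _ _).trans sdiff_subset)
    · ext e
      simp only [hS1, hS2, mem_union, mem_filter, Finset.mem_sdiff]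
      constructor
      · rintro (h | h | h)
        · exact hFS h
        · exact h.1
        · exact h.1.1
      · intro he
        by_cases h1 : e ∈ F
        · exact Or.inl h1
        · by_cases h2 : ∃ x ∈ e, x ∈ U
          · exact Or.inr (Or.inl ⟨he, h2⟩)
          · exact Or.inr (Or.inr ⟨⟨he, h1⟩, h2⟩)
  have hcard : (#𝒮 : ℝ) ≤ #ℱ₁ * (#ℱ₂ * #ℱ₃) := by
    have := (card_le_card hsub).trans card_image_le
    rw [card_product, card_product] at this
    exact_mod_cast this
  refine hcard.trans ?_
  rw [add_assoc, Real.exp_add, Real.exp_add (_ + (2 * (m : ℝ) + m * Real.log (1 / η)))]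
  gcongr

end Counting

/-! ### Atypical edges of a core are few. -/

section Bad

variable {V : Type*} [Fintype V] [DecidableEq V] {H : SimpleGraph V} [DecidableRel H.Adj]

/-- Every edge of `F` contributes at least `τ` to the conditional expectation, while all of them
together contribute only through homomorphisms that use `F`. If these are rare, then `F` is small.
-/
lemma card_mul_marginal_le {n : ℕ} [Nonempty (Fin n)] {Δ : ℕ} (hΔ : 0 < Δ) {S F : Finset (Sym2 (Fin n))} (hF : F ⊆ S)
    {p τ C g : ℝ} (hp : 0 < p) (hC : 1 ≤ C) (hq : edens S ≤ C * p ^ Δ) (hg : 0 ≤ g)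
    (hτ : ∀ e ∈ S, τ ≤ condSum H S p - condSum H (S.erase e) p)
    (hbad : ∀ J ⊆ H.edgeFinset, ∀ e ∈ J,
      𝔼 φ : V → Fin n, ind (Hom S J φ ∧ e.map φ ∈ F) ≤ g * (edens S ^ (1 / (Δ : ℝ))) ^ #J) :
    #F * τ ≤ (n : ℝ) ^ Fintype.card V * p ^ #H.edgeFinset *
      (2 ^ #H.edgeFinset * (#H.edgeFinset * (C ^ #H.edgeFinset * g))) := by
  have h1 : #F * τ ≤ ∑ e ∈ F, (condSum H S p - condSum H (S.erase e) p) := by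
    rw [← nsmul_eq_mul, ← sum_const]
    exact sum_le_sum fun e he => hτ e (hF he)
  refine h1.trans ((sum_condSum_sub_le S hF hp).trans ?_)
  rw [Fintype.card_fin]
  refine mul_le_mul_of_nonneg_left ?_ (by positivity)
  have h2 : ∀ J ∈ H.edgeFinset.powerset,
      ∑ e ∈ J, (𝔼 φ : V → Fin n, ind (Hom S J φ ∧ e.map φ ∈ F)) / p ^ #J ≤
        #H.edgeFinset * (C ^ #H.edgeFinset * g) := by
    intro J hJ
    have hJ' := mem_powerset.1 hJ
    have hterm : ∀ e ∈ J, (𝔼 φ : V → Fin n, ind (Hom S J φ ∧ e.map φ ∈ F)) / p ^ #J ≤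
        C ^ #H.edgeFinset * g := by
      intro e he
      rw [div_le_iff₀ (by positivity)]
      refine (hbad J hJ' e he).trans ?_
      have h3 := rpow_inv_pow_card_le hΔ (edens_nonneg S) hp hC hq #J
      have h4 : C ^ #J ≤ C ^ #H.edgeFinset := pow_le_pow_right₀ hC (card_le_card hJ')
      calc g * (edens S ^ (1 / (Δ : ℝ))) ^ #J ≤ g * (C ^ #J * p ^ #J) := by gcongr
        _ ≤ g * (C ^ #H.edgeFinset * p ^ #J) := by gcongr
        _ = _ := by ring
    refine (sum_le_sum hterm).trans ?_
    rw [sum_const, nsmul_eq_mul]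
    have h5 : (#J : ℝ) ≤ #H.edgeFinset := by exact_mod_cast card_le_card hJ'
    gcongr
  refine (sum_le_sum h2).trans (le_of_eq ?_)
  rw [sum_const, card_powerset, nsmul_eq_mul]
  push_cast
  ring

variable {Ω : Type*} [Fintype Ω] [Nonempty Ω]

/-- The edges of `S` between vertices of small degree with a small degree product. -/
noncomputable def lightEdges (S : Finset (Sym2 Ω)) (γ η : ℝ) : Finset (Sym2 Ω) :=
  open Classical in S.filter fun e => ∃ u v, e = s(u, v) ∧
    (dens S u < η ∧ dens S v < η ∧ dens S u * dens S v < γ * edens S)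

lemma lightEdges_subset (S : Finset (Sym2 Ω)) (γ η : ℝ) : lightEdges S γ η ⊆ S := by
  classical exact filter_subset _ _

lemma mem_lightEdges {S : Finset (Sym2 Ω)} {γ η : ℝ} {u v : Ω} :
    s(u, v) ∈ lightEdges S γ η ↔ s(u, v) ∈ S ∧
      (dens S u < η ∧ dens S v < η ∧ dens S u * dens S v < γ * edens S) := by
  unfold lightEdges
  simp only [mem_filter]
  refine and_congr_right fun _ => ⟨?_, fun h => ⟨u, v, rfl, h⟩⟩
  rintro ⟨x, y, hxy, h1, h2, h3⟩
  rcases Sym2.eq_iff.1 hxy with ⟨rfl, rfl⟩ | ⟨rfl, rfl⟩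
  · exact ⟨h1, h2, h3⟩
  · exact ⟨h2, h1, by rwa [mul_comm]⟩

/-- The edges of `S` with a small degree product or an end of very small degree. -/
noncomputable def poorEdges (S : Finset (Sym2 Ω)) (γ τ : ℝ) : Finset (Sym2 Ω) :=
  open Classical in S.filter fun e => ∃ u v, e = s(u, v) ∧
    (dens S u * dens S v < γ * edens S ∨ dens S u < τ ∨ dens S v < τ)

lemma poorEdges_subset (S : Finset (Sym2 Ω)) (γ τ : ℝ) : poorEdges S γ τ ⊆ S := by
  classical exact filter_subset _ _

lemma mem_poorEdges {S : Finset (Sym2 Ω)} {γ τ : ℝ} {u v : Ω} :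
    s(u, v) ∈ poorEdges S γ τ ↔ s(u, v) ∈ S ∧
      (dens S u * dens S v < γ * edens S ∨ dens S u < τ ∨ dens S v < τ) := by
  unfold poorEdges
  simp only [mem_filter]
  refine and_congr_right fun _ => ⟨?_, fun h => ⟨u, v, rfl, h⟩⟩
  rintro ⟨x, y, hxy, h⟩
  rcases Sym2.eq_iff.1 hxy with ⟨rfl, rfl⟩ | ⟨rfl, rfl⟩
  · exact h
  · rw [mul_comm (dens S u)]
    tauto

lemma rpow_inv_pow_pred_le {Δ : ℕ} (hΔ : 2 ≤ Δ) {γ : ℝ} (hγ : 0 ≤ γ) (hγ1 : γ ≤ 1) :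
    (γ ^ (1 / (Δ : ℝ))) ^ (Δ - 1) ≤ γ ^ (1 / (Δ : ℝ)) :=
  pow_le_of_le_one (by positivity) (Real.rpow_le_one hγ hγ1 (by positivity)) (by omega)

/-- If one end of `e` has non-full degree in `J`, the small degree at the other end makes the event
rare; if both ends are full, the small product does. -/
lemma expect_hom_light_le {Δ : ℕ} (hΔ : 2 ≤ Δ) (hreg : H.IsRegularOfDegree Δ)
    (S : Finset (Sym2 Ω)) {γ η : ℝ} (hγ : 0 ≤ γ) (hγ1 : γ ≤ 1) (hη : 0 ≤ η)
    {J : Finset (Sym2 V)} (hJ : J ⊆ H.edgeFinset) {e : Sym2 V} (he : e ∈ J) :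
    𝔼 φ : V → Ω, ind (Hom S J φ ∧ e.map φ ∈ lightEdges S γ η) ≤
      (γ ^ (1 / (Δ : ℝ)) + η ^ (1 / (Δ : ℝ))) * (edens S ^ (1 / (Δ : ℝ))) ^ #J := by
  have hΔ0 : 0 < Δ := by omega
  have hq : 0 ≤ (edens S ^ (1 / (Δ : ℝ))) ^ #J :=
    pow_nonneg (Real.rpow_nonneg (edens_nonneg S) _) _
  have hγ' : 0 ≤ γ ^ (1 / (Δ : ℝ)) := by positivity
  have hη' : 0 ≤ η ^ (1 / (Δ : ℝ)) := by positivity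
  induction e using Sym2.ind with
  | _ a b =>
    have hstep : ∀ φ : V → Ω, s(a, b).map φ ∈ lightEdges S γ η →
        (dens S (φ a) < η ∧ dens S (φ b) < η ∧ dens S (φ a) * dens S (φ b) < γ * edens S) :=
      fun φ h => (mem_lightEdges.1 h).2
    rcases (edeg_le hreg hJ b).lt_or_eq with hb | hb
    · refine (expect_le_expect fun φ _ => ind_mono fun h => ⟨h.1, (hstep φ h.2).1⟩).trans
        ((expect_hom_dens_le S hΔ0 J (not_isDiag_of_mem hJ) (edeg_le hreg hJ) he hb hη).trans ?_)
      gcongr; linarith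
    rcases (edeg_le hreg hJ a).lt_or_eq with ha | ha
    · rw [Sym2.eq_swap] at he
      refine (expect_le_expect fun φ _ => ind_mono fun h => ⟨h.1, (hstep φ h.2).2.1⟩).trans
        ((expect_hom_dens_le S hΔ0 J (not_isDiag_of_mem hJ) (edeg_le hreg hJ) he ha hη).trans ?_)
      gcongr; linarith
    · refine (expect_le_expect fun φ _ => ind_mono fun h => ⟨h.1, (hstep φ h.2).2.2⟩).trans
        ((expect_hom_prod_dens_le S hΔ0 J (not_isDiag_of_mem hJ) (edeg_le hreg hJ) he ha hb
          hγ).trans ?_)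
      have := rpow_inv_pow_pred_le hΔ hγ hγ1
      gcongr; linarith

/-- If all degrees on `J` were full, `star_or_all` with no high vertex at all would leave only the
empty and the complete edge set. -/
lemma exists_edge_partial {Δ : ℕ} (hreg : H.IsRegularOfDegree Δ) (hconn : H.Connected)
    {J : Finset (Sym2 V)} (hJ : J ⊆ H.edgeFinset) (hne : J.Nonempty) (hJE : J ≠ H.edgeFinset) :
    ∃ a b, s(a, b) ∈ J ∧ edeg J b < Δ := by
  by_contra hcon
  push Not at hcon
  rcases star_or_all hreg hconn hJ (fun _ => False) (by simp) (by simp)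
    (fun a b h1 h2 => (hcon a b h1).not_gt h2) with ⟨A, -, h1, h2⟩ | ⟨h, -⟩
  · have : A = ∅ := eq_empty_of_forall_notMem fun a ha => h2 a ha
    subst this
    obtain ⟨e, he⟩ := hne
    rw [← h1] at he
    simp [starEdges] at he
  · exact hJE h

/-- For proper `J`, small degrees everywhere make homomorphisms rare without regard to `e`, through
some edge with an end of non-full degree. Only for `J = H.edgeFinset` does the image of `e` matter;
a tiny degree is then handled by the odd closed walk, which is where nonbipartiteness enters. -/
lemma expect_hom_poor_le {Δ : ℕ} (hΔ : 2 ≤ Δ) (hreg : H.IsRegularOfDegree Δ)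
    (hconn : H.Connected) (hnb : ¬ H.IsBipartite)
    (S : Finset (Sym2 Ω)) (hq : 0 < edens S) {γ η τ : ℝ} (hγ : 0 ≤ γ) (hγ1 : γ ≤ 1) (hη : 0 ≤ η)
    (hτ : 0 < τ) (hS : ∀ u, dens S u < η)
    {J : Finset (Sym2 V)} (hJ : J ⊆ H.edgeFinset) {e : Sym2 V} (he : e ∈ J) :
    𝔼 φ : V → Ω, ind (Hom S J φ ∧ e.map φ ∈ poorEdges S γ τ) ≤
      (γ ^ (1 / (Δ : ℝ)) + η ^ (1 / (Δ : ℝ)) + 2 * (τ ^ 2 / edens S) ^ (1 / (4 * Δ : ℝ))) *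
        (edens S ^ (1 / (Δ : ℝ))) ^ #J := by
  have hΔ0 : 0 < Δ := by omega
  have hq' : 0 ≤ (edens S ^ (1 / (Δ : ℝ))) ^ #J := by positivity
  have hγ' : 0 ≤ γ ^ (1 / (Δ : ℝ)) := by positivity
  have hη' : 0 ≤ η ^ (1 / (Δ : ℝ)) := by positivity
  have hτ' : 0 ≤ (τ ^ 2 / edens S) ^ (1 / (4 * Δ : ℝ)) := by positivity
  by_cases hJE : J = H.edgeFinset
  · subst hJE
    induction e using Sym2.ind with
    | _ a b =>
      have hfull : ∀ a, edeg H.edgeFinset a = Δ := fun a => by rw [edeg_edgeFinset, hreg a]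
      have h1 := expect_hom_prod_dens_le S hΔ0 H.edgeFinset (not_isDiag_of_mem subset_rfl)
        (edeg_le hreg subset_rfl) he (hfull a) (hfull b) hγ
      have h2 := expect_hom_dens_lt_le hΔ0 hreg hconn hnb S hq a hτ
      have h3 := expect_hom_dens_lt_le hΔ0 hreg hconn hnb S hq b hτ
      have h4 := rpow_inv_pow_pred_le hΔ hγ hγ1
      have h5 := mul_le_mul_of_nonneg_right h4 hq'
      have h6 := mul_nonneg hη' hq'
      have h7 : 𝔼 φ : V → Ω, ind (Hom S H.edgeFinset φ ∧ s(a, b).map φ ∈ poorEdges S γ τ) ≤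
          𝔼 φ : V → Ω, ind (Hom S H.edgeFinset φ ∧ dens S (φ a) * dens S (φ b) < γ * edens S) +
          (𝔼 φ : V → Ω, ind (Hom S H.edgeFinset φ ∧ dens S (φ a) < τ) +
          𝔼 φ : V → Ω, ind (Hom S H.edgeFinset φ ∧ dens S (φ b) < τ)) := by
        rw [← expect_add_distrib, ← expect_add_distrib]
        refine expect_le_expect fun φ _ => ?_
        refine (ind_mono (Q := (Hom S H.edgeFinset φ ∧ dens S (φ a) * dens S (φ b) < γ * edens S) ∨
          ((Hom S H.edgeFinset φ ∧ dens S (φ a) < τ) ∨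
            (Hom S H.edgeFinset φ ∧ dens S (φ b) < τ))) ?_).trans
          ((ind_or_le _ _).trans (add_le_add le_rfl (ind_or_le _ _)))
        rintro ⟨h, hF⟩
        have := (mem_poorEdges.1 hF).2
        tauto
      linarith
  · obtain ⟨a, b, hab, hb⟩ := exists_edge_partial hreg hconn hJ ⟨e, he⟩ hJE
    refine (expect_le_expect fun φ _ => ind_mono fun h => ⟨h.1, hS (φ a)⟩).trans
      ((expect_hom_dens_le S hΔ0 J (not_isDiag_of_mem hJ) (edeg_le hreg hJ) hab hb hη).trans ?_)
    gcongr
    linarith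

end Bad

/-! ### The number of cores of a given size, for fixed parameters. -/

section CoreCount

variable {V : Type*} [Fintype V] [DecidableEq V] {H : SimpleGraph V} [DecidableRel H.Adj]

/-- The constant in the bound on the number of atypical edges of a core. -/
noncomputable def coreConst (H : SimpleGraph V) [DecidableRel H.Adj] (c₁ K : ℝ) : ℝ :=
  2 / c₁ * (2 ^ #H.edgeFinset * (#H.edgeFinset * (2 * K) ^ #H.edgeFinset))

lemma coreConst_nonneg {c₁ K : ℝ} (hc₁ : 0 < c₁) (hK : 0 ≤ K) : 0 ≤ coreConst H c₁ K := by
  unfold coreConst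
  positivity

/-- The marginals and the density of `S` cost only powers of `L`, so a rarity `g` that beats `L ^
(e(H) + 1)` makes `F` negligible against `n ^ 2 * p ^ Δ`. -/
lemma card_bad_le {n : ℕ} [Nonempty (Fin n)] {Δ : ℕ} (hΔ : 0 < Δ) {S F : Finset (Sym2 (Fin n))}
    (hF : F ⊆ S) (hS : ∀ e ∈ S, ¬ e.IsDiag)
    {p L c₁ K g : ℝ} (hp : 0 < p) (hL : 1 ≤ L) (hc₁ : 0 < c₁) (hK : 1 ≤ K) (hg : 0 ≤ g)
    (hcard : (#S : ℝ) ≤ K * ((n : ℝ) ^ 2 * p ^ Δ) * L)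
    (hemb : (n : ℝ) ^ Fintype.card V / 2 ≤ Fintype.card (V ↪ Fin n))
    (hτ : ∀ e ∈ S, c₁ / ((n : ℝ) ^ 2 * p ^ Δ * L) * condSum H (∅ : Finset (Sym2 (Fin n))) p ≤
      condSum H S p - condSum H (S.erase e) p)
    (hbad : ∀ J ⊆ H.edgeFinset, ∀ e ∈ J,
      𝔼 φ : V → Fin n, ind (Hom S J φ ∧ e.map φ ∈ F) ≤ g * (edens S ^ (1 / (Δ : ℝ))) ^ #J) :
    (#F : ℝ) ≤ (n : ℝ) ^ 2 * p ^ Δ * (coreConst H c₁ K * L ^ (#H.edgeFinset + 1) * g) := by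
  have hn : 0 < n := Fin.pos_iff_nonempty.2 inferInstance
  have hn0 : (0 : ℝ) < n := by exact_mod_cast hn
  have hq : edens S ≤ (2 * K * L) * p ^ Δ := by
    have h := card_sq_mul_edens S hS
    rw [Fintype.card_fin] at h
    have : (n : ℝ) ^ 2 * edens S ≤ (n : ℝ) ^ 2 * ((2 * K * L) * p ^ Δ) := by
      rw [h]; calc 2 * (#S : ℝ) ≤ 2 * (K * ((n : ℝ) ^ 2 * p ^ Δ) * L) := by gcongr
        _ = _ := by ring
    exact le_of_mul_le_mul_left this (by positivity)
  have hC : 1 ≤ 2 * K * L := by nlinarith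
  have h1 := card_mul_marginal_le hΔ hF hp hC hq hg hτ hbad
  rw [condSum_empty] at h1
  set M := (n : ℝ) ^ 2 * p ^ Δ with hM
  have hM0 : 0 < M := by positivity
  set X := (n : ℝ) ^ Fintype.card V * p ^ #H.edgeFinset with hX
  have hX0 : 0 < X := by positivity
  have h2 : #F * (c₁ / (M * L)) * (X / 2) ≤
      X * (2 ^ #H.edgeFinset * (#H.edgeFinset * ((2 * K * L) ^ #H.edgeFinset * g))) := by
    refine le_trans ?_ h1
    rw [mul_assoc (#F : ℝ)]
    have : X / 2 ≤ Fintype.card (V ↪ Fin n) * p ^ #H.edgeFinset := by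
      rw [hX, mul_div_right_comm]; gcongr
    gcongr
  have h3 : (#F : ℝ) * (X * (c₁ / (2 * (M * L)))) ≤ (M * (coreConst H c₁ K *
      L ^ (#H.edgeFinset + 1) * g)) * (X * (c₁ / (2 * (M * L)))) := by
    calc _ = #F * (c₁ / (M * L)) * (X / 2) := by field_simp
      _ ≤ _ := h2
      _ = _ := by unfold coreConst; rw [mul_pow]; field_simp; ring
  exact le_of_mul_le_mul_right h3 (by positivity)

set_option maxHeartbeats 1000000 in
/-- Counting cores of a given size, for fixed parameters. -/
lemma card_cores_le_of_bounds {Δ : ℕ} (hΔ : 2 ≤ Δ) (hreg : H.IsRegularOfDegree Δ)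
    (hconn : H.Connected) {n m : ℕ} {p L c c₁ K ε κ κ' : ℝ}
    (hn : 2 ≤ n) (hp : 0 < p) (hp1 : p < 1) (hL : L = Real.log (1 / p)) (hL1 : 1 ≤ L)
    (hLl : L ≤ Real.log n) (hc : 0 < c) (hc₁ : 0 < c₁) (hK : 1 ≤ K) (hε : 0 < ε)
    (hκ : 0 < κ) (hκ1 : κ ≤ 1 / 2) (hκε : κ ≤ ε / 9) (hκ' : κ' = κ / (4 * Δ))
    (hemb : (n : ℝ) ^ Fintype.card V / 2 ≤ Fintype.card (V ↪ Fin n))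
    (a3 : 6 + 1 / c ≤ ε / 9 * L)
    (a4 : (Δ * (#H.edgeFinset + 3) : ℕ) * Real.log L ≤ ε / 9 * L)
    (a5 : 2 * Real.log n ≤ ε / 9 * Real.exp (1 / 2 * Real.log n))
    (a6 : Real.log n ^ (Δ * (#H.edgeFinset + 3)) ≤
      2 * c * (ε / 54) * Real.exp (κ' * Real.log n))
    (a7 : coreConst H c₁ K * L ^ (#H.edgeFinset + 1) * ((L ^ (#H.edgeFinset + 3))⁻¹ +
      Real.exp (-(κ / Δ * L))) ≤ c * ε / (9 * Δ))
    (a8 : coreConst H c₁ K * (L ^ (#H.edgeFinset + 1) * (L ^ (#H.edgeFinset + 3))⁻¹ +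
      Real.log n ^ (#H.edgeFinset + 1) *
        ((2 * K * Real.exp (-(κ' * Real.log n)) * Real.log n) ^ (1 / (Δ : ℝ)) +
        2 * ((Δ * 54 / ε) ^ 2 / (2 * c * Real.log n ^ (4 * Δ * (#H.edgeFinset + 1) + 2 * Δ))) ^
          (1 / (4 * Δ : ℝ)))) ≤ c * ε / (9 * Δ))
    (a9 : Real.log n ^ (4 * Δ * (#H.edgeFinset + 1) + 2 * Δ) ≤ (n : ℝ) ^ 2 * p ^ Δ)
    (a11 : Real.exp (-(κ' * Real.log n)) ≤ n * p ^ Δ ∨ ¬ H.IsBipartite)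
    (hm1 : c * ((n : ℝ) ^ 2 * p ^ Δ) ≤ m) (hm2 : m ≤ K * ((n : ℝ) ^ 2 * p ^ Δ) * L)
    (𝒮 : Finset (Finset (Sym2 (Fin n))))
    (h𝒮 : ∀ S ∈ 𝒮, #S = m ∧ (∀ e ∈ S, ¬ e.IsDiag) ∧
      ∀ e ∈ S, c₁ / ((n : ℝ) ^ 2 * p ^ Δ * L) * condSum H (∅ : Finset (Sym2 (Fin n))) p ≤
        condSum H S p - condSum H (S.erase e) p) :
    (#𝒮 : ℝ) ≤ Real.exp (ε * m * L) := by
  have hΔ0 : 0 < Δ := by omega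
  have hΔ2 : (2 : ℝ) ≤ Δ := by exact_mod_cast hΔ
  have hΔR : (0 : ℝ) < Δ := by linarith
  have hn0 : (0 : ℝ) < n := by positivity
  have : Nonempty (Fin n) := ⟨⟨0, by omega⟩⟩
  set l := Real.log n with hl
  set M := (n : ℝ) ^ 2 * p ^ Δ with hM
  have hM0 : 0 < M := by positivity
  have hL0 : 0 < L := by linarith
  have hl0 : 0 < l := by linarith
  have hmR : (0 : ℝ) < m := lt_of_lt_of_le (by positivity) hm1
  have hm : 0 < m := by exact_mod_cast hmR
  have hpL : Real.log p = -L := by rw [hL, one_div, Real.log_inv, neg_neg]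
  have hpexp : p = Real.exp (-L) := by rw [← hpL, Real.exp_log hp]
  have hnexp : (n : ℝ) = Real.exp l := (Real.exp_log hn0).symm
  have hpΔ : p ^ Δ = Real.exp (-(Δ * L)) := by
    rw [hpexp, ← Real.exp_nat_mul]; congr 1; ring
  -- Then `γ ^ (1 / Δ) = L ^ (-(e(H) + 3))` beats the loss `L ^ (e(H) + 1)` in `card_bad_le`, while
  -- `log (1 / γ)` is of order `log L` and negligible against `L`.
  set A := Δ * (#H.edgeFinset + 3) with hA
  set γ := (L ^ A)⁻¹ with hγ
  have hγ0 : 0 < γ := by positivity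
  have hγ1 : γ ≤ 1 := inv_le_one_of_one_le₀ (one_le_pow₀ hL1)
  have hγr : γ ^ (1 / (Δ : ℝ)) = (L ^ (#H.edgeFinset + 3))⁻¹ := by
    rw [hγ, hA, one_div, Real.inv_rpow (by positivity), mul_comm, pow_mul,
      Real.pow_rpow_inv_natCast (by positivity) hΔ0.ne']
  -- This is `p ^ κ`: smaller than any power of `1 / L`, yet with `log (1 / η) = κ * L` only a small
  -- fraction of `L`.
  set η := Real.exp (-(κ * L)) with hη
  have hη0 : 0 < η := Real.exp_pos _
  have hη1 : η ≤ 1 := Real.exp_le_one_iff.2 (by have := mul_pos hκ hL0; linarith)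
  have hηr : η ^ (1 / (Δ : ℝ)) = Real.exp (-(κ / Δ * L)) := by
    rw [hη, ← Real.exp_mul]; congr 1; field_simp
  -- Makes the entropy `2 * m / t * (3 * l)` of the degree record equal to `ε / 9 * (m * L)`.
  set t := l / (ε / 54 * L) with ht
  have ht0 : 0 < t := by positivity
  set ξ := c * ε / (9 * Δ) with hξ
  have hcore0 : 0 ≤ coreConst H c₁ K := coreConst_nonneg hc₁ (by linarith)
  have hedens : ∀ S ∈ 𝒮, (n : ℝ) ^ 2 * edens S = 2 * m := by
    intro S hS
    have := card_sq_mul_edens S (h𝒮 S hS).2.1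
    rwa [Fintype.card_fin, (h𝒮 S hS).1] at this
  have hcover : ∀ S ∈ 𝒮, #S = m ∧ (∀ e ∈ S, ¬ e.IsDiag) ∧ ∃ F ⊆ S, (#F : ℝ) ≤ ξ * M ∧
      ∀ u v, s(u, v) ∈ S → s(u, v) ∉ F → (η ≤ dens S u ∨ η ≤ dens S v) ∨
        (γ * edens S ≤ dens S u * dens S v ∧ t ≤ n * dens S u ∧ t ≤ n * dens S v) := by
    intro S hS
    obtain ⟨hSm, hSd, hSτ⟩ := h𝒮 S hS
    refine ⟨hSm, hSd, ?_⟩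
    have hed := hedens S hS
    have hq : 0 < edens S := by
      by_contra hcon
      have : (n : ℝ) ^ 2 * edens S ≤ 0 := mul_nonpos_of_nonneg_of_nonpos (by positivity) (by linarith)
      linarith
    -- If `n * p ^ Δ` is not too small, a large degree product with one factor below `η` forces the
    -- other degree above `t`, even for bipartite `H`. Otherwise all degrees are small, and edges at
    -- vertices of degree below `t` are discarded as poor, using that `H` is nonbipartite.
    by_cases hdense : Real.exp (-(κ' * l)) ≤ n * p ^ Δ
    · refine ⟨lightEdges S γ η, lightEdges_subset _ _ _, ?_, ?_⟩
      · refine (card_bad_le hΔ0 (lightEdges_subset _ _ _) hSd hp hL1 hc₁ hK (g := γ ^ (1 / (Δ : ℝ)) +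
          η ^ (1 / (Δ : ℝ))) (by positivity) (by rw [hSm]; exact hm2) hemb hSτ
          fun J hJ e he => expect_hom_light_le hΔ hreg S hγ0.le hγ1 hη0.le hJ he).trans ?_
        rw [hγr, hηr, mul_comm ξ]
        gcongr
      · intro u v huv hF
        rw [mem_lightEdges] at hF
        by_cases hu : η ≤ dens S u
        · exact Or.inl (Or.inl hu)
        by_cases hv : η ≤ dens S v
        · exact Or.inl (Or.inr hv)
        push Not at hu hv
        have hprod : γ * edens S ≤ dens S u * dens S v := by
          by_contra hcon
          exact hF ⟨huv, hu, hv, not_le.1 hcon⟩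
        have hkey : η * t ≤ n * (γ * edens S) := by
          have h1 : 2 * c * (n * p ^ Δ) ≤ n * edens S := by
            have : n * (2 * c * (n * p ^ Δ)) ≤ n * (n * edens S) := by
              calc (n : ℝ) * (2 * c * (n * p ^ Δ)) = 2 * (c * M) := by rw [hM]; ring
                _ ≤ 2 * m := by linarith
                _ = n * (n * edens S) := by rw [← hed]; ring
            exact le_of_mul_le_mul_left this hn0
          have h2 : Real.exp (κ' * l) * η ≤ n * p ^ Δ := by
            -- Either `η ≤ n ^ (-2κ')`, and `hdense` suffices, or `L` is so small that `n * p ^ Δ >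
            -- n ^ (1/2)`.
            by_cases hcase : 2 * κ' * l ≤ κ * L
            · refine le_trans ?_ hdense
              rw [hη, ← Real.exp_add, Real.exp_le_exp]
              linarith
            · push Not at hcase
              rw [hη, ← Real.exp_add, hpΔ, hnexp, ← Real.exp_add, Real.exp_le_exp]
              have e1 : 4 * Δ * κ' = κ := by rw [hκ']; field_simp
              have e2 : κ * (2 * Δ * L) < κ * l := by
                have h5 : 2 * κ' * l * (2 * Δ) = κ * l := by rw [← e1]; ring
                have h6 := mul_lt_mul_of_pos_right hcase (show (0 : ℝ) < 2 * Δ by positivity)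
                linarith
              have e3 : 2 * Δ * L < l := lt_of_mul_lt_mul_left e2 hκ.le
              have e4 : κ' ≤ 1 / 2 := by
                rw [hκ', div_le_iff₀ (by positivity)]; linarith
              have e5 : 0 ≤ κ * L := by positivity
              have e6 : κ' * l ≤ 1 / 2 * l := by gcongr
              linarith
          have h3 : l ≤ (ε / 54 * L) * (γ * (2 * c * Real.exp (κ' * l))) := by
            have e1 : L ^ (A - 1) * l ≤ l ^ A := by
              have hA1 : A = (A - 1) + 1 := by
                have : 0 < A := Nat.mul_pos hΔ0 (by omega)
                omega
              rw [hA1, pow_succ, Nat.add_sub_cancel]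
              gcongr
            have e2 := e1.trans a6
            have hA1 : L ^ A = L ^ (A - 1) * L := by
              rw [← pow_succ]; congr 1
              have : 0 < A := Nat.mul_pos hΔ0 (by omega)
              omega
            rw [hγ, hA1]
            have e3 : 0 < L ^ (A - 1) := by positivity
            have e4 : ε / 54 * L * ((L ^ (A - 1) * L)⁻¹ * (2 * c * Real.exp (κ' * l))) =
                (2 * c * (ε / 54) * Real.exp (κ' * l)) / L ^ (A - 1) := by
              field_simp
            rw [e4, le_div_iff₀ e3]
            linarith
          have h4 : t ≤ γ * (2 * c * Real.exp (κ' * l)) := by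
            rw [ht, div_le_iff₀ (by positivity)]; linarith
          calc η * t ≤ η * (γ * (2 * c * Real.exp (κ' * l))) := by gcongr
            _ = γ * (2 * c * (Real.exp (κ' * l) * η)) := by ring
            _ ≤ γ * (2 * c * (n * p ^ Δ)) := by gcongr
            _ ≤ γ * (n * edens S) := by gcongr
            _ = _ := by ring
        have hside : ∀ a b : ℝ, 0 ≤ a → b ≤ η → γ * edens S ≤ a * b → t ≤ n * a := by
          intro a b ha hb hab
          have h1 : η * t ≤ η * (n * a) := by
            calc η * t ≤ n * (γ * edens S) := hkey
              _ ≤ n * (a * b) := by gcongr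
              _ ≤ n * (a * η) := by gcongr
              _ = _ := by ring
          exact le_of_mul_le_mul_left h1 hη0
        exact Or.inr ⟨hprod, hside _ _ (dens_nonneg _ _) hv.le hprod,
          hside _ _ (dens_nonneg _ _) hu.le (by rwa [mul_comm (dens S v)])⟩
    · have hnb : ¬ H.IsBipartite := a11.resolve_left hdense
      push Not at hdense
      set ηB := 2 * K * Real.exp (-(κ' * l)) * l with hηB
      have hdens : ∀ u, dens S u < ηB := by
        intro u
        have h1 := card_mul_dens_le S u
        rw [Fintype.card_fin, hSm] at h1
        have h2 : n * dens S u ≤ n * (K * (n * p ^ Δ) * L) := by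
          refine (h1.trans hm2).trans (le_of_eq ?_)
          rw [hM]; ring
        have h3 := le_of_mul_le_mul_left h2 hn0
        refine h3.trans_lt ?_
        have hE := Real.exp_pos (-(κ' * l))
        calc K * (n * p ^ Δ) * L ≤ K * Real.exp (-(κ' * l)) * l := by gcongr
          _ < ηB := by
            have : 0 < K * Real.exp (-(κ' * l)) * l := by positivity
            rw [hηB]; linarith [mul_assoc (2 * K) (Real.exp (-(κ' * l))) l,
              mul_assoc 2 K (Real.exp (-(κ' * l)) * l), mul_assoc K (Real.exp (-(κ' * l))) l]
      have hηB0 : 0 ≤ ηB := by positivity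
      refine ⟨poorEdges S γ (t / n), poorEdges_subset _ _ _, ?_, ?_⟩
      · refine (card_bad_le hΔ0 (poorEdges_subset _ _ _) hSd hp hL1 hc₁ hK (g := γ ^ (1 / (Δ : ℝ)) +
          ηB ^ (1 / (Δ : ℝ)) + 2 * ((t / n) ^ 2 / edens S) ^ (1 / (4 * Δ : ℝ))) (by positivity)
          (by rw [hSm]; exact hm2) hemb hSτ
          fun J hJ e he => expect_hom_poor_le hΔ hreg hconn hnb S hq hγ0.le hγ1 hηB0
            (by positivity) hdens hJ he).trans ?_
        rw [hγr, mul_comm ξ]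
        have hκ'0 : 0 ≤ κ' := by rw [hκ']; positivity
        -- In this case `n * p ^ Δ < 1`, so `log n` is at most `Δ * L` and `t` is bounded by a
        -- constant.
        have h1 : l ≤ Δ * L := by
          have e1 : n * p ^ Δ < 1 :=
            hdense.trans_le (Real.exp_le_one_iff.2 (by have := mul_nonneg hκ'0 hl0.le; linarith))
          rw [hpΔ, hnexp, ← Real.exp_add, ← Real.exp_zero, Real.exp_lt_exp] at e1
          linarith
        have h2 : t ≤ Δ * 54 / ε := by
          rw [ht, div_le_div_iff₀ (by positivity) hε]
          calc l * ε ≤ Δ * L * ε := by gcongr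
            _ = _ := by ring
        -- The left side is `t ^ 2 / (2 * m)`, and `m` exceeds a constant times a large power of
        -- `log n`: this is what the logarithmic factor in the lower bound on `p` is for.
        have h3 : (t / n) ^ 2 / edens S ≤
            (Δ * 54 / ε) ^ 2 / (2 * c * l ^ (4 * Δ * (#H.edgeFinset + 1) + 2 * Δ)) := by
          have e1 : (t / n) ^ 2 / edens S = t ^ 2 / (2 * m) := by
            rw [← hed]; field_simp
          rw [e1]
          have e2 : 2 * c * l ^ (4 * Δ * (#H.edgeFinset + 1) + 2 * Δ) ≤ 2 * m := by
            have : c * l ^ (4 * Δ * (#H.edgeFinset + 1) + 2 * Δ) ≤ m := le_trans (by gcongr) hm1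
            linarith
          gcongr
        refine mul_le_mul_of_nonneg_left (le_trans ?_ a8) hM0.le
        rw [mul_assoc]
        refine mul_le_mul_of_nonneg_left ?_ hcore0
        rw [add_assoc, mul_add]
        have h4 : ((t / n) ^ 2 / edens S) ^ (1 / (4 * Δ : ℝ)) ≤ ((Δ * 54 / ε) ^ 2 /
            (2 * c * l ^ (4 * Δ * (#H.edgeFinset + 1) + 2 * Δ))) ^ (1 / (4 * Δ : ℝ)) :=
          Real.rpow_le_rpow (by positivity) h3 (by positivity)
        gcongr
      · intro u v huv hF
        rw [mem_poorEdges] at hF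
        right
        have h1 : ¬ (dens S u * dens S v < γ * edens S ∨ dens S u < t / n ∨ dens S v < t / n) :=
          fun h => hF ⟨huv, h⟩
        push Not at h1
        obtain ⟨h1, h2, h3⟩ := h1
        rw [div_le_iff₀ hn0] at h2 h3
        exact ⟨h1, by linarith, by linarith⟩
  have hy1 : p ^ Δ ≤ 1 := pow_le_one₀ hp.le hp1.le
  refine (card_family_le_of_cover hm hn hη0 hη1 hγ0 hγ1 ht0 (show 0 < p ^ Δ by positivity) hy1 𝒮
    hcover).trans (Real.exp_le_exp.2 ?_)
  -- Six shares of `ε / 9 * (m * L)` cover the exponent; the terms linear in `m`, including this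
  -- one, and the constants are collected in `i7`.
  have i1 : p ^ Δ * (n : ℝ) ^ 2 ≤ m * (1 / c) := by
    rw [mul_one_div, le_div_iff₀ hc]; linarith
  have i2 : ξ * M * Real.log (1 / p ^ Δ) ≤ ε / 9 * (m * L) := by
    have : Real.log (1 / p ^ Δ) = Δ * L := by
      rw [one_div, Real.log_inv, Real.log_pow, hpL]; ring
    rw [this, hξ]
    calc c * ε / (9 * Δ) * M * (Δ * L) = ε / 9 * ((c * M) * L) := by field_simp
      _ ≤ ε / 9 * (m * L) := by gcongr
  have i3 : 2 * m / (η * n) * l ≤ ε / 9 * (m * L) := by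
    have e1 : Real.exp (1 / 2 * l) ≤ η * n := by
      rw [hη, hnexp, ← Real.exp_add, Real.exp_le_exp]
      have : κ * L ≤ 1 / 2 * l := by gcongr
      linarith
    have e2 : 2 * l ≤ ε / 9 * L * (η * n) := by
      calc 2 * l ≤ ε / 9 * Real.exp (1 / 2 * l) := a5
        _ ≤ ε / 9 * (η * n) := by gcongr
        _ = ε / 9 * 1 * (η * n) := by ring
        _ ≤ ε / 9 * L * (η * n) := by gcongr
    rw [div_mul_eq_mul_div, div_le_iff₀ (by positivity)]
    calc 2 * m * l = m * (2 * l) := by ring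
      _ ≤ m * (ε / 9 * L * (η * n)) := by gcongr
      _ = _ := by ring
  have i4 : m * Real.log (1 / η) ≤ ε / 9 * (m * L) := by
    rw [one_div, Real.log_inv, hη, Real.log_exp, neg_neg]
    calc m * (κ * L) ≤ m * (ε / 9 * L) := by gcongr
      _ = _ := by ring
  have i5 : 2 * m / t * (3 * l) = ε / 9 * (m * L) := by
    rw [ht]; field_simp; ring
  have i6 : m * Real.log (1 / γ) ≤ ε / 9 * (m * L) := by
    rw [one_div, hγ, inv_inv, Real.log_pow]
    calc _ ≤ m * (ε / 9 * L) := by gcongr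
      _ = _ := by ring
  have i7 : (m : ℝ) * (6 + 1 / c) ≤ ε / 9 * (m * L) := by
    calc _ ≤ m * (ε / 9 * L) := by gcongr
      _ = _ := by ring
  have i8 : (1 : ℝ) ≤ m := by exact_mod_cast hm
  have i9 : 0 ≤ ε * (m * L) := by positivity
  linarith

end CoreCount

/-! ### Asymptotics in the admissible range of `p`. -/

section Regime

variable {V : Type*} [Fintype V] [DecidableEq V] {H : SimpleGraph V} [DecidableRel H.Adj]

/-- The assumptions on the edge probability. -/
structure Admissible (H : SimpleGraph V) (Δ : ℕ) (p : ℕ → ℝ) : Prop where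
  pos : ∀ᶠ n in atTop, 0 < p n
  tendsto_zero : Tendsto p atTop (𝓝 0)
  -- The square of the lower bound on `p ^ (Δ / 2)`, hence the factor `2` in the exponent.
  lower : ∀ᶠ n : ℕ in atTop, Real.log n ^ (2 * Δ * Fintype.card V ^ 2) ≤ (n : ℝ) ^ 2 * p n ^ Δ
  -- The first alternative reads `n ^ (-κ) ≤ n * p ^ Δ`; this is how `p ^ (Δ / 2) ≥ n ^ (-1/2 -
  -- o(1))` is used.
  dense_or : ∀ κ : ℝ, 0 < κ → ∀ᶠ n : ℕ in atTop,
    Real.exp (-(κ * Real.log n)) ≤ n * p n ^ Δ ∨ ¬ H.IsBipartite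

lemma tendsto_log_natCast : Tendsto (fun n : ℕ => Real.log n) atTop atTop :=
  Real.tendsto_log_atTop.comp tendsto_natCast_atTop_atTop

variable {Δ : ℕ} {p : ℕ → ℝ}

lemma Admissible.tendsto_log (h : Admissible H Δ p) :
    Tendsto (fun n => Real.log (1 / p n)) atTop atTop := by
  have h1 : Tendsto p atTop (𝓝[>] 0) :=
    tendsto_nhdsWithin_iff.2 ⟨h.tendsto_zero, h.pos⟩
  simp_rw [one_div, Real.log_inv]
  exact tendsto_neg_atBot_atTop.comp (Real.tendsto_log_nhdsGT_zero.comp h1)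

lemma Admissible.lt_one (h : Admissible H Δ p) : ∀ᶠ n in atTop, p n < 1 :=
  h.tendsto_zero.eventually_lt_const one_pos

lemma Admissible.tendsto_size [Nonempty V] (hΔ : 2 ≤ Δ) (h : Admissible H Δ p) :
    Tendsto (fun n : ℕ => (n : ℝ) ^ 2 * p n ^ Δ) atTop atTop := by
  refine tendsto_atTop_mono' _ h.lower ((tendsto_pow_atTop ?_).comp tendsto_log_natCast)
  have : 0 < Fintype.card V := Fintype.card_pos
  positivity

lemma Admissible.log_le (hΔ : 2 ≤ Δ) [Nonempty V] (h : Admissible H Δ p) :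
    ∀ᶠ n : ℕ in atTop, Real.log (1 / p n) ≤ Real.log n := by
  filter_upwards [h.pos, h.lt_one, (h.tendsto_size hΔ).eventually_ge_atTop 1,
    eventually_ge_atTop 2] with n hp hp1 hM hn
  have hn0 : (0 : ℝ) < n := by positivity
  have h1 := Real.log_le_log one_pos hM
  rw [Real.log_one, Real.log_mul (by positivity) (by positivity), Real.log_pow, Real.log_pow] at h1
  rw [one_div, Real.log_inv]
  have h2 : Real.log (p n) < 0 := Real.log_neg hp hp1
  have h3 : (2 : ℝ) ≤ Δ := by exact_mod_cast hΔ
  push_cast at h1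
  nlinarith

lemma eventually_emb (V : Type*) [Fintype V] : ∀ᶠ n : ℕ in atTop,
    (n : ℝ) ^ Fintype.card V / 2 ≤ Fintype.card (V ↪ Fin n) := by
  filter_upwards [(tendsto_card_embedding V).eventually_const_lt (show (1 / 2 : ℝ) < 1 by norm_num),
    eventually_gt_atTop 0] with n hn hn0
  rw [lt_div_iff₀ (by positivity)] at hn
  linarith

/-- The left side, the power of `log n` needed for counting cores, is `2 * Δ * (Δ * v + 3)`. The
power in the hypothesis on `p` suffices because `v ≥ Δ + 1 ≥ 3`. -/
lemma exponent_le (hΔ : 2 ≤ Δ) (hreg : H.IsRegularOfDegree Δ) [Nonempty V] :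
    4 * Δ * (#H.edgeFinset + 1) + 2 * Δ ≤ 2 * Δ * Fintype.card V ^ 2 := by
  have h1 := two_mul_card_edges hreg
  have h2 : Δ + 1 ≤ Fintype.card V := by
    obtain ⟨v⟩ := ‹Nonempty V›
    have := H.degree_lt_card_verts v
    rw [hreg v] at this
    exact this
  have h3 : Δ * Fintype.card V + 3 ≤ Fintype.card V ^ 2 := by nlinarith
  calc 4 * Δ * (#H.edgeFinset + 1) + 2 * Δ = 2 * Δ * (2 * #H.edgeFinset + 3) := by ring
    _ ≤ _ := by rw [h1]; gcongr

lemma tendsto_pow_mul_exp_neg (k : ℕ) {b : ℝ} (hb : 0 < b) :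
    Tendsto (fun x : ℝ => x ^ k * Real.exp (-(b * x))) atTop (𝓝 0) := by
  have := (isLittleO_pow_exp_pos_mul_atTop k hb).tendsto_div_nhds_zero
  refine this.congr fun x => ?_
  rw [Real.exp_neg, div_eq_mul_inv]

lemma tendsto_pow_mul_inv_pow {k k' : ℕ} (h : k < k') :
    Tendsto (fun x : ℝ => x ^ k * (x ^ k')⁻¹) atTop (𝓝 0) := by
  have : Tendsto (fun x : ℝ => (x ^ (k' - k))⁻¹) atTop (𝓝 0) :=
    (tendsto_pow_atTop (by omega)).inv_tendsto_atTop
  refine this.congr' ?_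
  filter_upwards [eventually_gt_atTop 0] with x hx
  have : x ^ k' = x ^ k * x ^ (k' - k) := by rw [← pow_add]; congr 1; omega
  rw [this, mul_inv, ← mul_assoc, mul_inv_cancel₀ (by positivity), one_mul]

lemma tendsto_pow_mul_rpow {k j : ℕ} (hj : 0 < j) {f : ℝ → ℝ} (hf : ∀ᶠ x in atTop, 0 ≤ f x)
    (h : Tendsto (fun x => x ^ (j * k) * f x) atTop (𝓝 0)) :
    Tendsto (fun x : ℝ => x ^ k * f x ^ (1 / (j : ℝ))) atTop (𝓝 0) := by
  have hj' : (0 : ℝ) < 1 / (j : ℝ) := by positivity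
  have h1 := h.rpow_const (p := 1 / (j : ℝ)) (Or.inr hj'.le)
  rw [Real.zero_rpow hj'.ne'] at h1
  refine h1.congr' ?_
  filter_upwards [eventually_ge_atTop 0, hf] with x hx hfx
  rw [Real.mul_rpow (by positivity) hfx, one_div, mul_comm, pow_mul', mul_comm,
    Real.pow_rpow_inv_natCast (by positivity) hj.ne']

/-- There are few cores of any given size. -/
lemma eventually_card_cores_le (hΔ : 2 ≤ Δ) (hreg : H.IsRegularOfDegree Δ) (hconn : H.Connected)
    (h : Admissible H Δ p) {c c₁ K ε : ℝ} (hc : 0 < c) (hc₁ : 0 < c₁) (hK : 1 ≤ K) (hε : 0 < ε) :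
    ∀ᶠ n : ℕ in atTop, ∀ m : ℕ, c * ((n : ℝ) ^ 2 * p n ^ Δ) ≤ m →
      m ≤ K * ((n : ℝ) ^ 2 * p n ^ Δ) * Real.log (1 / p n) →
      ∀ 𝒮 : Finset (Finset (Sym2 (Fin n))),
      (∀ S ∈ 𝒮, #S = m ∧ (∀ e ∈ S, ¬ e.IsDiag) ∧
        ∀ e ∈ S, c₁ / ((n : ℝ) ^ 2 * p n ^ Δ * Real.log (1 / p n)) *
          condSum H (∅ : Finset (Sym2 (Fin n))) (p n) ≤
            condSum H S (p n) - condSum H (S.erase e) (p n)) →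
      (#𝒮 : ℝ) ≤ Real.exp (ε * m * Real.log (1 / p n)) := by
  have := hconn.nonempty
  have hΔ0 : 0 < Δ := by omega
  have hΔR : (0 : ℝ) < Δ := by exact_mod_cast hΔ0
  set κ := min (1 / 2) (ε / 9) with hκdef
  have hκ : 0 < κ := lt_min (by norm_num) (by positivity)
  set κ' := κ / (4 * Δ) with hκ'
  have hκ'0 : 0 < κ' := by positivity
  set E := #H.edgeFinset with hE
  have hξ : 0 < c * ε / (9 * Δ) := by positivity
  have t3 : ∀ᶠ x : ℝ in atTop, 6 + 1 / c ≤ ε / 9 * x :=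
    (tendsto_id.const_mul_atTop (by positivity : 0 < ε / 9)).eventually_ge_atTop _
  have t4 : ∀ᶠ x : ℝ in atTop, (Δ * (E + 3) : ℕ) * Real.log x ≤ ε / 9 * x := by
    have h1 : Tendsto (fun x : ℝ => (Δ * (E + 3) : ℕ) * (Real.log x / x)) atTop (𝓝 0) := by
      have := (Real.isLittleO_log_id_atTop.tendsto_div_nhds_zero).const_mul ((Δ * (E + 3) : ℕ) : ℝ)
      rwa [mul_zero] at this
    filter_upwards [h1.eventually_lt_const (show 0 < ε / 9 by positivity), eventually_gt_atTop 0]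
      with x hx hx0
    rw [← mul_div_assoc, div_lt_iff₀ hx0] at hx
    exact hx.le
  have texp : ∀ (k : ℕ) (a b d : ℝ), 0 < b → 0 < d →
      ∀ᶠ x : ℝ in atTop, a * x ^ k ≤ d * Real.exp (b * x) := by
    intro k a b d hb hd
    have h1 : Tendsto (fun x : ℝ => a * (x ^ k * Real.exp (-(b * x)))) atTop (𝓝 0) := by
      have := (tendsto_pow_mul_exp_neg k hb).const_mul a
      rwa [mul_zero] at this
    filter_upwards [h1.eventually_lt_const hd] with x hx
    rw [Real.exp_neg, ← mul_assoc, ← div_eq_mul_inv, div_lt_iff₀ (Real.exp_pos _)] at hx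
    exact hx.le
  have t5 := texp 1 2 (1 / 2) (ε / 9) (by norm_num) (by positivity)
  have t6 := texp (Δ * (E + 3)) 1 κ' (2 * c * (ε / 54)) hκ'0 (by positivity)
  have tinv : Tendsto (fun x : ℝ => x ^ (E + 1) * (x ^ (E + 3))⁻¹) atTop (𝓝 0) :=
    tendsto_pow_mul_inv_pow (by omega)
  have t7 : ∀ᶠ x : ℝ in atTop, coreConst H c₁ K * x ^ (E + 1) * ((x ^ (E + 3))⁻¹ +
      Real.exp (-(κ / Δ * x))) < c * ε / (9 * Δ) := by
    have h1 : Tendsto (fun x : ℝ => coreConst H c₁ K * (x ^ (E + 1) * (x ^ (E + 3))⁻¹ +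
        x ^ (E + 1) * Real.exp (-(κ / Δ * x)))) atTop (𝓝 (coreConst H c₁ K * (0 + 0))) :=
      (tinv.add (tendsto_pow_mul_exp_neg (E + 1) (by positivity))).const_mul _
    rw [add_zero, mul_zero] at h1
    filter_upwards [h1.eventually_lt_const hξ] with x hx
    rw [mul_assoc, mul_add]
    exact hx
  have t8a : Tendsto (fun x : ℝ => x ^ (E + 1) *
      (2 * K * Real.exp (-(κ' * x)) * x) ^ (1 / (Δ : ℝ))) atTop (𝓝 0) := by
    refine tendsto_pow_mul_rpow hΔ0 ?_ ?_
    · filter_upwards [eventually_ge_atTop 0] with x hx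
      positivity
    · have := (tendsto_pow_mul_exp_neg (Δ * (E + 1) + 1) hκ'0).const_mul (2 * K)
      rw [mul_zero] at this
      exact this.congr fun x => by ring
  have t8b : Tendsto (fun x : ℝ => x ^ (E + 1) *
      ((Δ * 54 / ε) ^ 2 / (2 * c * x ^ (4 * Δ * (E + 1) + 2 * Δ))) ^ (1 / (4 * Δ : ℝ)))
      atTop (𝓝 0) := by
    have h1 := tendsto_pow_mul_rpow (k := E + 1) (j := 4 * Δ) (by positivity)
      (f := fun x => (Δ * 54 / ε) ^ 2 / (2 * c * x ^ (4 * Δ * (E + 1) + 2 * Δ))) ?_ ?_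
    · push_cast at h1
      exact h1
    · filter_upwards [eventually_ge_atTop 0] with x hx
      positivity
    · have := (tendsto_pow_mul_inv_pow (k := 4 * Δ * (E + 1)) (k' := 4 * Δ * (E + 1) + 2 * Δ)
        (by omega)).const_mul ((Δ * 54 / ε) ^ 2 / (2 * c))
      rw [mul_zero] at this
      exact this.congr fun x => by rw [div_mul_eq_div_div _ (2 * c)]; ring
  have t8 : ∀ᶠ n : ℕ in atTop, coreConst H c₁ K *
      (Real.log (1 / p n) ^ (E + 1) * (Real.log (1 / p n) ^ (E + 3))⁻¹ +
      Real.log n ^ (E + 1) *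
        ((2 * K * Real.exp (-(κ' * Real.log n)) * Real.log n) ^ (1 / (Δ : ℝ)) +
        2 * ((Δ * 54 / ε) ^ 2 / (2 * c * Real.log n ^ (4 * Δ * (E + 1) + 2 * Δ))) ^
          (1 / (4 * Δ : ℝ)))) < c * ε / (9 * Δ) := by
    have h1 := ((tinv.comp h.tendsto_log).add ((t8a.comp tendsto_log_natCast).add
      ((t8b.comp tendsto_log_natCast).const_mul 2))).const_mul (coreConst H c₁ K)
    simp only [mul_zero, add_zero] at h1
    filter_upwards [h1.eventually_lt_const hξ] with n hn
    refine lt_of_eq_of_lt ?_ hn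
    simp only [Function.comp]
    ring
  have t9 : ∀ᶠ n : ℕ in atTop,
      Real.log n ^ (4 * Δ * (E + 1) + 2 * Δ) ≤ (n : ℝ) ^ 2 * p n ^ Δ := by
    filter_upwards [h.lower, tendsto_log_natCast.eventually_ge_atTop 1] with n hn hl
    exact (pow_le_pow_right₀ hl (exponent_le hΔ hreg)).trans hn
  filter_upwards [h.pos, h.lt_one, eventually_ge_atTop 2, h.tendsto_log.eventually_ge_atTop 1,
    h.log_le hΔ, eventually_emb V, h.tendsto_log.eventually t3, h.tendsto_log.eventually t4,
    tendsto_log_natCast.eventually t5, tendsto_log_natCast.eventually t6,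
    h.tendsto_log.eventually t7, t8, t9, h.dense_or κ' hκ'0] with
    n b1 b2 b3 b4 b5 b6 b7 b8 b9 b10 b11 b12 b13 b14 m hm1 hm2 𝒮 h𝒮
  rw [pow_one] at b9
  rw [one_mul] at b10
  exact card_cores_le_of_bounds hΔ hreg hconn b3 b1 b2 rfl b4 b5 hc hc₁ hK hε hκ (min_le_left _ _)
    (min_le_right _ _) hκ' b6 b7 b8 b9 b10 b11.le b12.le b13 b14 hm1 hm2 𝒮 h𝒮

end Regime

/-! ### Upper bound on the tail by a union bound over cores. -/

section UpperBound

variable {V : Type*} [Fintype V] [DecidableEq V] {H : SimpleGraph V} [DecidableRel H.Adj]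
  {Δ : ℕ} {p : ℕ → I}

lemma card_edgeFinset_pos (hΔ : 2 ≤ Δ) (hreg : H.IsRegularOfDegree Δ) [Nonempty V] :
    0 < #H.edgeFinset := by
  have h := two_mul_card_edges hreg
  have : 0 < Δ * Fintype.card V := Nat.mul_pos (by omega) Fintype.card_pos
  omega

/-- Upper bound on the upper tail probability, given that small edge sets are harmless. -/
lemma eventually_upperTailProb_le (hΔ : 2 ≤ Δ) (hreg : H.IsRegularOfDegree Δ)
    (hconn : H.Connected) (h : Admissible H Δ fun n => (p n : ℝ)) {δ c c₀ : ℝ} (hδ : 0 < δ)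
    (hc₀ : 0 < c₀) (hc : c₀ < c)
    (hsmall : ∃ ε > 0, ∀ᶠ n : ℕ in atTop, ∀ S : Finset (Sym2 (Fin n)), (∀ e ∈ S, ¬ e.IsDiag) →
      (#S : ℝ) ≤ c * ((n : ℝ) ^ 2 * (p n : ℝ) ^ Δ) →
      condSum H S (p n) < (1 + δ - ε) * condSum H (∅ : Finset (Sym2 (Fin n))) (p n)) :
    ∀ᶠ n : ℕ in atTop, upperTailProb H δ n (p n) ≤
      Real.exp (-(c₀ * ((n : ℝ) ^ 2 * (p n : ℝ) ^ Δ * Real.log (1 / (p n : ℝ))))) := by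
  have := hconn.nonempty
  have hE := card_edgeFinset_pos hΔ hreg
  set E := #H.edgeFinset with hEdef
  have hER : (0 : ℝ) < E := by exact_mod_cast hE
  have hc0 : 0 < c := hc₀.trans hc
  obtain ⟨ε₀, hε₀, hsmall⟩ := hsmall
  set ε := min ε₀ δ with hε
  have hεpos : 0 < ε := lt_min hε₀ hδ
  set r := (1 + δ - ε / 2) / (1 + δ) with hr
  have hεδ : ε ≤ δ := min_le_right _ _
  have hr0 : 0 < r := div_pos (by linarith) (by linarith)
  have hr1 : r < 1 := by rw [hr, div_lt_one (by linarith)]; linarith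
  have hlogr : 0 < -Real.log r := neg_pos.2 (Real.log_neg hr0 hr1)
  -- With `r = B / T` and `k ≥ K₀ * x`, the moment term `r ^ k` is at most `exp (-(c * x))`.
  set K₀ := c / -Real.log r with hK₀
  have hK₀pos : 0 < K₀ := div_pos hc0 hlogr
  set K := E * (K₀ + 1) with hK
  have hK1 : 1 ≤ K := by
    have : (1 : ℝ) ≤ E := by exact_mod_cast hE
    nlinarith
  set c₁ := ε / 2 / (E * (K₀ + 1)) with hc₁
  have hc₁pos : 0 < c₁ := by positivity
  -- Places `(1 - ε₁) * c` midway between `c₀` and `c`; the other half of the gap pays for the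
  -- number of possible core sizes.
  set ε₁ := (c - c₀) / (2 * c) with hε₁
  have hε₁pos : 0 < ε₁ := div_pos (by linarith) (by linarith)
  have hε₁c : (1 - ε₁) * c = (c + c₀) / 2 := by rw [hε₁]; field_simp; ring
  have hε₁1 : 0 < 1 - ε₁ := pos_of_mul_pos_left (by rw [hε₁c]; linarith) hc0.le
  have hx : Tendsto (fun n : ℕ => (n : ℝ) ^ 2 * (p n : ℝ) ^ Δ * Real.log (1 / (p n : ℝ)))
      atTop atTop := (h.tendsto_size hΔ).atTop_mul_atTop₀ h.tendsto_log
  have hexp : ∀ᶠ x : ℝ in atTop, (K + 2) * x ≤ Real.exp ((c - c₀) / 2 * x) := by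
    have hb : 0 < (c - c₀) / 2 := by linarith
    have h1 := (tendsto_pow_mul_exp_neg 1 hb).const_mul (K + 2)
    rw [mul_zero] at h1
    filter_upwards [h1.eventually_lt_const one_pos] with x hx
    rw [Real.exp_neg, ← mul_assoc, ← div_eq_mul_inv, div_lt_iff₀ (Real.exp_pos _), one_mul,
      pow_one] at hx
    exact hx.le
  filter_upwards [hsmall, eventually_card_cores_le hΔ hreg hconn h hc0 hc₁pos hK1 hε₁pos,
    h.pos, h.lt_one, hx.eventually_ge_atTop 1, hx.eventually hexp, eventually_ge_atTop
    (Fintype.card V), h.tendsto_log.eventually_gt_atTop 0] with n g1 g2 hp hp1 hx1 hexp hn hL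
  set q : ℝ := (p n : ℝ) with hq
  set L := Real.log (1 / q) with hLdef
  set M := (n : ℝ) ^ 2 * q ^ Δ with hM
  set x := M * L with hxdef
  set X := condSum H (∅ : Finset (Sym2 (Fin n))) q with hX
  have hX0 : 0 < X := condSum_empty_pos hn hp
  set k := ⌈K₀ * x⌉₊ with hk
  have hk1 : K₀ * x ≤ k := Nat.le_ceil _
  have hk2 : (k : ℝ) ≤ (K₀ + 1) * x := by
    have := (Nat.ceil_lt_add_one (show 0 ≤ K₀ * x by positivity)).le
    linarith
  have hk0 : (0 : ℝ) < k := lt_of_lt_of_le (by positivity) hk1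
  -- Discarding up to `E * k` edges of marginal below `t` loses at most `ε / 2 * X`, so cores keep
  -- at least `(1 + δ - ε) * X`.
  set t := ε / 2 * X / (E * k) with ht
  have ht0 : 0 < t := by positivity
  have htc : c₁ / x * X ≤ t := by
    rw [ht, hc₁]
    calc ε / 2 / (E * (K₀ + 1)) / x * X = ε / 2 * X / (E * ((K₀ + 1) * x)) := by
          field_simp
      _ ≤ _ := by gcongr
  have hB : 0 ≤ (1 + δ - ε / 2) * X := mul_nonneg (by linarith) hX0.le
  have hT : 0 < (1 + δ) * X := mul_pos (by linarith) hX0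
  have hmain := upper_tail_le_cores (H := H) (n := n) (p := p n) hT hB ht0.le k
  rw [upperTailProb_eq]
  refine hmain.trans ?_
  have hBt : (1 + δ - ε / 2) * X - (E * k : ℕ) * t = (1 + δ - ε) * X := by
    rw [ht]; push_cast; field_simp; ring
  rw [hBt]
  set 𝒞 := cores H n (p n) (E * k) ((1 + δ - ε) * X) t with h𝒞
  have hEk : ((E * k : ℕ) : ℝ) ≤ K * x := by
    push_cast
    calc (E : ℝ) * k ≤ E * ((K₀ + 1) * x) := by gcongr
      _ = _ := by rw [hK]; ring
  have hfirst : ((1 + δ - ε / 2) * X / ((1 + δ) * X)) ^ k ≤ Real.exp (-((c + c₀) / 2 * x)) := by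
    rw [mul_div_mul_right _ _ hX0.ne', ← hr, ← Real.exp_log hr0, ← Real.exp_nat_mul,
      Real.exp_le_exp]
    have h1 : c * x ≤ k * -Real.log r := by
      calc c * x = K₀ * x * -Real.log r := by
            rw [hK₀, mul_right_comm, div_mul_cancel₀ _ hlogr.ne']
        _ ≤ _ := by gcongr
    have : c₀ * x ≤ c * x := by gcongr
    linarith
  have hlevel : ∀ m ∈ range (E * k + 1), ∑ C ∈ 𝒞 with #C = m, q ^ #C ≤
      Real.exp (-((c + c₀) / 2 * x)) := by
    intro m hm
    have hmk : m ≤ E * k := by have := mem_range.1 hm; omega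
    rcases (𝒞.filter fun C => #C = m).eq_empty_or_nonempty with h0 | ⟨C, hC⟩
    · rw [h0, sum_empty]; positivity
    · have hcore := mem_cores.1 (mem_filter.1 hC).1
      have hCm := (mem_filter.1 hC).2
      -- A smaller core would contradict `hsmall`.
      have hcm : c * M ≤ m := by
        by_contra hcon
        have h1 := g1 C hcore.1 (by rw [hCm]; exact (not_le.1 hcon).le)
        have h2 : (1 + δ - ε₀) * X ≤ (1 + δ - ε) * X := by
          have : ε ≤ ε₀ := min_le_left _ _
          gcongr
        linarith [hcore.2.2.1]
      have hcard := g2 m hcm ((Nat.cast_le.2 hmk).trans (hEk.trans (mul_assoc K M L).ge))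
        (𝒞.filter fun C => #C = m) (by
          intro S hS
          obtain ⟨hS1, hS2⟩ := mem_filter.1 hS
          have := mem_cores.1 hS1
          exact ⟨hS2, this.1, fun e he => htc.trans (this.2.2.2 e he)⟩)
      have hqL : q = Real.exp (-L) := by
        rw [hLdef, one_div, Real.log_inv, neg_neg, Real.exp_log hp]
      calc ∑ C ∈ 𝒞 with #C = m, q ^ #C = ∑ C ∈ 𝒞 with #C = m, q ^ m :=
            sum_congr rfl fun C hC => by rw [(mem_filter.1 hC).2]
        _ = #(𝒞.filter fun C => #C = m) * q ^ m := by rw [sum_const, nsmul_eq_mul]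
        _ ≤ Real.exp (ε₁ * m * L) * q ^ m := by gcongr
        _ = Real.exp (-((1 - ε₁) * m * L)) := by
            rw [hqL, ← Real.exp_nat_mul, ← Real.exp_add]; congr 1; ring
        _ ≤ _ := by
            rw [Real.exp_le_exp, ← hε₁c]
            have : (1 - ε₁) * (c * M) * L ≤ (1 - ε₁) * m * L := by gcongr
            rw [hxdef]; linarith
  have hsecond : ∑ C ∈ 𝒞, q ^ #C ≤ (K * x + 1) * Real.exp (-((c + c₀) / 2 * x)) := by
    rw [← sum_fiberwise_of_maps_to (s := 𝒞) (t := range (E * k + 1)) (g := fun C => #C)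
      (fun C hC => mem_range.2 (Nat.lt_succ_of_le (mem_cores.1 hC).2.1))]
    refine (sum_le_sum hlevel).trans ?_
    rw [sum_const, card_range, nsmul_eq_mul]
    push_cast at hEk ⊢
    gcongr
  have hsplit : Real.exp (-(c₀ * x)) =
      Real.exp ((c - c₀) / 2 * x) * Real.exp (-((c + c₀) / 2 * x)) := by
    rw [← Real.exp_add]; congr 1; ring
  have hpos := Real.exp_pos (-((c + c₀) / 2 * x))
  rw [hsplit]
  calc _ ≤ Real.exp (-((c + c₀) / 2 * x)) + (K * x + 1) * Real.exp (-((c + c₀) / 2 * x)) :=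
        add_le_add hfirst hsecond
    _ = (K * x + 2) * Real.exp (-((c + c₀) / 2 * x)) := by ring
    _ ≤ ((K + 2) * x) * Real.exp (-((c + c₀) / 2 * x)) := by gcongr; linarith
    _ ≤ _ := by gcongr

end UpperBound

/-! ### Counting embeddings that meet a clique or a hub. -/

section Planting

variable {V : Type*} [Fintype V] [DecidableEq V] {H : SimpleGraph V} [DecidableRel H.Adj] {n : ℕ}

/-- The edges of the complete graph on `U`. -/
def cliqueEdges (U : Finset (Fin n)) : Finset (Sym2 (Fin n)) :=
  U.offDiag.image fun x => s(x.1, x.2)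

/-- The edges of the complete graph that touch `U`. -/
def hubEdges (U : Finset (Fin n)) : Finset (Sym2 (Fin n)) :=
  (touching U).filter fun e => ¬ e.IsDiag

lemma mem_cliqueEdges {U : Finset (Fin n)} {x y : Fin n} :
    s(x, y) ∈ cliqueEdges U ↔ x ∈ U ∧ y ∈ U ∧ x ≠ y := by
  simp only [cliqueEdges, mem_image, mem_offDiag, Prod.exists, Sym2.eq_iff]
  constructor
  · rintro ⟨a, b, ⟨h1, h2, h3⟩, ⟨rfl, rfl⟩ | ⟨rfl, rfl⟩⟩
    · exact ⟨h1, h2, h3⟩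
    · exact ⟨h2, h1, h3.symm⟩
  · rintro h
    exact ⟨x, y, h, Or.inl ⟨rfl, rfl⟩⟩

lemma mem_hubEdges {U : Finset (Fin n)} {x y : Fin n} :
    s(x, y) ∈ hubEdges U ↔ (x ∈ U ∨ y ∈ U) ∧ x ≠ y := by
  simp only [hubEdges, touching, mem_filter, mem_image, mem_product, mem_univ, and_true,
    Prod.exists, Sym2.eq_iff, Sym2.mk_isDiag_iff]
  refine and_congr_left fun _ => ⟨?_, ?_⟩
  · rintro ⟨a, b, h, ⟨rfl, rfl⟩ | ⟨rfl, rfl⟩⟩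
    · exact Or.inl h
    · exact Or.inr h
  · rintro (h | h)
    · exact ⟨x, y, h, Or.inl ⟨rfl, rfl⟩⟩
    · exact ⟨y, x, h, Or.inr ⟨rfl, rfl⟩⟩

lemma cliqueEdges_not_isDiag (U : Finset (Fin n)) : ∀ e ∈ cliqueEdges U, ¬ e.IsDiag := by
  intro e he
  induction e using Sym2.ind with
  | _ x y => simpa using (mem_cliqueEdges.1 he).2.2

lemma hubEdges_not_isDiag (U : Finset (Fin n)) : ∀ e ∈ hubEdges U, ¬ e.IsDiag :=
  fun _ he => (mem_filter.1 he).2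

lemma two_mul_card_cliqueEdges_le (U : Finset (Fin n)) :
    2 * (#(cliqueEdges U) : ℝ) ≤ (#U : ℝ) ^ 2 := by
  have h : #(cliqueEdges U) = (#U).choose 2 := Sym2.card_image_offDiag U
  rw [h, Nat.cast_choose_two]
  nlinarith [(#U).cast_nonneg (α := ℝ)]

lemma card_hubEdges_le (U : Finset (Fin n)) : #(hubEdges U) ≤ #U * n :=
  (card_filter_le _ _).trans (card_touching_le U)

/-- The number of embeddings into a set. -/
lemma descFactorial_le_card_embedding (U : Finset (Fin n)) :
    (#U).descFactorial (Fintype.card V) ≤ #{φ : V ↪ Fin n | ∀ a, φ a ∈ U} := by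
  have h : (#U).descFactorial (Fintype.card V) = Fintype.card (V ↪ U) := by
    rw [Fintype.card_embedding_eq, Fintype.card_coe]
  rw [h, ← card_univ]
  refine card_le_card_of_injOn (fun f => f.trans (Function.Embedding.subtype _)) ?_ ?_
  · intro f _
    simp
  · intro f _ g _ hfg
    ext a
    have := congrArg (fun φ : V ↪ Fin n => φ a) hfg
    exact congrArg (fun z : U => (z.1 : ℕ)) (by simpa using this)

/-- The number of embeddings such that exactly the vertices in `A` are mapped to `U`. -/
lemma descFactorial_mul_le_card_embedding (U : Finset (Fin n)) (A : Finset V) :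
    (#U).descFactorial #A * (n - #U).descFactorial (Fintype.card V - #A) ≤
      #{φ : V ↪ Fin n | univ.filter (fun a => φ a ∈ U) = A} := by
  classical
  have h : (#U).descFactorial #A * (n - #U).descFactorial (Fintype.card V - #A) =
      Fintype.card ((A ↪ U) × ((Aᶜ : Finset V) ↪ (Uᶜ : Finset (Fin n)))) := by
    rw [Fintype.card_prod, Fintype.card_embedding_eq, Fintype.card_embedding_eq, Fintype.card_coe,
      Fintype.card_coe, Fintype.card_coe, Fintype.card_coe, card_compl, card_compl,
      Fintype.card_fin]
  rw [h, ← card_univ]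
  let F : ((A ↪ U) × ((Aᶜ : Finset V) ↪ (Uᶜ : Finset (Fin n)))) → (V ↪ Fin n) := fun f =>
    { toFun := fun a => if ha : a ∈ A then (f.1 ⟨a, ha⟩ : Fin n)
        else (f.2 ⟨a, mem_compl.2 ha⟩ : Fin n)
      inj' := by
        intro a b hab
        by_cases ha : a ∈ A <;> by_cases hb : b ∈ A
        · simp only [ha, hb, dite_true] at hab
          simpa using f.1.injective (Subtype.ext hab)
        · simp only [ha, hb, dite_true, dite_false] at hab
          exact absurd (hab ▸ (f.1 ⟨a, ha⟩).2) (mem_compl.1 (f.2 ⟨b, mem_compl.2 hb⟩).2)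
        · simp only [ha, hb, dite_true, dite_false] at hab
          exact absurd (hab ▸ (f.1 ⟨b, hb⟩).2) (mem_compl.1 (f.2 ⟨a, mem_compl.2 ha⟩).2)
        · simp only [ha, hb, dite_false] at hab
          simpa using f.2.injective (Subtype.ext hab) }
  have hF1 : ∀ f a (ha : a ∈ A), F f a = f.1 ⟨a, ha⟩ := fun f a ha => dif_pos ha
  have hF2 : ∀ f a (ha : a ∉ A), F f a = f.2 ⟨a, mem_compl.2 ha⟩ := fun f a ha => dif_neg ha
  refine card_le_card_of_injOn F ?_ ?_
  · intro f _
    simp only [coe_filter, mem_univ, true_and, Set.mem_ofPred_eq]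
    ext a
    simp only [mem_filter, mem_univ, true_and]
    by_cases ha : a ∈ A
    · rw [hF1 f a ha]; simp [ha]
    · rw [hF2 f a ha]
      exact iff_of_false (mem_compl.1 (f.2 ⟨a, mem_compl.2 ha⟩).2) ha
  · rintro f _ g _ hfg
    have h1 : ∀ a, F f a = F g a := fun a => by rw [hfg]
    refine Prod.ext ?_ ?_
    · ext ⟨a, ha⟩
      have := h1 a
      rw [hF1 f a ha, hF1 g a ha] at this
      rw [this]
    · ext ⟨a, ha⟩
      have := h1 a
      rw [hF2 f a (mem_compl.1 ha), hF2 g a (mem_compl.1 ha)] at this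
      rw [this]

/-- Embeddings into `U` have weight `1` instead of `p ^ e(H)`; no other weight decreases. -/
lemma condSum_cliqueEdges_ge (U : Finset (Fin n)) {p : ℝ} (hp : 0 ≤ p) (hp1 : p ≤ 1) :
    condSum H (∅ : Finset (Sym2 (Fin n))) p +
      (1 - p ^ #H.edgeFinset) * (#U).descFactorial (Fintype.card V) ≤
        condSum H (cliqueEdges U) p := by
  have h0 : 0 ≤ 1 - p ^ #H.edgeFinset := by linarith [pow_le_one₀ hp hp1 (n := #H.edgeFinset)]
  have h1 : ((#U).descFactorial (Fintype.card V) : ℝ) ≤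
      ∑ φ : V ↪ Fin n, if ∀ a, φ a ∈ U then 1 else 0 := by
    rw [sum_boole]
    exact_mod_cast descFactorial_le_card_embedding U
  refine (add_le_add le_rfl (mul_le_mul_of_nonneg_left h1 h0)).trans ?_
  unfold condSum
  rw [mul_sum, ← sum_add_distrib]
  refine sum_le_sum fun φ _ => ?_
  rw [sdiff_empty, card_copyEdges]
  split_ifs with h
  · have : copyEdges H φ \ cliqueEdges U = ∅ := by
      rw [sdiff_eq_empty_iff_subset]
      intro e he
      have hd := copyEdges_not_isDiag φ e he
      simp only [copyEdges, mem_image] at he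
      obtain ⟨e', -, rfl⟩ := he
      induction e' using Sym2.ind with
      | _ a b =>
        rw [Sym2.map_mk] at hd ⊢
        exact mem_cliqueEdges.2 ⟨h a, h b, by simpa using hd⟩
    rw [this, card_empty]
    simp
  · rw [mul_zero, add_zero]
    refine pow_le_pow_of_le_one hp hp1 ?_
    rw [← card_copyEdges φ]
    exact card_le_card sdiff_subset

/-- Embeddings are classified by the set `A` of vertices sent into `U`. For independent `A`, the `Δ
* #A` star edges are all planted; the other sets are dropped. -/
lemma condSum_hubEdges_ge {Δ : ℕ} (hreg : H.IsRegularOfDegree Δ) (U : Finset (Fin n)) {p : ℝ}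
    (hp : 0 ≤ p) (hp1 : p ≤ 1) :
    ∑ A ∈ indepSets H, ((#U).descFactorial #A * (n - #U).descFactorial (Fintype.card V - #A) : ℕ) *
      p ^ (#H.edgeFinset - Δ * #A) ≤ condSum H (hubEdges U) p := by
  classical
  unfold condSum
  rw [← sum_fiberwise_of_maps_to (s := univ) (t := univ)
    (g := fun φ : V ↪ Fin n => univ.filter fun a => φ a ∈ U) (fun _ _ => mem_univ _)]
  refine le_trans (sum_le_sum fun A hA => ?_)
    (sum_le_sum_of_subset_of_nonneg (subset_univ (indepSets H)) fun _ _ _ =>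
      sum_nonneg fun _ _ => pow_nonneg hp _)
  refine le_trans (mul_le_mul_of_nonneg_right
    (Nat.cast_le.2 (descFactorial_mul_le_card_embedding U A)) (pow_nonneg hp _)) ?_
  rw [← nsmul_eq_mul, ← sum_const]
  refine sum_le_sum fun φ hφ => pow_le_pow_of_le_one hp hp1 ?_
  have hφA := (mem_filter.1 hφ).2
  rw [card_copyEdges_sdiff, ← card_starEdges hreg (mem_indepSets.1 hA)]
  refine Nat.sub_le_sub_left (card_le_card fun e he => ?_) _
  simp only [starEdges, pulled, mem_filter] at he ⊢
  obtain ⟨he, a, ha, b, rfl⟩ := he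
  refine ⟨he, ?_⟩
  rw [Sym2.map_mk]
  refine mem_hubEdges.2 ⟨Or.inl ?_, ?_⟩
  · rw [← hφA] at ha
    exact (mem_filter.1 ha).2
  · have := H.ne_of_adj (SimpleGraph.mem_edgeFinset.1 he)
    exact fun h => this (φ.injective h)

lemma tendsto_natCast_sub_div {x : ℕ → ℕ} {y : ℕ → ℝ} {α : ℝ} (hy : Tendsto y atTop atTop)
    (hx : Tendsto (fun n => (x n : ℝ) / y n) atTop (𝓝 α)) (k : ℕ) :
    Tendsto (fun n => ((x n - k : ℕ) : ℝ) / y n) atTop (𝓝 α) := by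
  have h1 : Tendsto (fun n => (x n : ℝ) / y n - k / y n) atTop (𝓝 α) := by
    have := hx.sub (hy.const_div_atTop (k : ℝ))
    rwa [sub_zero] at this
  refine tendsto_of_tendsto_of_tendsto_of_le_of_le' h1 hx ?_ ?_
  · filter_upwards [hy.eventually_gt_atTop 0] with n hn
    rw [← sub_div]
    gcongr
    rw [sub_le_iff_le_add]
    exact_mod_cast (show x n ≤ x n - k + k by omega)
  · filter_upwards [hy.eventually_gt_atTop 0] with n hn
    gcongr
    omega

lemma tendsto_descFactorial_div {x : ℕ → ℕ} {y : ℕ → ℝ} {α : ℝ} (hy : Tendsto y atTop atTop)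
    (hx : Tendsto (fun n => (x n : ℝ) / y n) atTop (𝓝 α)) (k : ℕ) :
    Tendsto (fun n => ((x n).descFactorial k : ℝ) / y n ^ k) atTop (𝓝 (α ^ k)) := by
  induction k with
  | zero => simp
  | succ k ih =>
    rw [pow_succ']
    refine ((tendsto_natCast_sub_div hy hx k).mul ih).congr fun n => ?_
    rw [Nat.descFactorial_succ, Nat.cast_mul, pow_succ', mul_div_mul_comm]

end Planting

/-! ### Lower bound on the tail by planting a clique or a hub. -/

section LowerBound

variable {V : Type*} [Fintype V] [DecidableEq V] {H : SimpleGraph V} [DecidableRel H.Adj]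
  {Δ : ℕ}

/-- Lower bound on the upper tail probability from planting. -/
lemma eventually_le_upperTailProb {p : ℕ → I} [Nonempty V] (hΔ : 2 ≤ Δ)
    (h : Admissible H Δ fun n => (p n : ℝ)) {δ c c₀ : ℝ} (hδ : 0 < δ) (hc : c < c₀)
    (hplant : ∃ ε > 0, ∀ᶠ n : ℕ in atTop, ∃ S : Finset (Sym2 (Fin n)), (∀ e ∈ S, ¬ e.IsDiag) ∧
      (#S : ℝ) ≤ c * ((n : ℝ) ^ 2 * (p n : ℝ) ^ Δ) ∧
      (1 + δ + ε) * condSum H (∅ : Finset (Sym2 (Fin n))) (p n) ≤ condSum H S (p n)) :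
    ∀ᶠ n : ℕ in atTop,
      Real.exp (-(c₀ * ((n : ℝ) ^ 2 * (p n : ℝ) ^ Δ * Real.log (1 / (p n : ℝ))))) ≤
        upperTailProb H δ n (p n) := by
  obtain ⟨ε, hε, hplant⟩ := hplant
  -- Half of the slack pays for the factor `p ^ e(H)` lost in `planting_bound`, where the count is
  -- bounded by the number of all embeddings; the other half pays for `ε`.
  have hb : 0 < (c₀ - c) / 2 := by linarith
  filter_upwards [hplant, h.pos, eventually_ge_atTop (Fintype.card V),
    ((h.tendsto_size hΔ).const_mul_atTop hb).eventually_ge_atTop (#H.edgeFinset : ℝ),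
    (((h.tendsto_size hΔ).atTop_mul_atTop₀ h.tendsto_log).const_mul_atTop hb).eventually_ge_atTop
      (-Real.log ε), h.tendsto_log.eventually_gt_atTop 0] with n ⟨S, hS, hcard, hX⟩ hp hn h1 h2 hL
  set q : ℝ := (p n : ℝ) with hq
  set L := Real.log (1 / q) with hLdef
  set M := (n : ℝ) ^ 2 * q ^ Δ with hM
  set X := condSum H (∅ : Finset (Sym2 (Fin n))) q with hXdef
  have hX0 : 0 < X := condSum_empty_pos hn hp
  have hplb := planting_bound (H := H) (p := p n) hS (T := (1 + δ) * X)
    (mul_nonneg (by linarith) hX0.le)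
  rw [← upperTailProb_eq] at hplb
  have hN : (0 : ℝ) < Fintype.card (V ↪ Fin n) := by
    rw [hXdef, condSum_empty] at hX0
    exact pos_of_mul_pos_left hX0 (by positivity)
  have h3 : Fintype.card (V ↪ Fin n) * (q ^ (#S + #H.edgeFinset) * ε) ≤
      Fintype.card (V ↪ Fin n) * upperTailProb H δ n (p n) := by
    refine le_trans ?_ hplb
    calc Fintype.card (V ↪ Fin n) * (q ^ (#S + #H.edgeFinset) * ε) = q ^ #S * (ε * X) := by
          rw [hXdef, condSum_empty, pow_add]; ring
      _ ≤ _ := by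
          refine mul_le_mul_of_nonneg_left ?_ (by positivity)
          linarith
  refine le_trans ?_ (le_of_mul_le_mul_left h3 hN)
  have hqL : q = Real.exp (-L) := by
    rw [hLdef, one_div, Real.log_inv, neg_neg, Real.exp_log hp]
  rw [hqL, ← Real.exp_nat_mul, ← Real.exp_log hε, ← Real.exp_add, Real.exp_le_exp]
  push_cast
  have h4 : (#S + #H.edgeFinset : ℝ) * L ≤ (c * M + (c₀ - c) / 2 * M) * L := by gcongr
  have h5 : (c * M + (c₀ - c) / 2 * M) * L + (c₀ - c) / 2 * (M * L) = c₀ * (M * L) := by ring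
  linarith

variable {p : ℕ → ℝ}

lemma Admissible.eventually_rpow (h : Admissible H Δ p) : ∀ᶠ n : ℕ in atTop,
    (p n ^ ((Δ : ℝ) / 2)) ^ 2 = p n ^ Δ := by
  filter_upwards [h.pos] with n hp
  rw [← Real.rpow_natCast, ← Real.rpow_mul hp.le, ← Real.rpow_natCast]
  congr 1
  push_cast
  ring

lemma Admissible.tendsto_rpow (hΔ : 2 ≤ Δ) (h : Admissible H Δ p) :
    Tendsto (fun n => p n ^ ((Δ : ℝ) / 2)) atTop (𝓝 0) := by
  have hΔ' : 0 < (Δ : ℝ) / 2 := by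
    have : (2 : ℝ) ≤ Δ := by exact_mod_cast hΔ
    linarith
  have := h.tendsto_zero.rpow_const (p := (Δ : ℝ) / 2) (Or.inr hΔ'.le)
  rwa [Real.zero_rpow hΔ'.ne'] at this

lemma Admissible.tendsto_root [Nonempty V] (hΔ : 2 ≤ Δ) (h : Admissible H Δ p) :
    Tendsto (fun n : ℕ => (n : ℝ) * p n ^ ((Δ : ℝ) / 2)) atTop atTop := by
  have h1 := Real.tendsto_sqrt_atTop.comp (h.tendsto_size hΔ)
  refine h1.congr' ?_
  filter_upwards [h.pos, h.eventually_rpow] with n hp h2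
  rw [Function.comp_apply, ← h2, ← mul_pow, Real.sqrt_sq (by positivity)]

lemma exists_card_eq {n a : ℕ} (h : a ≤ n) : ∃ U : Finset (Fin n), #U = a := by
  obtain ⟨U, -, hU⟩ := exists_subset_card_eq (s := (univ : Finset (Fin n))) (n := a)
    (by rwa [card_univ, Fintype.card_fin])
  exact ⟨U, hU⟩

lemma condSum_empty_le {n : ℕ} {q : ℝ} (hq : 0 ≤ q) :
    condSum H (∅ : Finset (Sym2 (Fin n))) q ≤ (n : ℝ) ^ Fintype.card V * q ^ #H.edgeFinset := by
  rw [condSum_empty, Fintype.card_embedding_eq, Fintype.card_fin]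
  gcongr
  exact_mod_cast Nat.descFactorial_le_pow _ _

/-- Planting a clique. -/
lemma exists_clique_planting (hΔ : 2 ≤ Δ) (hreg : H.IsRegularOfDegree Δ) [Nonempty V]
    (h : Admissible H Δ p) {δ c : ℝ} (hδ : 0 < δ)
    (hc : δ ^ ((2 : ℝ) / Fintype.card V) / 2 < c) :
    ∃ ε > 0, ∀ᶠ n : ℕ in atTop, ∃ S : Finset (Sym2 (Fin n)), (∀ e ∈ S, ¬ e.IsDiag) ∧
      (#S : ℝ) ≤ c * ((n : ℝ) ^ 2 * p n ^ Δ) ∧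
      (1 + δ + ε) * condSum H (∅ : Finset (Sym2 (Fin n))) (p n) ≤ condSum H S (p n) := by
  set v := Fintype.card V with hv
  have hv0 : 0 < v := Fintype.card_pos
  -- `α` lies slightly above `δ ^ (1 / v)`; the clique has about `α * n * p ^ (Δ / 2)` vertices.
  obtain ⟨α, hα0, hαδ, hαc⟩ : ∃ α : ℝ, 0 < α ∧ δ < α ^ v ∧ α ^ 2 / 2 < c := by
    set β := δ ^ (1 / (v : ℝ)) with hβ
    have hβ0 : 0 < β := by positivity
    have h1 : β ^ v = δ := by rw [hβ, one_div, Real.rpow_inv_natCast_pow hδ.le hv0.ne']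
    have h2 : β ^ 2 / 2 < c := by
      rw [hβ, ← Real.rpow_natCast, ← Real.rpow_mul hδ.le]
      refine lt_of_eq_of_lt ?_ hc
      congr 2
      push_cast
      ring
    have h3 : Tendsto (fun α : ℝ => α ^ 2 / 2) (𝓝[>] β) (𝓝 (β ^ 2 / 2)) :=
      (Continuous.tendsto (by fun_prop) β).mono_left nhdsWithin_le_nhds
    obtain ⟨α, hα, hα'⟩ := ((h3.eventually_lt_const h2).and self_mem_nhdsWithin).exists
    have hα' : β < α := hα'
    exact ⟨α, hβ0.trans hα', h1 ▸ pow_lt_pow_left₀ hα' hβ0.le hv0.ne', hα⟩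
  obtain ⟨δ', hδ1, hδ2⟩ := exists_between hαδ
  refine ⟨δ' - δ, by linarith, ?_⟩
  set y : ℕ → ℝ := fun n => (n : ℝ) * p n ^ ((Δ : ℝ) / 2) with hy
  have hytop : Tendsto y atTop atTop := h.tendsto_root hΔ
  set a : ℕ → ℕ := fun n => ⌈α * y n⌉₊ with ha
  have hay : Tendsto (fun n => (a n : ℝ) / y n) atTop (𝓝 α) :=
    (tendsto_nat_ceil_mul_div_atTop hα0.le).comp hytop
  have han : Tendsto (fun n : ℕ => (a n : ℝ) / n) atTop (𝓝 0) := by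
    have := hay.mul (h.tendsto_rpow hΔ)
    rw [mul_zero] at this
    refine this.congr' ?_
    filter_upwards [hytop.eventually_gt_atTop 0, eventually_gt_atTop 0] with n hy0 hn
    have hn0 : (0 : ℝ) < n := by exact_mod_cast hn
    have : p n ^ ((Δ : ℝ) / 2) = y n / n := by rw [hy]; field_simp
    rw [this]
    field_simp
  have hE := card_edgeFinset_pos hΔ hreg
  have hfac : Tendsto (fun n => (1 - p n ^ #H.edgeFinset) *
      (((a n).descFactorial v : ℝ) / y n ^ v)) atTop (𝓝 ((1 - 0 ^ #H.edgeFinset) * α ^ v)) :=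
    ((h.tendsto_zero.pow _).const_sub 1).mul (tendsto_descFactorial_div hytop hay v)
  rw [zero_pow hE.ne', sub_zero, one_mul] at hfac
  have hsq : Tendsto (fun n => ((a n : ℝ) / y n) ^ 2 / 2) atTop (𝓝 (α ^ 2 / 2)) :=
    (hay.pow 2).div_const 2
  filter_upwards [h.pos, h.lt_one, hytop.eventually_gt_atTop 0, eventually_gt_atTop 0,
    han.eventually_lt_const one_pos, hfac.eventually_const_lt hδ2, hsq.eventually_lt_const hαc,
    h.eventually_rpow] with n hp hp1 hy0 hn han' hfac' hsq' hroot
  have hn0 : (0 : ℝ) < n := by exact_mod_cast hn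
  have hyM : y n ^ 2 = (n : ℝ) ^ 2 * p n ^ Δ := by rw [← hroot, hy, mul_pow]
  rw [div_lt_one hn0] at han'
  obtain ⟨U, hU⟩ := exists_card_eq (n := n) (a := a n) (by exact_mod_cast han'.le)
  refine ⟨cliqueEdges U, cliqueEdges_not_isDiag U, ?_, ?_⟩
  · have h1 := two_mul_card_cliqueEdges_le U
    rw [hU] at h1
    rw [div_pow, div_div, div_lt_iff₀ (by positivity)] at hsq'
    rw [← hyM]
    linarith
  · have h1 := condSum_cliqueEdges_ge (H := H) U hp.le hp1.le
    rw [hU] at h1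
    have h2 : condSum H (∅ : Finset (Sym2 (Fin n))) (p n) ≤ y n ^ v := by
      refine (condSum_empty_le hp.le).trans (le_of_eq ?_)
      rw [hy, mul_pow]
      congr 1
      rw [← Real.rpow_natCast, ← Real.rpow_natCast, ← Real.rpow_mul hp.le]
      congr 1
      have : (2 * #H.edgeFinset : ℝ) = Δ * v := by exact_mod_cast two_mul_card_edges hreg
      linarith
    rw [← mul_div_assoc, lt_div_iff₀ (by positivity)] at hfac'
    have h3 : δ' * condSum H (∅ : Finset (Sym2 (Fin n))) (p n) ≤ δ' * y n ^ v :=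
      mul_le_mul_of_nonneg_left h2 (by linarith)
    calc _ = condSum H (∅ : Finset (Sym2 (Fin n))) (p n) +
          δ' * condSum H (∅ : Finset (Sym2 (Fin n))) (p n) := by ring
      _ ≤ _ := by linarith

/-- Planting a hub. -/
lemma exists_hub_planting (hΔ : 2 ≤ Δ) (hreg : H.IsRegularOfDegree Δ) [Nonempty V]
    (h : Admissible H Δ p) (hdense : Tendsto (fun n : ℕ => (n : ℝ) * p n ^ Δ) atTop atTop)
    {δ θ c : ℝ} (hθ0 : 0 < θ) (hθ : indepSum H θ = δ) (hc : θ < c) :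
    ∃ ε > 0, ∀ᶠ n : ℕ in atTop, ∃ S : Finset (Sym2 (Fin n)), (∀ e ∈ S, ¬ e.IsDiag) ∧
      (#S : ℝ) ≤ c * ((n : ℝ) ^ 2 * p n ^ Δ) ∧
      (1 + δ + ε) * condSum H (∅ : Finset (Sym2 (Fin n))) (p n) ≤ condSum H S (p n) := by
  set v := Fintype.card V with hv
  obtain ⟨α, hα1, hα2⟩ := exists_between hc
  have hα0 : 0 < α := hθ0.trans hα1
  have hlt : δ < indepSum H α := hθ ▸ strictMonoOn_indepSum H hθ0.le hα0.le hα1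
  obtain ⟨δ', hδ1, hδ2⟩ := exists_between hlt
  have hδ0 : 0 ≤ δ := hθ ▸ indepSum_nonneg H hθ0.le
  refine ⟨δ' - δ, by linarith, ?_⟩
  set y : ℕ → ℝ := fun n => (n : ℝ) * p n ^ Δ with hy
  have hytop : Tendsto y atTop atTop := hdense
  -- The number of hub vertices; rounding is negligible because `n * p ^ Δ → ∞`.
  set a : ℕ → ℕ := fun n => ⌈α * y n⌉₊ with ha
  have hay : Tendsto (fun n => (a n : ℝ) / y n) atTop (𝓝 α) :=
    (tendsto_nat_ceil_mul_div_atTop hα0.le).comp hytop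
  have han : Tendsto (fun n : ℕ => (a n : ℝ) / n) atTop (𝓝 0) := by
    have := hay.mul (h.tendsto_zero.pow Δ)
    rw [zero_pow (by omega), mul_zero] at this
    refine this.congr' ?_
    filter_upwards [hytop.eventually_gt_atTop 0, eventually_gt_atTop 0] with n hy0 hn
    have hn0 : (0 : ℝ) < n := by exact_mod_cast hn
    have : p n ^ Δ = y n / n := by rw [hy]; field_simp
    rw [this]
    field_simp
  have hsub : Tendsto (fun n : ℕ => ((n - a n : ℕ) : ℝ) / n) atTop (𝓝 1) := by
    have := han.const_sub 1
    rw [sub_zero] at this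
    refine this.congr' ?_
    filter_upwards [eventually_gt_atTop 0, han.eventually_lt_const one_pos] with n hn h1
    have hn0 : (0 : ℝ) < n := by exact_mod_cast hn
    rw [div_lt_one hn0] at h1
    rw [Nat.cast_sub (by exact_mod_cast h1.le), sub_div, div_self hn0.ne']
  -- The relative contribution of `A` tends to `α ^ #A`, so the expectation is multiplied by at
  -- least about `P_H(α)`.
  have hfac : Tendsto (fun n : ℕ => ∑ A ∈ indepSets H, ((a n).descFactorial #A : ℝ) / y n ^ #A *
      (((n - a n).descFactorial (v - #A) : ℝ) / (n : ℝ) ^ (v - #A))) atTop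
      (𝓝 (∑ A ∈ indepSets H, α ^ #A * 1 ^ (v - #A))) :=
    tendsto_finsetSum _ fun A _ => (tendsto_descFactorial_div hytop hay _).mul
      (tendsto_descFactorial_div tendsto_natCast_atTop_atTop hsub _)
  simp only [one_pow, mul_one] at hfac
  rw [sum_indepSets] at hfac
  filter_upwards [h.pos, h.lt_one, hytop.eventually_gt_atTop 0, eventually_gt_atTop 0,
    han.eventually_lt_const one_pos,
    hfac.eventually_const_lt (show 1 + δ' < 1 + indepSum H α by linarith),
    hay.eventually_lt_const hα2] with n hp hp1 hy0 hn han' hfac' hc'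
  have hn0 : (0 : ℝ) < n := by exact_mod_cast hn
  rw [div_lt_one hn0] at han'
  obtain ⟨U, hU⟩ := exists_card_eq (n := n) (a := a n) (by exact_mod_cast han'.le)
  refine ⟨hubEdges U, hubEdges_not_isDiag U, ?_, ?_⟩
  · have h1 : (#(hubEdges U) : ℝ) ≤ a n * n := by rw [← hU]; exact_mod_cast card_hubEdges_le U
    rw [div_lt_iff₀ hy0] at hc'
    calc (#(hubEdges U) : ℝ) ≤ a n * n := h1
      _ ≤ c * y n * n := by gcongr
      _ = _ := by rw [hy]; ring
  · have h1 := condSum_hubEdges_ge hreg U hp.le hp1.le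
    rw [hU] at h1
    refine le_trans ?_ h1
    have h2 : condSum H (∅ : Finset (Sym2 (Fin n))) (p n) ≤ (n : ℝ) ^ v * p n ^ #H.edgeFinset :=
      condSum_empty_le hp.le
    calc (1 + δ + (δ' - δ)) * condSum H (∅ : Finset (Sym2 (Fin n))) (p n)
        = (1 + δ') * condSum H (∅ : Finset (Sym2 (Fin n))) (p n) := by ring
      _ ≤ (1 + δ') * ((n : ℝ) ^ v * p n ^ #H.edgeFinset) :=
          mul_le_mul_of_nonneg_left h2 (by linarith)
      _ ≤ (∑ A ∈ indepSets H, ((a n).descFactorial #A : ℝ) / y n ^ #A *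
          (((n - a n).descFactorial (v - #A) : ℝ) / (n : ℝ) ^ (v - #A))) *
            ((n : ℝ) ^ v * p n ^ #H.edgeFinset) :=
          mul_le_mul_of_nonneg_right hfac'.le (by positivity)
      _ = _ := by
          rw [sum_mul]
          refine sum_congr rfl fun A hA => ?_
          have hAv : #A ≤ v := card_le_univ A
          have hAE : Δ * #A ≤ #H.edgeFinset := by
            rw [← card_starEdges hreg (mem_indepSets.1 hA)]
            exact card_le_card (filter_subset _ _)
          have e1 : (n : ℝ) ^ v = (n : ℝ) ^ #A * (n : ℝ) ^ (v - #A) := by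
            rw [← pow_add]; congr 1; omega
          have e2 : p n ^ #H.edgeFinset = (p n ^ Δ) ^ #A * p n ^ (#H.edgeFinset - Δ * #A) := by
            rw [← pow_mul, ← pow_add]; congr 1; omega
          rw [e1, e2, hy]
          push_cast
          rw [mul_pow]
          field_simp
          rw [hv]

end LowerBound

/-! ### Assembling the two regimes. -/

section Limits

variable {V : Type*} [Fintype V] [DecidableEq V] {H : SimpleGraph V} [DecidableRel H.Adj]
  {Δ : ℕ} {p : ℕ → I}

/-- Squaring converts the bounds on `p ^ (Δ / 2)` into bounds on `p ^ Δ`. In the bipartite case this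
gives `n * p ^ Δ ≥ n ^ (-2 ε_n)`, which exceeds `n ^ (-κ)` once `ε_n < κ / 2`. -/
lemma Admissible.of_isLittleO [Nonempty V] (hΔ : 2 ≤ Δ)
    (h1 : (fun n : ℕ => (n : ℝ)⁻¹ * Real.log n ^ (Δ * Fintype.card V ^ 2))
      =o[atTop] fun n => (p n : ℝ) ^ ((Δ : ℝ) / 2))
    (h2 : (fun n => (p n : ℝ) ^ ((Δ : ℝ) / 2)) =o[atTop] fun _ : ℕ => (1 : ℝ))
    (h3 : ¬ H.IsBipartite ∨ ∃ ε : ℕ → ℝ, Tendsto ε atTop (𝓝 0) ∧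
      ∀ᶠ n : ℕ in atTop, (n : ℝ) ^ (-(1 / 2 : ℝ) - ε n) ≤ (p n : ℝ) ^ ((Δ : ℝ) / 2)) :
    Admissible H Δ fun n => (p n : ℝ) := by
  have hΔ' : (0 : ℝ) < Δ := by
    have : 0 < Δ := by omega
    exact_mod_cast this
  have hp0 : ∀ n, (0 : ℝ) ≤ p n := fun n => (p n).2.1
  have hsq : ∀ n, ((p n : ℝ) ^ ((Δ : ℝ) / 2)) ^ 2 = (p n : ℝ) ^ Δ := by
    intro n
    rw [← Real.rpow_natCast, ← Real.rpow_mul (hp0 n), ← Real.rpow_natCast]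
    congr 1
    push_cast
    ring
  have hle : ∀ᶠ n : ℕ in atTop, (n : ℝ)⁻¹ * Real.log n ^ (Δ * Fintype.card V ^ 2) ≤
      (p n : ℝ) ^ ((Δ : ℝ) / 2) := by
    filter_upwards [h1.bound one_pos] with n hn
    rw [one_mul, Real.norm_of_nonneg (Real.rpow_nonneg (hp0 n) _)] at hn
    exact (le_abs_self _).trans hn
  refine ⟨?_, ?_, ?_, ?_⟩
  · filter_upwards [hle, eventually_gt_atTop 1] with n hn hn1
    refine lt_of_le_of_ne (hp0 n) fun h => ?_
    rw [← h, Real.zero_rpow (by positivity)] at hn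
    have : 0 < Real.log n := Real.log_pos (by exact_mod_cast hn1)
    have : (0 : ℝ) < n := by positivity
    have : 0 < (n : ℝ)⁻¹ * Real.log n ^ (Δ * Fintype.card V ^ 2) := by positivity
    linarith
  · have h := ((isLittleO_one_iff ℝ).1 h2).rpow_const (p := 2 / (Δ : ℝ)) (Or.inr (by positivity))
    rw [Real.zero_rpow (by positivity)] at h
    refine h.congr fun n => ?_
    rw [← Real.rpow_mul (hp0 n)]
    have : (Δ : ℝ) / 2 * (2 / Δ) = 1 := by field_simp
    rw [this, Real.rpow_one]
  · filter_upwards [hle, eventually_gt_atTop 0] with n hn hn0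
    have hn0' : (0 : ℝ) < n := by exact_mod_cast hn0
    rw [← hsq, ← mul_pow, mul_assoc 2, mul_comm 2, pow_mul]
    have hlog : 0 ≤ Real.log n := Real.log_natCast_nonneg n
    refine pow_le_pow_left₀ (by positivity) ?_ 2
    rwa [inv_mul_le_iff₀ hn0'] at hn
  · intro κ hκ
    rcases h3 with h3 | ⟨ε, hε, h3⟩
    · exact Eventually.of_forall fun n => Or.inr h3
    · filter_upwards [h3, hε.eventually_lt_const (show 0 < κ / 2 by positivity),
        eventually_gt_atTop 0] with n hn hεn hn0
      left
      have hn0' : (0 : ℝ) < n := by exact_mod_cast hn0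
      have hlog : 0 ≤ Real.log n := Real.log_natCast_nonneg n
      have h4 := pow_le_pow_left₀ (by positivity) hn 2
      rw [hsq, Real.rpow_def_of_pos hn0', ← Real.exp_nat_mul] at h4
      calc Real.exp (-(κ * Real.log n))
          ≤ Real.exp (Real.log n +
            (2 : ℕ) * (Real.log n * (-(1 / 2 : ℝ) - ε n))) := by
            rw [Real.exp_le_exp]
            have := mul_le_mul_of_nonneg_right hεn.le hlog
            push_cast
            linarith
        _ = n * Real.exp ((2 : ℕ) * (Real.log n * (-(1 / 2 : ℝ) - ε n))) := by
            rw [Real.exp_add, Real.exp_log hn0']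
        _ ≤ _ := by gcongr

lemma tendsto_neg_log_div {P x : ℕ → ℝ} {c : ℝ} (hc : 0 < c) (hx : ∀ᶠ n in atTop, 0 < x n)
    (hupper : ∀ a, 0 < a → a < c → ∀ᶠ n in atTop, P n ≤ Real.exp (-(a * x n)))
    (hlower : ∀ a, c < a → ∀ᶠ n in atTop, Real.exp (-(a * x n)) ≤ P n) :
    Tendsto (fun n => -Real.log (P n) / x n) atTop (𝓝 c) := by
  refine tendsto_order.2 ⟨fun a ha => ?_, fun a ha => ?_⟩
  · obtain ⟨b, hb1, hb2⟩ := exists_between (max_lt ha hc)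
    -- The lower bound on `P`, here with `c + 1`, only guarantees `P n > 0`: with `Real.log 0 = 0`
    -- the upper bound alone would not suffice.
    filter_upwards [hx, hupper b ((le_max_right _ _).trans_lt hb1) hb2,
      hlower (c + 1) (by linarith)] with n h1 h2 h3
    have hP : 0 < P n := (Real.exp_pos _).trans_le h3
    have h4 := (Real.log_le_iff_le_exp hP).2 h2
    rw [lt_div_iff₀ h1]
    have : a * x n < b * x n := mul_lt_mul_of_pos_right ((le_max_left _ _).trans_lt hb1) h1
    linarith
  · obtain ⟨b, hb1, hb2⟩ := exists_between ha
    filter_upwards [hx, hlower b hb1] with n h1 h2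
    have hP : 0 < P n := (Real.exp_pos _).trans_le h2
    have h4 := (Real.le_log_iff_exp_le hP).2 h2
    rw [div_lt_iff₀ h1]
    have : b * x n < a * x n := mul_lt_mul_of_pos_right hb2 h1
    linarith

lemma Admissible.eventually_scale_pos (h : Admissible H Δ fun n => (p n : ℝ)) :
    ∀ᶠ n : ℕ in atTop, 0 < (n : ℝ) ^ 2 * (p n : ℝ) ^ Δ * Real.log (1 / (p n : ℝ)) := by
  filter_upwards [h.pos, h.tendsto_log.eventually_gt_atTop 0, eventually_gt_atTop 0] with n hp hL hn
  have hn0 : (0 : ℝ) < n := by exact_mod_cast hn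
  positivity

lemma two_mul_rpow_lt [Nonempty V] {δ c : ℝ} (hδ : 0 < δ) (hc0 : 0 < c)
    (hc : c < δ ^ ((2 : ℝ) / Fintype.card V) / 2) :
    (2 * c) ^ ((Fintype.card V : ℝ) / 2) < δ := by
  have hv : (0 : ℝ) < Fintype.card V := by exact_mod_cast Fintype.card_pos
  calc (2 * c) ^ ((Fintype.card V : ℝ) / 2)
      < (δ ^ ((2 : ℝ) / Fintype.card V)) ^ ((Fintype.card V : ℝ) / 2) :=
        Real.rpow_lt_rpow (by positivity) (by linarith) (by positivity)
    _ = δ := by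
        rw [← Real.rpow_mul hδ.le]
        have : (2 : ℝ) / Fintype.card V * (Fintype.card V / 2) = 1 := by field_simp
        rw [this, Real.rpow_one]

/-- The sparse regime. -/
lemma tendsto_of_sparse (hΔ : 2 ≤ Δ) (hreg : H.IsRegularOfDegree Δ) (hconn : H.Connected)
    (h : Admissible H Δ fun n => (p n : ℝ)) {δ : ℝ} (hδ : 0 < δ)
    (hsparse : Tendsto (fun n : ℕ => (n : ℝ) * (p n : ℝ) ^ Δ) atTop (𝓝 0)) :
    Tendsto (fun n : ℕ => -Real.log (upperTailProb H δ n (p n)) /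
      ((n : ℝ) ^ 2 * (p n : ℝ) ^ Δ * Real.log (1 / (p n : ℝ))))
      atTop (𝓝 (δ ^ ((2 : ℝ) / Fintype.card V) / 2)) := by
  have := hconn.nonempty
  refine tendsto_neg_log_div (by positivity) h.eventually_scale_pos (fun a ha hac => ?_)
    fun a ha => ?_
  · obtain ⟨b, hab, hbc⟩ := exists_between hac
    obtain ⟨c, hbc, hc⟩ := exists_between hbc
    refine eventually_upperTailProb_le hΔ hreg hconn h hδ ha hab ?_
    have hb0 : 0 < b := ha.trans hab
    obtain ⟨ε, hε, p₀, hp₀, hev⟩ := condSum_lt_of_card_le_of_sparse hΔ hreg hconn hb0 hbc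
      (two_mul_rpow_lt hδ (hb0.trans hbc) hc)
    refine ⟨ε, hε, ?_⟩
    filter_upwards [hev, h.pos, h.tendsto_zero.eventually_lt_const hp₀,
      hsparse.eventually_lt_const hp₀] with n h1 h2 h3 h4
    exact h1 _ h2 h3 h4
  · obtain ⟨b, hb, hba⟩ := exists_between ha
    exact eventually_le_upperTailProb hΔ h hδ hba (exists_clique_planting hΔ hreg h hδ hb)

/-- The dense regime. -/
lemma tendsto_of_dense (hΔ : 2 ≤ Δ) (hreg : H.IsRegularOfDegree Δ) (hconn : H.Connected)
    (h : Admissible H Δ fun n => (p n : ℝ)) {δ θ : ℝ} (hδ : 0 < δ) (hθ0 : 0 < θ)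
    (hθ : indepSum H θ = δ)
    (hdense : Tendsto (fun n : ℕ => (n : ℝ) * (p n : ℝ) ^ Δ) atTop atTop) :
    Tendsto (fun n : ℕ => -Real.log (upperTailProb H δ n (p n)) /
      ((n : ℝ) ^ 2 * (p n : ℝ) ^ Δ * Real.log (1 / (p n : ℝ))))
      atTop (𝓝 (min (δ ^ ((2 : ℝ) / Fintype.card V) / 2) θ)) := by
  have := hconn.nonempty
  refine tendsto_neg_log_div (lt_min (by positivity) hθ0) h.eventually_scale_pos
    (fun a ha hac => ?_) fun a ha => ?_
  · obtain ⟨b, hab, hbc⟩ := exists_between hac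
    obtain ⟨c, hbc, hc⟩ := exists_between hbc
    refine eventually_upperTailProb_le hΔ hreg hconn h hδ ha hab ?_
    have hb0 : 0 < b := ha.trans hab
    have hc0 : 0 < c := hb0.trans hbc
    obtain ⟨ε, hε, p₀, hp₀, hev⟩ := condSum_lt_of_card_le hΔ hreg hconn hb0 hbc
      (hθ ▸ strictMonoOn_indepSum H hc0.le hθ0.le (hc.trans_le (min_le_right _ _)))
      (two_mul_rpow_lt hδ hc0 (hc.trans_le (min_le_left _ _)))
    refine ⟨ε, hε, ?_⟩
    filter_upwards [hev, h.pos, h.tendsto_zero.eventually_lt_const hp₀] with n h1 h2 h3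
    exact h1 _ h2 h3
  · obtain ⟨b, hb, hba⟩ := exists_between ha
    refine eventually_le_upperTailProb hΔ h hδ hba ?_
    rcases min_lt_iff.1 hb with hb | hb
    · exact exists_clique_planting hΔ hreg h hδ hb
    · exact exists_hub_planting hΔ hreg h hdense hθ0 hθ hb

end Limits

end UpperTail

theorem theorem1p5 {V : Type*} [Fintype V] [DecidableEq V]
    (H : SimpleGraph V) [DecidableRel H.Adj] (Δ : ℕ) (hΔ : 2 ≤ Δ)
    (hconn : H.Connected) (hreg : H.IsRegularOfDegree Δ) (δ : ℝ) (hδ : 0 < δ) :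
    ∃ θ : ℝ, (0 < θ ∧ (independencePolynomial H).eval θ = 1 + δ ∧
        ∀ θ' : ℝ, 0 < θ' → (independencePolynomial H).eval θ' = 1 + δ → θ' = θ) ∧
      ∀ p : ℕ → I,
        ((fun n : ℕ => (n : ℝ)⁻¹ * Real.log n ^ (Δ * Fintype.card V ^ 2))
          =o[atTop] fun n => (p n : ℝ) ^ ((Δ : ℝ) / 2)) →
        ((fun n => (p n : ℝ) ^ ((Δ : ℝ) / 2)) =o[atTop] fun _ : ℕ => (1 : ℝ)) →
        (¬ H.IsBipartite ∨
          ∃ ε : ℕ → ℝ, Tendsto ε atTop (𝓝 0) ∧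
            ∀ᶠ n : ℕ in atTop, (n : ℝ) ^ (-(1 / 2 : ℝ) - ε n) ≤ (p n : ℝ) ^ ((Δ : ℝ) / 2)) →
        (Tendsto (fun n : ℕ => (n : ℝ) * (p n : ℝ) ^ Δ) atTop (𝓝 0) →
          Tendsto (fun n : ℕ => -Real.log (upperTailProb H δ n (p n)) /
              ((n : ℝ) ^ 2 * (p n : ℝ) ^ Δ * Real.log (1 / (p n : ℝ))))
            atTop (𝓝 (δ ^ ((2 : ℝ) / Fintype.card V) / 2))) ∧
        (Tendsto (fun n : ℕ => (n : ℝ) * (p n : ℝ) ^ Δ) atTop atTop →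
          Tendsto (fun n : ℕ => -Real.log (upperTailProb H δ n (p n)) /
              ((n : ℝ) ^ 2 * (p n : ℝ) ^ Δ * Real.log (1 / (p n : ℝ))))
            atTop (𝓝 (min (δ ^ ((2 : ℝ) / Fintype.card V) / 2) θ))) := by
  have := hconn.nonempty
  obtain ⟨θ, hθ0, hθ⟩ := UpperTail.exists_indepSum_eq H hδ
  refine ⟨θ, ⟨hθ0, ?_, fun θ' hθ'0 hθ' => ?_⟩, fun p h1 h2 h3 => ?_⟩
  · rw [UpperTail.eval_independencePolynomial, hθ]
  · rw [UpperTail.eval_independencePolynomial] at hθ'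
    exact (UpperTail.strictMonoOn_indepSum H).injOn hθ'0.le hθ0.le (by linarith)
  · have h := UpperTail.Admissible.of_isLittleO hΔ h1 h2 h3
    exact ⟨UpperTail.tendsto_of_sparse hΔ hreg hconn h hδ,
      UpperTail.tendsto_of_dense hΔ hreg hconn h hδ hθ0 hθ⟩
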